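/- Fix real numbers $m_{11},m_{22},m_{33}$, $m_{12},m_{23},m_{31}>0$, $\varphi_{11},\varphi_{22},\varphi_{33},\varphi_{12},\varphi_{23},\varphi_{31}$ and $\hbar>0$. For $\tilde E=(\tilde E_1,\tilde E_2,\tilde E_3)\in\mathbb R^3$ and $\theta=(\theta_1,\theta_2)\in(\mathbb R/2\pi\mathbb Z)^2$ let $A(\theta)$ be the Hermitian $3\times3$ matrix with diagonal entries $a_{ii}=\tilde E_i+m_{ii}\cos(\varphi_{ii}-\theta_1)$ and off-diagonal entries $a_{12}=m_{12}e^{i\varphi_{12}}$, $a_{23}=m_{23}e^{i\varphi_{23}}$, $a_{31}=m_{31}e^{i(\varphi_{31}-\theta_2)}$ (so $a_{13}=\overline{a_{31}}$ and $m_{13}=m_{31}$). Let $E_1(\theta)\le E_2(\theta)\le E_3(\theta)$ be its eigenvalues, and put $$\gamma=(\gamma_1,\gamma_2)=\Big(\frac{\tilde E_1-\tilde E_3}{\hbar},\frac{\tilde E_2-\tilde E_3}{\hbar}\Big),\qquad \Theta=\varphi_{12}+\varphi_{23}+\varphi_{31}-\theta_2 .$$ For $i=1,2$ put $K_i=\sqrt{m_{ii}^2+m_{33}^2-2m_{ii}m_{33}\cos(\varphi_{ii}-\varphi_{33})}$,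 let $\alpha_i$ be the argument of $m_{33}e^{i\varphi_{33}}-m_{ii}e^{i\varphi_{ii}}$, a complex number of modulus $K_i$ ($\alpha_i=0$ if $K_i=0$), let $\eta=\alpha_1-\alpha_2$, and $$Y_1=m_{13}\Big(\frac{m_{12}}{m_{23}}-\frac{m_{23}}{m_{12}}\Big),\qquad Y_2=m_{23}\Big(\frac{m_{12}}{m_{13}}-\frac{m_{13}}{m_{12}}\Big).$$ For $s=\pm1$ let $\mathcal E_s$ be the curve $$\gamma_1(t)=\frac{K_1\cos(t-\eta)+sY_1}{\hbar},\qquad \gamma_2(t)=\frac{K_2\cos t+sY_2}{\hbar}\qquad(t\in\mathbb R).$$ (1) Degeneracies. $E_1(\theta)=E_2(\theta)$ if and only if $e^{i\Theta}=1$ and $\gamma$ is the point of $\mathcal E_1$ with parameter $t=\theta_1-\alpha_2$. Likewise $E_2(\theta)=E_3(\theta)$ if and only if $e^{i\Theta}=-1$ and $\gamma$ is the point of $\mathcal E_{-1}$ with parameter $t=\theta_1-\alpha_2$. Hence in the plane $(\gamma_1,\gamma_2)$ the set of parameters for which levels $1,2$ (respectively $2,3$) are degenerate for some $\theta$ is exactly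 $\mathcal E_1$ (respectively $\mathcal E_{-1}$). (2) Ellipses. Write $x=\hbar\gamma_1-sY_1$, $y=\hbar\gamma_2-sY_2$ and $$Q_s(\gamma)=K_2^2x^2-2K_1K_2\cos\eta\;xy+K_1^2y^2-(K_1K_2\sin\eta)^2 .$$ If $K_1K_2\sin\eta\ne0$, then $\mathcal E_s$ is the ellipse $\{Q_s=0\}$, whose inside is $\{Q_s<0\}$. If $K_1=K_2$, then $\mathcal E_s$ is symmetric under the reflections $(\gamma_1,\gamma_2)\mapsto$ "$(\gamma_2,\gamma_1)$" and "$(-\gamma_2,-\gamma_1)$" taken relative to its centre $(sY_1,sY_2)/\hbar$, i.e. its axes are parallel to $\gamma_1=\pm\gamma_2$. (3) Chern indices. For a level $n$ that is nondegenerate for all $\theta$ let $$C_n=\frac{i}{2\pi}\int_0^{2\pi}\!\!\int_0^{2\pi}\big(\langle\partial_{\theta_1}\psi_n|\partial_{\theta_2}\psi_n\rangle-\langle\partial_{\theta_2}\psi_n|\partial_{\theta_1}\psi_n\rangle\big)\,d\theta_2\,d\theta_1 ,$$ where $\psi_n$ denotes local smooth families of unit eigenvectors (the integrand does not depend on their choice).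 Let $c_s(\gamma)=\operatorname{sign}(\sin\eta)$ if $\gamma$ is inside $\mathcal E_s$ (that is, $Q_s(\gamma)<0$) and $c_s(\gamma)=0$ otherwise. Then level $1$ is nondegenerate for all $\theta$ with $C_1=c_1(\gamma)$ whenever $\gamma\notin\mathcal E_1$; level $3$ is nondegenerate for all $\theta$ with $C_3=c_{-1}(\gamma)$ whenever $\gamma\notin\mathcal E_{-1}$; and level $2$ is nondegenerate for all $\theta$ with $C_2=-c_1(\gamma)-c_{-1}(\gamma)$ whenever $\gamma\notin\mathcal E_1\cup\mathcal E_{-1}$. In particular all Chern indices vanish outside both ellipses, and, when $K_1K_2\sin\eta\ne0$, crossing $\mathcal E_1$ changes $(C_1,C_2)$ by $\pm(1,-1)$ and crossing $\mathcal E_{-1}$ changes $(C_2,C_3)$ by $\pm(-1,1)$, the other index being unchanged. -/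

import Mathlib

open scoped ContDiff InnerProductSpace

/-! ### Bands and Chern indices of a family of Hermitian `3 × 3` matrices over the torus -/

/-- The `n`-th eigenvalue of a Hermitian `3 × 3` matrix, counted with multiplicity, in
*increasing* order (`n = 0, 1, 2` are the levels `1, 2, 3`). Mathlib's `eigenvalues₀` is
decreasing, hence `Fin.rev`. -/
noncomputable def bandEnergy {A : Matrix (Fin 3) (Fin 3) ℂ} (hA : A.IsHermitian) (n : Fin 3) : ℝ :=
  hA.eigenvalues₀ (Fin.cast (Fintype.card_fin 3).symm n.rev)

/-- `ψ` is, near the point `θ`, a smooth family of unit eigenvectors for the level `n`. -/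
def IsLocalEigenvector {A : ℝ × ℝ → Matrix (Fin 3) (Fin 3) ℂ} (hA : ∀ θ, (A θ).IsHermitian)
    (n : Fin 3) (θ : ℝ × ℝ) (ψ : ℝ × ℝ → EuclideanSpace ℂ (Fin 3)) : Prop :=
  ContDiffAt ℝ ∞ ψ θ ∧
    ∀ᶠ x in nhds θ, ‖ψ x‖ = 1 ∧
      Matrix.toEuclideanLin (A x) (ψ x) = (bandEnergy (hA x) n : ℂ) • ψ x

/-- The integrand `⟨∂₁ψ | ∂₂ψ⟩ - ⟨∂₂ψ | ∂₁ψ⟩` of the Chern integral (the inner product is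
antilinear in its first argument). -/
noncomputable def berryIntegrand (ψ : ℝ × ℝ → EuclideanSpace ℂ (Fin 3)) (θ : ℝ × ℝ) : ℂ :=
  ⟪fderiv ℝ ψ θ (1, 0), fderiv ℝ ψ θ (0, 1)⟫_ℂ - ⟪fderiv ℝ ψ θ (0, 1), fderiv ℝ ψ θ (1, 0)⟫_ℂ

/-- The level `n` of the family `A` over the torus `(ℝ / 2πℤ)²` is nowhere degenerate, and the
line bundle of its eigenvectors has Chern index
`c = (i / 2π) ∬ (⟨∂₁ψ | ∂₂ψ⟩ - ⟨∂₂ψ | ∂₁ψ⟩) dθ₁ dθ₂`.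
The integrand `F` is the one given by local smooth families `ψ` of unit eigenvectors; these exist
near every point, and all of them give the same value. -/
def HasChernIndex {A : ℝ × ℝ → Matrix (Fin 3) (Fin 3) ℂ} (hA : ∀ θ, (A θ).IsHermitian)
    (n : Fin 3) (c : ℤ) : Prop :=
  (∀ θ, ∀ m, m ≠ n → bandEnergy (hA θ) m ≠ bandEnergy (hA θ) n) ∧
  ∃ F : ℝ × ℝ → ℂ, Continuous F ∧
    (∀ θ, ∃ ψ, IsLocalEigenvector hA n θ ψ) ∧
    (∀ θ ψ, IsLocalEigenvector hA n θ ψ → F θ = berryIntegrand ψ θ) ∧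
    (Complex.I / (2 * Real.pi)) *
      (∫ θ₁ in (0 : ℝ)..2 * Real.pi, ∫ θ₂ in (0 : ℝ)..2 * Real.pi, F (θ₁, θ₂)) = c

/-! ### The model interaction matrix -/

/-- The fixed constants of the model: strengths `m_ij` and phases `φ_ij`. -/
structure TunnelData where
  m11 : ℝ
  m22 : ℝ
  m33 : ℝ
  m12 : ℝ
  m23 : ℝ
  m31 : ℝ
  φ11 : ℝ
  φ22 : ℝ
  φ33 : ℝ
  φ12 : ℝ
  φ23 : ℝ
  φ31 : ℝ

namespace TunnelData

/-- `m e^{iα}`. -/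
noncomputable def polar (m α : ℝ) : ℂ := (m : ℂ) * Complex.exp (Complex.I * (α : ℂ))

/-- The Hermitian matrix with diagonal entries `Ẽ_i + m_ii cos (φ_ii - θ₁)` and off-diagonal
entries `a₁₂ = m₁₂ e^{iφ₁₂}`, `a₂₃ = m₂₃ e^{iφ₂₃}`, `a₃₁ = m₃₁ e^{i(φ₃₁ - θ₂)}`. -/
noncomputable def matrix (p : TunnelData) (E : Fin 3 → ℝ) (θ : ℝ × ℝ) :
    Matrix (Fin 3) (Fin 3) ℂ :=
  !![((E 0 + p.m11 * Real.cos (p.φ11 - θ.1) : ℝ) : ℂ), polar p.m12 p.φ12,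
      star (polar p.m31 (p.φ31 - θ.2));
    star (polar p.m12 p.φ12), ((E 1 + p.m22 * Real.cos (p.φ22 - θ.1) : ℝ) : ℂ),
      polar p.m23 p.φ23;
    polar p.m31 (p.φ31 - θ.2), star (polar p.m23 p.φ23),
      ((E 2 + p.m33 * Real.cos (p.φ33 - θ.1) : ℝ) : ℂ)]

theorem matrix_isHermitian (p : TunnelData) (E : Fin 3 → ℝ) (θ : ℝ × ℝ) :
    (p.matrix E θ).IsHermitian := by
  ext i j
  fin_cases i <;> fin_cases j <;>
    simp only [matrix, Matrix.conjTranspose_apply, Matrix.of_apply, Matrix.cons_val',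
      Matrix.cons_val_zero, Matrix.cons_val_one, Matrix.cons_val, Fin.mk_zero,
      Fin.mk_one, Fin.reduceFinMk, Complex.star_def, Complex.conj_ofReal,
      Complex.conj_conj]

/-- The eigenvalue `E_n(θ)` of the model matrix, in increasing order of `n`. -/
noncomputable def band (p : TunnelData) (E : Fin 3 → ℝ) (θ : ℝ × ℝ) (n : Fin 3) : ℝ :=
  bandEnergy (p.matrix_isHermitian E θ) n

/-- The external parameters `(γ₁, γ₂) = ((Ẽ₁ - Ẽ₃)/ħ, (Ẽ₂ - Ẽ₃)/ħ)`. -/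
noncomputable def gam (ħ : ℝ) (E : Fin 3 → ℝ) : ℝ × ℝ :=
  ((E 0 - E 2) / ħ, (E 1 - E 2) / ħ)

/-- The total tunnelling phase `Θ = φ₁₂ + φ₂₃ + φ₃₁ - θ₂ = arg (a₁₂ a₂₃ a₃₁)` modulo `2π`. -/
def totalPhase (p : TunnelData) (θ : ℝ × ℝ) : ℝ := p.φ12 + p.φ23 + p.φ31 - θ.2

noncomputable def K1 (p : TunnelData) : ℝ :=
  Real.sqrt (p.m11 ^ 2 + p.m33 ^ 2 - 2 * p.m11 * p.m33 * Real.cos (p.φ11 - p.φ33))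

noncomputable def K2 (p : TunnelData) : ℝ :=
  Real.sqrt (p.m22 ^ 2 + p.m33 ^ 2 - 2 * p.m22 * p.m33 * Real.cos (p.φ22 - p.φ33))

noncomputable def Y1 (p : TunnelData) : ℝ := p.m31 * (p.m12 / p.m23 - p.m23 / p.m12)

noncomputable def Y2 (p : TunnelData) : ℝ := p.m23 * (p.m12 / p.m31 - p.m31 / p.m12)

/-- The angle `α₁` with `K₁ e^{iα₁} = m₃₃ e^{iφ₃₃} - m₁₁ e^{iφ₁₁}`. -/
noncomputable def angle1 (p : TunnelData) : ℝ :=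
  Complex.arg (polar p.m33 p.φ33 - polar p.m11 p.φ11)

/-- The angle `α₂` with `K₂ e^{iα₂} = m₃₃ e^{iφ₃₃} - m₂₂ e^{iφ₂₂}`. -/
noncomputable def angle2 (p : TunnelData) : ℝ :=
  Complex.arg (polar p.m33 p.φ33 - polar p.m22 p.φ22)

/-- `η = α₁ - α₂`. -/
noncomputable def eta (p : TunnelData) : ℝ := p.angle1 - p.angle2

/-- The point `((K₁ cos (t - η) + s Y₁)/ħ, (K₂ cos t + s Y₂)/ħ)`. -/
noncomputable def ellipsePoint (p : TunnelData) (ħ s t : ℝ) : ℝ × ℝ :=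
  ((p.K1 * Real.cos (t - p.eta) + s * p.Y1) / ħ, (p.K2 * Real.cos t + s * p.Y2) / ħ)

/-- The curve described by `ellipsePoint` in the plane `(γ₁, γ₂)`. -/
def ellipse (p : TunnelData) (ħ s : ℝ) : Set (ℝ × ℝ) := Set.range (p.ellipsePoint ħ s)

/-- `(K₂x)² - 2K₁K₂ cos η · xy + (K₁y)² - (K₁K₂ sin η)²`, where
`(x, y) = (ħγ₁ - sY₁, ħγ₂ - sY₂)`. If `K₁K₂ sin η ≠ 0` the ellipse is its zero set, and the open
domain that it bounds is the set where this is negative; if `K₁K₂ sin η = 0` the ellipse is flat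
and the form is nowhere negative. -/
noncomputable def ellipseForm (p : TunnelData) (ħ s : ℝ) (g : ℝ × ℝ) : ℝ :=
  (p.K2 * (ħ * g.1 - s * p.Y1)) ^ 2
    - 2 * p.K1 * p.K2 * Real.cos p.eta * (ħ * g.1 - s * p.Y1) * (ħ * g.2 - s * p.Y2)
    + (p.K1 * (ħ * g.2 - s * p.Y2)) ^ 2 - (p.K1 * p.K2 * Real.sin p.eta) ^ 2

/-- `sign (sin η)` inside the ellipse with label `s`, and `0` outside. -/
noncomputable def jump (p : TunnelData) (ħ s : ℝ) (g : ℝ × ℝ) : ℤ :=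
  if p.ellipseForm ħ s g < 0 then ((SignType.sign (Real.sin p.eta) : SignType) : ℤ) else 0

end TunnelData

/-! ### Eigenvalues of Hermitian `3 × 3` matrices -/

/-! Write `a`, `b`, `c` for the off-diagonal entries in the places `12`, `23`, `31`, all nonzero,
and `E` for the lowest eigenvalue of `A`. Then `A - E` is positive semidefinite and singular, and
`E` is degenerate exactly when `A - E` has rank one. The moduli of `a`, `b`, `c` determine the
diagonal `r` of a positive rank one matrix (`rankOneDiag`), and such a matrix exists only if `a * b
* c` is positive. So degeneracy means `a * b * c > 0` together with two real equations for the
differences of the diagonal entries (`bandEnergy_zero_eq_one_iff`). In the model `r 0 - r 2 = Y1`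
and `r 1 - r 2 = Y2`, and the equations say that `γ` is a point of the ellipse. The top level is the
lowest level of `-A`, so the matrices `s • A` with `s = ±1` cover both cases.

For the Chern index of the lowest level, let `w(θ₁)` be the complex number whose real and imaginary
parts are the defects in the two equations (`windCurve`). Columns `0` and `1` of the adjugate of `A
- E` are eigenvectors. Column `0` is nonzero when `w` avoids the closed negative real axis, column
`1` when it avoids the closed negative imaginary axis. On each domain Green's theorem turns the
curvature integral into a difference of Berry phases of loops in `θ₂`. Where both columns exist,
their Berry phases differ by `2πi` in the open third quadrant and by `0` elsewhere
(`loopPhase_one_sub_loopPhase_zero`), just as the branches of the logarithm with these two cuts do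
(`log_neg_I_mul`). Hence Berry phase minus logarithm glues to a periodic function, and the curvature
integral equals `∮ w'/w` (`integral_lowest_eq_integral_windCurve`).

Up to the sign `s`, `w` runs along a translated ellipse, and a real linear change of coordinates
reduces its winding number to that of a circle (`integral_logDeriv_cosCurve`). The curvatures of the
three levels add up to zero, which gives the middle level. -/

/-- The Hermitian matrix with real diagonal `d` and entries `a`, `b`, `c` in the places
`12`, `23`, `31`. -/
def hermThree (d : Fin 3 → ℝ) (a b c : ℂ) : Matrix (Fin 3) (Fin 3) ℂ :=
  !![(d 0 : ℂ), a, star c; star a, (d 1 : ℂ), b; c, star b, (d 2 : ℂ)]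

/-- The determinant of `hermThree d a b c`. -/
def hermDet (d : Fin 3 → ℝ) (a b c : ℂ) : ℝ :=
  d 0 * d 1 * d 2 + 2 * (a * b * c).re - d 0 * Complex.normSq b - d 1 * Complex.normSq c
    - d 2 * Complex.normSq a

/-- The sum of the principal `2 × 2` minors of `hermThree d a b c`. -/
def hermMinors (d : Fin 3 → ℝ) (a b c : ℂ) : ℝ :=
  (d 1 * d 2 - Complex.normSq b) + (d 0 * d 2 - Complex.normSq c) + (d 0 * d 1 - Complex.normSq a)

theorem hermThree_sub (d : Fin 3 → ℝ) (a b c : ℂ) (x : ℝ) :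
    hermThree d a b c - (x : ℂ) • (1 : Matrix (Fin 3) (Fin 3) ℂ)
      = hermThree (fun i => d i - x) a b c := by
  ext i j
  fin_cases i <;> fin_cases j <;> simp [hermThree]

theorem det_hermThree (d : Fin 3 → ℝ) (a b c : ℂ) :
    (hermThree d a b c).det = (hermDet d a b c : ℂ) := by
  rw [Matrix.det_fin_three]
  apply Complex.ext <;>
    simp [hermThree, hermDet, Complex.normSq_apply] <;> ring

theorem bandEnergy_mono {A : Matrix (Fin 3) (Fin 3) ℂ} (hA : A.IsHermitian) :
    Monotone (bandEnergy hA) := fun m n h =>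
  hA.eigenvalues₀_antitone (by simpa using h)

theorem det_sub_smul_one_eq_prod_bandEnergy {A : Matrix (Fin 3) (Fin 3) ℂ} (hA : A.IsHermitian)
    (x : ℝ) : (A - (x : ℂ) • (1 : Matrix (Fin 3) (Fin 3) ℂ)).det
      = ((∏ n, (bandEnergy hA n - x) : ℝ) : ℂ) := by
  have h1 : ((Matrix.scalar (Fin 3)) (x : ℂ) - A).det = ∏ i, ((x : ℂ) - hA.eigenvalues i) := by
    rw [← Matrix.eval_charpoly, hA.charpoly_eq, Polynomial.eval_prod]
    simp
  have h2 : A - (x : ℂ) • (1 : Matrix (Fin 3) (Fin 3) ℂ)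
      = -((Matrix.scalar (Fin 3)) (x : ℂ) - A) := by
    rw [neg_sub, Matrix.scalar_apply, Matrix.smul_one_eq_diagonal]
  have h3 : ∏ i, ((x : ℂ) - hA.eigenvalues i) = ∏ n, ((x : ℂ) - bandEnergy hA n) := by
    unfold Matrix.IsHermitian.eigenvalues bandEnergy
    rw [Equiv.prod_comp (Fintype.equivOfCardEq (Fintype.card_fin _)).symm
      (fun j => (x : ℂ) - (hA.eigenvalues₀ j : ℂ)),
      ← Equiv.prod_comp (Fin.revPerm.trans (finCongr (Fintype.card_fin 3).symm))]
    rfl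
  rw [h2, Matrix.det_neg, h1, h3]
  push_cast
  rw [Fin.prod_univ_three, Fin.prod_univ_three, Fintype.card_fin]
  ring

section Bands

variable {d : Fin 3 → ℝ} {a b c : ℂ} (hA : (hermThree d a b c).IsHermitian)

theorem hermDet_sub_eq_prod (x : ℝ) :
    hermDet (fun i => d i - x) a b c
      = (bandEnergy hA 0 - x) * (bandEnergy hA 1 - x) * (bandEnergy hA 2 - x) := by
  have h := det_sub_smul_one_eq_prod_bandEnergy hA x
  rw [hermThree_sub, det_hermThree, Fin.prod_univ_three] at h
  exact_mod_cast h

theorem hermDet_sub_bandEnergy (n : Fin 3) :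
    hermDet (fun i => d i - bandEnergy hA n) a b c = 0 := by
  rw [hermDet_sub_eq_prod hA]
  fin_cases n <;> simp

theorem sum_sub_eq_sum_bandEnergy (x : ℝ) :
    (d 0 - x) + (d 1 - x) + (d 2 - x)
      = (bandEnergy hA 0 - x) + (bandEnergy hA 1 - x) + (bandEnergy hA 2 - x) := by
  -- The trace is half the second difference of the characteristic cubic at `-1`, `0`, `1`.
  have h0 := hermDet_sub_eq_prod hA 0
  have h1 := hermDet_sub_eq_prod hA 1
  have h2 := hermDet_sub_eq_prod hA (-1)
  simp only [hermDet] at h0 h1 h2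
  linarith

theorem hermMinors_sub_eq (x : ℝ) :
    hermMinors (fun i => d i - x) a b c
      = (bandEnergy hA 1 - x) * (bandEnergy hA 2 - x) + (bandEnergy hA 0 - x) * (bandEnergy hA 2 - x)
        + (bandEnergy hA 0 - x) * (bandEnergy hA 1 - x) := by
  have h0 := hermDet_sub_eq_prod hA 0
  have h1 := hermDet_sub_eq_prod hA 1
  have h2 := sum_sub_eq_sum_bandEnergy hA 0
  have h3 : (d 0 + d 1 + d 2) * x = (bandEnergy hA 0 + bandEnergy hA 1 + bandEnergy hA 2) * x := by
    congr 1; linarith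
  simp only [hermDet, hermMinors] at h0 h1 ⊢
  linarith

/-- The level `n` is a simple eigenvalue. -/
def IsSimpleBand {A : Matrix (Fin 3) (Fin 3) ℂ} (hA : A.IsHermitian) (n : Fin 3) : Prop :=
  ∀ m, m ≠ n → bandEnergy hA m ≠ bandEnergy hA n

theorem hermMinors_sub_bandEnergy_ne_zero {n : Fin 3} (hn : IsSimpleBand hA n) :
    hermMinors (fun i => d i - bandEnergy hA n) a b c ≠ 0 := by
  rw [hermMinors_sub_eq hA]
  have h0 := hn 0
  have h1 := hn 1
  have h2 := hn 2
  fin_cases n <;> simp_all [sub_eq_zero]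

/-- The open conditions that single out the level `n` among the roots of the
characteristic polynomial. -/
theorem eq_bandEnergy_of_hermDet_eq_zero {n : Fin 3} {x y : ℝ} {d' : Fin 3 → ℝ} {a' b' c' : ℂ}
    (hA' : (hermThree d' a' b' c').IsHermitian) (hn : IsSimpleBand hA' n)
    (hy : y = bandEnergy hA' n)
    (hdet : hermDet (fun i => d i - x) a b c = 0)
    (hmin : 0 < hermMinors (fun i => d i - x) a b c * hermMinors (fun i => d' i - y) a' b' c')
    (htr : ((d' 0 - y) + (d' 1 - y) + (d' 2 - y)) ≠ 0 →
      0 < ((d 0 - x) + (d 1 - x) + (d 2 - x)) * ((d' 0 - y) + (d' 1 - y) + (d' 2 - y))) :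
    x = bandEnergy hA n := by
  rw [hermMinors_sub_eq hA, hermMinors_sub_eq hA'] at hmin
  rw [sum_sub_eq_sum_bandEnergy hA, sum_sub_eq_sum_bandEnergy hA'] at htr
  rw [hermDet_sub_eq_prod hA] at hdet
  have u1 := bandEnergy_mono hA (show (0 : Fin 3) ≤ 1 by decide)
  have u2 := bandEnergy_mono hA (show (1 : Fin 3) ≤ 2 by decide)
  have v1 := bandEnergy_mono hA' (show (0 : Fin 3) ≤ 1 by decide)
  have v2 := bandEnergy_mono hA' (show (1 : Fin 3) ≤ 2 by decide)
  have h0 := hn 0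
  have h1 := hn 1
  have h2 := hn 2
  clear hn
  set l := bandEnergy hA
  set l' := bandEnergy hA'
  subst hy
  have key : x = l 0 ∨ x = l 1 ∨ x = l 2 := by
    rcases mul_eq_zero.1 hdet with h | h
    · rcases mul_eq_zero.1 h with h | h
      · left; linarith
      · right; left; linarith
    · right; right; linarith
  -- At a simple root the sum of minors is the product of the gaps to the other levels: positive for
  -- the outer levels, negative for the middle one. The shifted trace then separates the lowest
  -- level (positive) from the highest (negative); for the middle level it may vanish and is not
  -- needed.
  fin_cases n
  · simp only [Fin.zero_eta, ne_eq, not_true_eq_false, false_imp_iff, one_ne_zero, not_false_eq_true,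
      true_imp_iff, Fin.isValue, sub_self, zero_mul, add_zero, zero_add] at *
    have w1 : 0 < l' 1 - l' 0 := by have := lt_of_le_of_ne v1 (Ne.symm h1); linarith
    have w2 : 0 < l' 2 - l' 0 := by linarith
    have hm := pos_of_mul_pos_left hmin (mul_pos w1 w2).le
    have ht := pos_of_mul_pos_left (htr (by positivity)) (by positivity)
    rcases key with h | h | h
    · exact h
    · nlinarith
    · nlinarith
  · simp only [Fin.mk_one, ne_eq, not_true_eq_false, false_imp_iff, zero_ne_one, not_false_eq_true,
      true_imp_iff, Fin.isValue, sub_self, zero_mul, mul_zero, add_zero, zero_add] at *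
    have w1 : l' 0 - l' 1 < 0 := by have := lt_of_le_of_ne v1 h0; linarith
    have w2 : 0 < l' 2 - l' 1 := by
      have := lt_of_le_of_ne v2 (Ne.symm (h2 (by decide))); linarith
    have hm := neg_of_mul_pos_left hmin (mul_neg_of_neg_of_pos w1 w2).le
    rcases key with h | h | h
    · nlinarith
    · exact h
    · nlinarith
  · simp only [Fin.reduceFinMk, ne_eq, not_true_eq_false, false_imp_iff, Fin.isValue, sub_self,
      mul_zero, add_zero, zero_add] at *
    have w2 : l' 1 - l' 2 < 0 := by
      have := lt_of_le_of_ne v2 (h1 (by decide)); linarith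
    have w1 : l' 0 - l' 2 < 0 := by linarith
    have hm := pos_of_mul_pos_left hmin (mul_pos_of_neg_of_neg w1 w2).le
    have hne : l' 0 - l' 2 + (l' 1 - l' 2) < 0 := by linarith
    have ht := neg_of_mul_pos_left (htr hne.ne) hne.le
    rcases key with h | h | h
    · nlinarith
    · nlinarith
    · exact h

end Bands

/-! ### Smoothness of simple levels -/

theorem continuous_hermMinors {X : Type*} [TopologicalSpace X] {d : X → Fin 3 → ℝ} {a b c : X → ℂ} (hd : Continuous d)
    (ha : Continuous a) (hb : Continuous b) (hc : Continuous c) :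
    Continuous fun x => hermMinors (d x) (a x) (b x) (c x) := by
  simp only [hermMinors]
  have := Complex.continuous_normSq.comp ha
  have := Complex.continuous_normSq.comp hb
  have := Complex.continuous_normSq.comp hc
  simp only [Function.comp_def] at *
  fun_prop

section Smooth

variable {X : Type*} [NormedAddCommGroup X] [NormedSpace ℝ X]

theorem contDiff_hermDet {d : X → Fin 3 → ℝ} {a b c : X → ℂ} (hd : ContDiff ℝ ∞ d)
    (ha : ContDiff ℝ ∞ a) (hb : ContDiff ℝ ∞ b) (hc : ContDiff ℝ ∞ c) :
    ContDiff ℝ ∞ fun x => hermDet (d x) (a x) (b x) (c x) := by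
  have hd' : ∀ i, ContDiff ℝ ∞ fun x => d x i := fun i => contDiff_pi.1 hd i
  have hre : ∀ {f : X → ℂ}, ContDiff ℝ ∞ f → ContDiff ℝ ∞ fun x => (f x).re := fun hf =>
    Complex.reCLM.contDiff.comp hf
  have him : ∀ {f : X → ℂ}, ContDiff ℝ ∞ f → ContDiff ℝ ∞ fun x => (f x).im := fun hf =>
    Complex.imCLM.contDiff.comp hf
  simp only [hermDet, Complex.normSq_apply]
  have h1 := hre ((ha.mul hb).mul hc)
  have := hre ha
  have := hre hb
  have := hre hc
  have := him ha
  have := him hb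
  have := him hc
  have := hd' 0
  have := hd' 1
  have := hd' 2
  fun_prop

theorem hasDerivAt_hermDet_sub (d : Fin 3 → ℝ) (a b c : ℂ) (x : ℝ) :
    HasDerivAt (fun y => hermDet (fun i => d i - y) a b c)
      (-hermMinors (fun i => d i - x) a b c) x := by
  unfold hermDet hermMinors
  have h : ∀ i, HasDerivAt (fun y => d i - y) (-1) x := fun i => (hasDerivAt_id x).const_sub _
  convert! (((((h 0).mul (h 1)).mul (h 2)).add_const (2 * (a * b * c).re)).sub
    ((h 0).mul_const (Complex.normSq b))).sub ((h 1).mul_const (Complex.normSq c)) |>.sub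
    ((h 2).mul_const (Complex.normSq a)) using 1
  simp; ring

/-- Implicit function theorem for the characteristic polynomial: its derivative in the energy is
`-hermMinors`, nonzero at a simple root. The implicit function stays on level `n` because the sign
conditions of `eq_bandEnergy_of_hermDet_eq_zero` are open. -/
theorem contDiffAt_bandEnergy [CompleteSpace X] {d : X → Fin 3 → ℝ} {a b c : X → ℂ}
    (hd : ContDiff ℝ ∞ d) (ha : ContDiff ℝ ∞ a) (hb : ContDiff ℝ ∞ b) (hc : ContDiff ℝ ∞ c)
    (hA : ∀ x, (hermThree (d x) (a x) (b x) (c x)).IsHermitian) {n : Fin 3} {x₀ : X}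
    (hn : IsSimpleBand (hA x₀) n) :
    ContDiffAt ℝ ∞ (fun x => bandEnergy (hA x) n) x₀ := by
  set l := bandEnergy (hA x₀) n with hl
  let f : X × ℝ → ℝ := fun p =>
    hermDet (fun i => d p.1 i - p.2) (a p.1) (b p.1) (c p.1)
  have hd2 : ContDiff ℝ ∞ fun p : X × ℝ => fun i => d p.1 i - p.2 := by
    refine contDiff_pi.2 fun i => ((contDiff_pi.1 hd i).comp contDiff_fst).sub contDiff_snd
  have hf : ContDiff ℝ ∞ f :=
    contDiff_hermDet hd2 (ha.comp contDiff_fst) (hb.comp contDiff_fst) (hc.comp contDiff_fst)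
  have hfl : f (x₀, l) = 0 := hermDet_sub_bandEnergy (hA x₀) n
  have hm0 := hermMinors_sub_bandEnergy_ne_zero (hA x₀) hn
  have hfd : HasFDerivAt f (fderiv ℝ f (x₀, l)) (x₀, l) :=
    (hf.differentiable (by simp)).differentiableAt.hasFDerivAt
  have hval : (fderiv ℝ f (x₀, l) ∘L .inr ℝ X ℝ) 1
      = -hermMinors (fun i => d x₀ i - l) (a x₀) (b x₀) (c x₀) := by
    have h1 : HasDerivAt (fun y => f (x₀, y)) (fderiv ℝ f (x₀, l) ((0 : X), (1 : ℝ))) l :=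
      hfd.comp_hasDerivAt l ((hasDerivAt_const l x₀).prodMk (hasDerivAt_id l))
    simpa using h1.unique (hasDerivAt_hermDet_sub (d x₀) (a x₀) (b x₀) (c x₀) l)
  have hinv : (fderiv ℝ f (x₀, l) ∘L .inr ℝ X ℝ).IsInvertible := by
    have hu : (fderiv ℝ f (x₀, l) ∘L .inr ℝ X ℝ) 1 ≠ 0 := by rw [hval]; simpa using hm0
    refine ⟨ContinuousLinearEquiv.unitsEquivAut ℝ (Units.mk0 _ hu), ?_⟩
    ext
    simp
  have hinf : (∞ : WithTop ℕ∞) ≠ 0 := by simp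
  have cdf : ContDiffAt ℝ ∞ f (x₀, l) := hf.contDiffAt
  set g := cdf.implicitFunction hinf hinv with hg
  have hgs : ContDiffAt ℝ ∞ g x₀ := cdf.contDiffAt_implicitFunction hinf hinv
  have hg0 : g x₀ = l := cdf.implicitFunction_apply_self hinf hinv
  have hgz : ∀ᶠ x in nhds x₀, f (x, g x) = 0 := by
    have := cdf.eventually_apply_implicitFunction hinf hinv
    simpa [hfl, hg] using this
  refine hgs.congr_of_eventuallyEq ?_
  have hpair : ContinuousAt (fun x => (x, g x)) x₀ := continuousAt_id.prodMk hgs.continuousAt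
  have hmin : ∀ᶠ x in nhds x₀, 0 < hermMinors (fun i => d x i - g x) (a x) (b x) (c x)
      * hermMinors (fun i => d x₀ i - l) (a x₀) (b x₀) (c x₀) := by
    have h1 : Continuous fun p : X × ℝ => hermMinors (fun i => d p.1 i - p.2) (a p.1) (b p.1) (c p.1) :=
      continuous_hermMinors hd2.continuous (ha.continuous.comp continuous_fst)
        (hb.continuous.comp continuous_fst) (hc.continuous.comp continuous_fst)
    have h2 : ContinuousAt (fun x => hermMinors (fun i => d x i - g x) (a x) (b x) (c x)) x₀ :=
      ContinuousAt.comp (f := fun x => (x, g x)) (x := x₀) h1.continuousAt hpair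
    refine (h2.mul continuousAt_const).eventually (lt_mem_nhds ?_)
    simp only [Pi.mul_apply, hg0]
    exact mul_self_pos.2 hm0
  have htr : ∀ᶠ x in nhds x₀, ((d x₀ 0 - l) + (d x₀ 1 - l) + (d x₀ 2 - l)) ≠ 0 →
      0 < ((d x 0 - g x) + (d x 1 - g x) + (d x 2 - g x))
        * ((d x₀ 0 - l) + (d x₀ 1 - l) + (d x₀ 2 - l)) := by
    by_cases h0 : ((d x₀ 0 - l) + (d x₀ 1 - l) + (d x₀ 2 - l)) = 0
    · simp [h0]
    have hdi : ∀ i, ContinuousAt (fun x => d x i - g x) x₀ := fun i =>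
      ((contDiff_pi.1 hd i).continuous.continuousAt).sub hgs.continuousAt
    filter_upwards [(((hdi 0).add (hdi 1)).add (hdi 2) |>.mul
      (continuousAt_const (y := (d x₀ 0 - l) + (d x₀ 1 - l) + (d x₀ 2 - l)))).eventually
        (lt_mem_nhds (show (0 : ℝ) < _ by
          simp only [Pi.mul_apply, Pi.add_apply, hg0]; exact mul_self_pos.2 h0))] with x hx _
    exact hx
  filter_upwards [hgz, hmin, htr] with x h1 h2 h3
  exact (eq_bandEnergy_of_hermDet_eq_zero (hA x) (hA x₀) hn hl h1 h2 h3).symm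

end Smooth

/-! ### Berry curvature of a simple level -/

section Gauge

theorem inner_fderiv_add_eq_zero {V : Type*} [NormedAddCommGroup V] [InnerProductSpace ℂ V]
    {ψ χ : ℝ × ℝ → V} {θ : ℝ × ℝ} {z : ℂ} (hψ : DifferentiableAt ℝ ψ θ)
    (hχ : DifferentiableAt ℝ χ θ) (h : ∀ᶠ x in nhds θ, ⟪ψ x, χ x⟫_ℂ = z) (v : ℝ × ℝ) :
    ⟪fderiv ℝ ψ θ v, χ θ⟫_ℂ + ⟪ψ θ, fderiv ℝ χ θ v⟫_ℂ = 0 := by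
  have h1 := fderiv_inner_apply ℂ hψ hχ v
  have h2 : fderiv ℝ (fun t => ⟪ψ t, χ t⟫_ℂ) θ = 0 := by
    rw [Filter.EventuallyEq.fderiv_eq (f₁ := fun t => ⟪ψ t, χ t⟫_ℂ) (f := fun _ => z) h]
    simp
  rw [h2] at h1
  simpa [add_comm] using h1.symm

theorem inner_self_eq_one_of_norm {V : Type*} [NormedAddCommGroup V] [InnerProductSpace ℂ V]
    {v : V} (h : ‖v‖ = 1) : ⟪v, v⟫_ℂ = 1 := by
  rw [inner_self_eq_norm_sq_to_K, h]; simp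

/-- Gauge invariance. With `χ = c • ψ` and `|c| = 1`, both `⟪ψ, ∂ψ⟫` and `conj c * ∂c` are purely
imaginary, so all terms containing `∂c` cancel on antisymmetrization. -/
theorem berryIntegrand_congr_phase {ψ χ : ℝ × ℝ → EuclideanSpace ℂ (Fin 3)} {θ : ℝ × ℝ}
    (hψ : DifferentiableAt ℝ ψ θ) (hχ : DifferentiableAt ℝ χ θ)
    (hψ1 : ∀ᶠ x in nhds θ, ‖ψ x‖ = 1) (hχ1 : ∀ᶠ x in nhds θ, ‖χ x‖ = 1)
    (h : ∀ᶠ x in nhds θ, χ x = ⟪ψ x, χ x⟫_ℂ • ψ x) :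
    berryIntegrand χ θ = berryIntegrand ψ θ := by
  set c : ℝ × ℝ → ℂ := fun x => ⟪ψ x, χ x⟫_ℂ with hc
  have hcd : DifferentiableAt ℝ c θ := hψ.inner ℂ hχ
  have hcc : ∀ᶠ x in nhds θ, ⟪c x, c x⟫_ℂ = 1 := by
    filter_upwards [hψ1, hχ1, h] with x h1 h2 h3
    refine inner_self_eq_one_of_norm ?_
    rw [h3, norm_smul, h1, mul_one] at h2
    exact h2
  have hψψ : ∀ᶠ x in nhds θ, ⟪ψ x, ψ x⟫_ℂ = 1 := hψ1.mono fun x => inner_self_eq_one_of_norm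
  have hd : ∀ v, fderiv ℝ χ θ v = c θ • fderiv ℝ ψ θ v + fderiv ℝ c θ v • ψ θ := by
    intro v
    have h1 : fderiv ℝ χ θ = fderiv ℝ (fun x => c x • ψ x) θ :=
      Filter.EventuallyEq.fderiv_eq h
    rw [h1, fderiv_fun_smul hcd hψ]
    simp
  have e1 := inner_fderiv_add_eq_zero hψ hψ hψψ (1, 0)
  have e2 := inner_fderiv_add_eq_zero hψ hψ hψψ (0, 1)
  have c1 := inner_fderiv_add_eq_zero hcd hcd hcc (1, 0)
  have c2 := inner_fderiv_add_eq_zero hcd hcd hcc (0, 1)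
  have c0 := hcc.self_of_nhds
  have p0 := hψψ.self_of_nhds
  unfold berryIntegrand
  rw [hd, hd]
  simp only [inner_add_left, inner_add_right, inner_smul_left, inner_smul_right, p0]
  simp only [RCLike.inner_apply] at c0 c1 c2
  set k := c θ
  set k1 := fderiv ℝ c θ (1, 0)
  set k2 := fderiv ℝ c θ (0, 1)
  set X := fderiv ℝ ψ θ (1, 0)
  set Y := fderiv ℝ ψ θ (0, 1)
  have e1' : ⟪X, ψ θ⟫_ℂ = -⟪ψ θ, X⟫_ℂ := by linear_combination e1
  have e2' : ⟪Y, ψ θ⟫_ℂ = -⟪ψ θ, Y⟫_ℂ := by linear_combination e2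
  rw [e1', e2']
  have hk : k ≠ 0 := by rintro h0; simp [h0] at c0
  have c1' : (starRingEnd ℂ) k1 * k = -(k1 * (starRingEnd ℂ) k) := by linear_combination c1
  have c2' : (starRingEnd ℂ) k2 * k = -(k2 * (starRingEnd ℂ) k) := by linear_combination c2
  -- Both derivatives of `c` are imaginary multiples of `c`, so this product is real.
  have c3 : (starRingEnd ℂ) k1 * k2 = (starRingEnd ℂ) k2 * k1 := by
    linear_combination (k2 * (starRingEnd ℂ) k) * c1' - (k1 * (starRingEnd ℂ) k) * c2'
      - ((starRingEnd ℂ) k1 * k2 - (starRingEnd ℂ) k2 * k1) * c0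
  linear_combination (⟪X, Y⟫_ℂ - ⟪Y, X⟫_ℂ) * c0 + ⟪ψ θ, Y⟫_ℂ * c1' - ⟪ψ θ, X⟫_ℂ * c2' + c3

/-- In the moving frame the matrices `⟪ψ m, ∂ψ n⟫` are antihermitian, and the sum of the integrands
is minus the trace of the commutator of the two connection matrices. -/
theorem sum_berryIntegrand_eq_zero {ψ : Fin 3 → ℝ × ℝ → EuclideanSpace ℂ (Fin 3)} {θ : ℝ × ℝ}
    (hψ : ∀ n, DifferentiableAt ℝ (ψ n) θ)
    (h : ∀ᶠ x in nhds θ, Orthonormal ℂ fun n => ψ n x) :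
    ∑ n, berryIntegrand (ψ n) θ = 0 := by
  let b : OrthonormalBasis (Fin 3) ℂ (EuclideanSpace ℂ (Fin 3)) :=
    (basisOfOrthonormalOfCardEqFinrank h.self_of_nhds (by simp)).toOrthonormalBasis
      (by simpa using h.self_of_nhds)
  have hb : ∀ n, b n = ψ n θ := by intro n; simp [b]
  have hskew : ∀ m n v, ⟪fderiv ℝ (ψ m) θ v, ψ n θ⟫_ℂ = -⟪ψ m θ, fderiv ℝ (ψ n) θ v⟫_ℂ := by
    intro m n v
    refine eq_neg_of_add_eq_zero_left (inner_fderiv_add_eq_zero (hψ m) (hψ n)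
      (z := if m = n then 1 else 0) ?_ v)
    filter_upwards [h] with x hx
    exact orthonormal_iff_ite.1 hx m n
  have hexp : ∀ n v w, ⟪fderiv ℝ (ψ n) θ v, fderiv ℝ (ψ n) θ w⟫_ℂ
      = ∑ m, -(⟪ψ n θ, fderiv ℝ (ψ m) θ v⟫_ℂ * ⟪ψ m θ, fderiv ℝ (ψ n) θ w⟫_ℂ) := by
    intro n v w
    rw [← b.sum_inner_mul_inner]
    refine Finset.sum_congr rfl fun m _ => ?_
    rw [hb, hskew, neg_mul]
  simp only [berryIntegrand, hexp, Fin.sum_univ_three]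
  ring

end Gauge

/-! ### Eigenvectors from the columns of the adjugate -/

section Sections

/-- The `k`-th column of the adjugate, as a vector. -/
noncomputable def adjCol (M : Matrix (Fin 3) (Fin 3) ℂ) (k : Fin 3) : EuclideanSpace ℂ (Fin 3) :=
  WithLp.toLp 2 fun i => M.adjugate i k

theorem adjCol_apply (M : Matrix (Fin 3) (Fin 3) ℂ) (k i : Fin 3) :
    adjCol M k i = M.adjugate i k := rfl

theorem mulVec_adjCol {M : Matrix (Fin 3) (Fin 3) ℂ} (h : M.det = 0) (k : Fin 3) :
    M.mulVec (adjCol M k).ofLp = 0 := by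
  ext i
  have := congrFun (congrFun M.mul_adjugate i) k
  rw [h, zero_smul] at this
  simpa [Matrix.mul_apply, Matrix.mulVec, dotProduct, adjCol] using this

/-- Drop the `k`-th equation and solve the other two for `v j` in terms of `v k` by Cramer's rule.
Thus a kernel vector is a multiple of the `k`-th adjugate column once the diagonal entry there is
nonzero. -/
theorem adjugate_mul_eq_of_mulVec_eq_zero {M : Matrix (Fin 3) (Fin 3) ℂ} {v : Fin 3 → ℂ}
    (h : M.mulVec v = 0) (k j : Fin 3) :
    M.adjugate k k * v j = M.adjugate j k * v k := by
  have h0 := congrFun h 0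
  have h1 := congrFun h 1
  have h2 := congrFun h 2
  simp only [Matrix.mulVec, dotProduct, Fin.sum_univ_three, Pi.zero_apply] at h0 h1 h2
  rw [Matrix.adjugate_fin_three]
  fin_cases k <;> fin_cases j <;> simp
  · linear_combination M 2 2 * h1 - M 1 2 * h2
  · linear_combination M 1 1 * h2 - M 2 1 * h1
  · linear_combination M 2 2 * h0 - M 0 2 * h2
  · linear_combination M 0 0 * h2 - M 2 0 * h0
  · linear_combination M 1 1 * h0 - M 0 1 * h1
  · linear_combination M 0 0 * h1 - M 1 0 * h0

theorem toEuclideanLin_eq_smul_iff (A : Matrix (Fin 3) (Fin 3) ℂ) (x : ℂ)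
    (v : EuclideanSpace ℂ (Fin 3)) :
    Matrix.toEuclideanLin A v = x • v
      ↔ (A - x • (1 : Matrix (Fin 3) (Fin 3) ℂ)).mulVec v.ofLp = 0 := by
  rw [Matrix.sub_mulVec, Matrix.smul_mulVec, Matrix.one_mulVec, sub_eq_zero,
    ← (WithLp.ofLp_injective 2).eq_iff]
  simp [Matrix.toLpLin_apply]

variable {d : Fin 3 → ℝ} {a b c : ℂ}

theorem hermMinors_eq_sum_adjugate :
    (hermMinors d a b c : ℂ) = (hermThree d a b c).adjugate 0 0 + (hermThree d a b c).adjugate 1 1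
      + (hermThree d a b c).adjugate 2 2 := by
  rw [Matrix.adjugate_fin_three]
  simp [hermThree, hermMinors, ← Complex.mul_conj]
  ring

variable (hA : (hermThree d a b c).IsHermitian) {n : Fin 3}

/-- The trace of the adjugate is the product of the gaps to the other two levels. -/
theorem exists_adjugate_ne_zero (hn : IsSimpleBand hA n) :
    ∃ k, (hermThree (fun i => d i - bandEnergy hA n) a b c).adjugate k k ≠ 0 := by
  by_contra! h
  have := hermMinors_sub_bandEnergy_ne_zero hA hn
  have h2 := hermMinors_eq_sum_adjugate (d := fun i => d i - bandEnergy hA n) (a := a) (b := b)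
    (c := c)
  rw [h, h, h] at h2
  simp only [add_zero, Complex.ofReal_eq_zero] at h2
  exact this h2

theorem toEuclideanLin_adjCol (k : Fin 3) :
    Matrix.toEuclideanLin (hermThree d a b c)
        (adjCol (hermThree (fun i => d i - bandEnergy hA n) a b c) k)
      = (bandEnergy hA n : ℂ) • adjCol (hermThree (fun i => d i - bandEnergy hA n) a b c) k := by
  rw [toEuclideanLin_eq_smul_iff, hermThree_sub]
  apply mulVec_adjCol
  rw [det_hermThree, hermDet_sub_bandEnergy, Complex.ofReal_zero]

theorem eq_smul_adjCol {v : EuclideanSpace ℂ (Fin 3)}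
    (hv : Matrix.toEuclideanLin (hermThree d a b c) v = (bandEnergy hA n : ℂ) • v) {k : Fin 3}
    (hk : (hermThree (fun i => d i - bandEnergy hA n) a b c).adjugate k k ≠ 0) :
    v = (v k / (hermThree (fun i => d i - bandEnergy hA n) a b c).adjugate k k) •
      adjCol (hermThree (fun i => d i - bandEnergy hA n) a b c) k := by
  rw [toEuclideanLin_eq_smul_iff, hermThree_sub] at hv
  ext j
  have := adjugate_mul_eq_of_mulVec_eq_zero hv k j
  rw [PiLp.smul_apply, adjCol_apply, smul_eq_mul, div_mul_eq_mul_div, eq_div_iff hk]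
  linear_combination this

theorem eq_inner_smul_of_isSimpleBand (hn : IsSimpleBand hA n) {v w : EuclideanSpace ℂ (Fin 3)}
    (hv : Matrix.toEuclideanLin (hermThree d a b c) v = (bandEnergy hA n : ℂ) • v)
    (hw : Matrix.toEuclideanLin (hermThree d a b c) w = (bandEnergy hA n : ℂ) • w)
    (hv1 : ‖v‖ = 1) : w = ⟪v, w⟫_ℂ • v := by
  obtain ⟨k, hk⟩ := exists_adjugate_ne_zero hA hn
  have h1 := eq_smul_adjCol hA hv hk
  have h2 := eq_smul_adjCol hA hw hk
  set s := adjCol (hermThree (fun i => d i - bandEnergy hA n) a b c) k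
  set α := v k / (hermThree (fun i => d i - bandEnergy hA n) a b c).adjugate k k
  set β := w k / (hermThree (fun i => d i - bandEnergy hA n) a b c).adjugate k k
  have hα : α ≠ 0 := by
    intro h0
    rw [h1, h0, zero_smul, norm_zero] at hv1
    exact zero_ne_one hv1
  have h3 : w = (β / α) • v := by
    rw [h1, h2, smul_smul, div_mul_cancel₀ _ hα]
  rw [h3, inner_smul_right, inner_self_eq_one_of_norm hv1, mul_one]

theorem inner_eq_zero_of_bandEnergy_ne {A : Matrix (Fin 3) (Fin 3) ℂ} (hA : A.IsHermitian)
    {m n : Fin 3} (hmn : bandEnergy hA m ≠ bandEnergy hA n) {v w : EuclideanSpace ℂ (Fin 3)}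
    (hv : Matrix.toEuclideanLin A v = (bandEnergy hA m : ℂ) • v)
    (hw : Matrix.toEuclideanLin A w = (bandEnergy hA n : ℂ) • w) : ⟪v, w⟫_ℂ = 0 := by
  have h := (Matrix.isSymmetric_toEuclideanLin_iff.2 hA) v w
  rw [hv, hw, inner_smul_left, inner_smul_right, Complex.conj_ofReal] at h
  have h2 : ((bandEnergy hA m : ℂ) - bandEnergy hA n) * ⟪v, w⟫_ℂ = 0 := by linear_combination h
  refine (mul_eq_zero.1 h2).resolve_left ?_
  exact sub_ne_zero.2 (by exact_mod_cast hmn)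

end Sections

section Normalize

variable {V : Type*} [NormedAddCommGroup V] [InnerProductSpace ℂ V]

/-- The unit vector field in the direction of `s` (zero where `s` vanishes). -/
noncomputable def unitField (s : ℝ × ℝ → V) (θ : ℝ × ℝ) : V := (((‖s θ‖⁻¹ : ℝ)) : ℂ) • s θ

theorem contDiffAt_unitField {s : ℝ × ℝ → V} {θ : ℝ × ℝ} (hs : ContDiffAt ℝ ∞ s θ)
    (h0 : s θ ≠ 0) : ContDiffAt ℝ ∞ (unitField s) θ := by
  have h1 : ContDiffAt ℝ ∞ (fun x => ((‖s x‖⁻¹ : ℝ) : ℂ)) θ :=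
    Complex.ofRealCLM.contDiff.contDiffAt.comp θ ((hs.norm ℂ h0).inv (norm_ne_zero_iff.2 h0))
  exact h1.smul hs

theorem norm_unitField {s : ℝ × ℝ → V} {θ : ℝ × ℝ} (h0 : s θ ≠ 0) : ‖unitField s θ‖ = 1 := by
  rw [unitField, norm_smul, Complex.norm_real, norm_inv, norm_norm,
    inv_mul_cancel₀ (norm_ne_zero_iff.2 h0)]

end Normalize

/-! ### Local eigenvector fields and the global curvature function -/

section Family

variable {d : ℝ × ℝ → Fin 3 → ℝ} {a b c : ℝ × ℝ → ℂ}
  (hA : ∀ θ, (hermThree (d θ) (a θ) (b θ) (c θ)).IsHermitian) {n : Fin 3}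

/-- The vector field formed by the `k`-th column of the adjugate of `A - E_n`. -/
noncomputable def eigenField (n k : Fin 3) (θ : ℝ × ℝ) : EuclideanSpace ℂ (Fin 3) :=
  adjCol (hermThree (fun i => d θ i - bandEnergy (hA θ) n) (a θ) (b θ) (c θ)) k

section

variable (hd : ContDiff ℝ ∞ d) (ha : ContDiff ℝ ∞ a) (hb : ContDiff ℝ ∞ b) (hc : ContDiff ℝ ∞ c)
  (hn : ∀ θ, IsSimpleBand (hA θ) n)
include hd ha hb hc hn

theorem contDiff_eigenField (k : Fin 3) : ContDiff ℝ ∞ (eigenField hA n k) := by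
  have hE : ContDiff ℝ ∞ fun θ => bandEnergy (hA θ) n :=
    contDiff_iff_contDiffAt.2 fun θ => contDiffAt_bandEnergy hd ha hb hc hA (hn θ)
  have hdi : ∀ i, ContDiff ℝ ∞ fun θ => ((d θ i - bandEnergy (hA θ) n : ℝ) : ℂ) := fun i =>
    Complex.ofRealCLM.contDiff.comp ((contDiff_pi.1 hd i).sub hE)
  have hst : ∀ {f : ℝ × ℝ → ℂ}, ContDiff ℝ ∞ f → ContDiff ℝ ∞ fun x => star (f x) := fun hf =>
    Complex.conjCLE.contDiff.comp hf
  have hM : ∀ i j, ContDiff ℝ ∞ fun θ =>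
      hermThree (fun i => d θ i - bandEnergy (hA θ) n) (a θ) (b θ) (c θ) i j := by
    intro i j
    fin_cases i <;> fin_cases j <;> simp only [hermThree, Matrix.of_apply, Matrix.cons_val',
      Matrix.cons_val_zero, Matrix.cons_val_one, Matrix.cons_val, Fin.mk_zero, Fin.mk_one,
      Fin.reduceFinMk]
    exacts [hdi 0, ha, hst hc, hst ha, hdi 1, hb, hc, hst hb, hdi 2]
  refine (contDiff_piLp 2).2 fun i => ?_
  simp only [eigenField, adjCol_apply, Matrix.adjugate_fin_three]
  generalize hN : (fun θ => hermThree (fun i => d θ i - bandEnergy (hA θ) n) (a θ) (b θ) (c θ)) = N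
    at hM
  have hN' : ∀ θ, hermThree (fun i => d θ i - bandEnergy (hA θ) n) (a θ) (b θ) (c θ) = N θ :=
    fun θ => congrFun hN θ
  simp only [hN'] at hM ⊢
  fin_cases i <;> fin_cases k <;> simp <;> fun_prop

theorem isLocalEigenvector_unitField {θ : ℝ × ℝ} {k : Fin 3} (h0 : eigenField hA n k θ ≠ 0) :
    IsLocalEigenvector hA n θ (unitField (eigenField hA n k)) := by
  have hs := contDiff_eigenField hA hd ha hb hc hn k
  refine ⟨contDiffAt_unitField hs.contDiffAt h0, ?_⟩
  filter_upwards [hs.continuous.continuousAt.eventually_ne h0] with x hx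
  refine ⟨norm_unitField hx, ?_⟩
  rw [unitField, map_smul, smul_comm]
  congr 1
  exact toEuclideanLin_adjCol (hA x) k

end

theorem exists_eigenField_ne_zero (hn : ∀ θ, IsSimpleBand (hA θ) n) (θ : ℝ × ℝ) : ∃ k, eigenField hA n k θ ≠ 0 := by
  obtain ⟨k, hk⟩ := exists_adjugate_ne_zero (hA θ) (hn θ)
  refine ⟨k, fun h => hk ?_⟩
  have := congrArg (fun v : EuclideanSpace ℂ (Fin 3) => v k) h
  exact this

theorem continuousAt_berryIntegrand {ψ : ℝ × ℝ → EuclideanSpace ℂ (Fin 3)} {θ : ℝ × ℝ}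
    (hψ : ContDiffAt ℝ ∞ ψ θ) : ContinuousAt (berryIntegrand ψ) θ := by
  have h : ∀ v, ContinuousAt (fun x => fderiv ℝ ψ x v) θ := fun v =>
    ((hψ.fderiv_right (m := 0) (by simp)).continuousAt).clm_apply continuousAt_const
  exact ((h _).inner (𝕜 := ℂ) (h _)).sub ((h _).inner (𝕜 := ℂ) (h _))

theorem berryIntegrand_eq_of_isLocalEigenvector {θ : ℝ × ℝ} (hn : ∀ θ, IsSimpleBand (hA θ) n)
    {ψ χ : ℝ × ℝ → EuclideanSpace ℂ (Fin 3)} (hψ : IsLocalEigenvector hA n θ ψ)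
    (hχ : IsLocalEigenvector hA n θ χ) : berryIntegrand χ θ = berryIntegrand ψ θ := by
  refine berryIntegrand_congr_phase (hψ.1.differentiableAt (by simp))
    (hχ.1.differentiableAt (by simp)) (hψ.2.mono fun _ h => h.1) (hχ.2.mono fun _ h => h.1) ?_
  filter_upwards [hψ.2, hχ.2] with x h1 h2
  exact eq_inner_smul_of_isSimpleBand (hA x) (hn x) h1.2 h2.2 h1.1

/-- `F` is the Berry curvature of the level `n`. -/
def IsBerryCurvature {A : ℝ × ℝ → Matrix (Fin 3) (Fin 3) ℂ} (hA : ∀ θ, (A θ).IsHermitian)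
    (n : Fin 3) (F : ℝ × ℝ → ℂ) : Prop :=
  Continuous F ∧ (∀ θ, ∃ ψ, IsLocalEigenvector hA n θ ψ) ∧
    ∀ θ ψ, IsLocalEigenvector hA n θ ψ → F θ = berryIntegrand ψ θ

/-- The column `k θ` used at `θ` may jump, but by gauge invariance the value near `θ` can be
computed with the single smooth field that is nonzero at `θ`; this gives continuity. -/
theorem exists_isBerryCurvature (hd : ContDiff ℝ ∞ d) (ha : ContDiff ℝ ∞ a) (hb : ContDiff ℝ ∞ b)
    (hc : ContDiff ℝ ∞ c) (hn : ∀ θ, IsSimpleBand (hA θ) n) : ∃ F, IsBerryCurvature hA n F := by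
  choose k hk using exists_eigenField_ne_zero hA hn
  have hloc : ∀ θ, IsLocalEigenvector hA n θ (unitField (eigenField hA n (k θ))) := fun θ =>
    isLocalEigenvector_unitField hA hd ha hb hc hn (hk θ)
  refine ⟨fun θ => berryIntegrand (unitField (eigenField hA n (k θ))) θ, ?_, fun θ => ⟨_, hloc θ⟩,
    fun θ ψ hψ => berryIntegrand_eq_of_isLocalEigenvector hA hn hψ (hloc θ)⟩
  rw [continuous_iff_continuousAt]
  intro θ
  refine (continuousAt_berryIntegrand (hloc θ).1).congr ?_
  have hs := contDiff_eigenField hA hd ha hb hc hn (k θ)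
  filter_upwards [hs.continuous.continuousAt.eventually_ne (hk θ)] with x hx
  exact berryIntegrand_eq_of_isLocalEigenvector hA hn (hloc x)
    (isLocalEigenvector_unitField hA hd ha hb hc hn hx)

theorem sum_isBerryCurvature {A : ℝ × ℝ → Matrix (Fin 3) (Fin 3) ℂ} {hA : ∀ θ, (A θ).IsHermitian}
    (hn : ∀ θ n, IsSimpleBand (hA θ) n)
    {F : Fin 3 → ℝ × ℝ → ℂ} (hF : ∀ n, IsBerryCurvature hA n (F n)) (θ : ℝ × ℝ) :
    ∑ n, F n θ = 0 := by
  choose ψ hψ using fun n => (hF n).2.1 θ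
  rw [Finset.sum_congr rfl fun n _ => (hF n).2.2 θ (ψ n) (hψ n)]
  refine sum_berryIntegrand_eq_zero (fun n => (hψ n).1.differentiableAt (by simp)) ?_
  filter_upwards [Filter.eventually_all.2 fun n => (hψ n).2] with x hx
  refine ⟨fun n => (hx n).1, fun m n hmn => ?_⟩
  exact inner_eq_zero_of_bandEnergy_ne (hA x) (hn x n m hmn) (hx m).2 (hx n).2

end Family

/-! ### Green's theorem and Berry phases of loops -/

section Green

open MeasureTheory

/-- The Berry phase of `ψ` along the loop `{t} × [0, 2π]`, up to a factor `i`. -/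
noncomputable def loopPhase (ψ : ℝ × ℝ → EuclideanSpace ℂ (Fin 3)) (t : ℝ) : ℂ :=
  ∫ y in (0 : ℝ)..2 * Real.pi, ⟪ψ (t, y), fderiv ℝ ψ (t, y) (0, 1)⟫_ℂ

theorem contDiffAt_inner_fderiv {ψ : ℝ × ℝ → EuclideanSpace ℂ (Fin 3)} {θ : ℝ × ℝ}
    (hψ : ContDiffAt ℝ ∞ ψ θ) (v : ℝ × ℝ) :
    ContDiffAt ℝ ∞ (fun x => ⟪ψ x, fderiv ℝ ψ x v⟫_ℂ) θ :=
  hψ.inner ℂ ((hψ.fderiv_right (m := ∞) (by simp)).clm_apply contDiffAt_const)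

/-- The curvature is the curl of the connection: the mixed second derivatives of `ψ` cancel by
symmetry. -/
theorem fderiv_inner_fderiv_sub {ψ : ℝ × ℝ → EuclideanSpace ℂ (Fin 3)} {θ : ℝ × ℝ}
    (hψ : ContDiffAt ℝ ∞ ψ θ) :
    fderiv ℝ (fun x => ⟪ψ x, fderiv ℝ ψ x (0, 1)⟫_ℂ) θ (1, 0)
      + fderiv ℝ (fun x => -⟪ψ x, fderiv ℝ ψ x (1, 0)⟫_ℂ) θ (0, 1) = berryIntegrand ψ θ := by
  have hd := hψ.differentiableAt (by simp)
  have hd2 : DifferentiableAt ℝ (fderiv ℝ ψ) θ :=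
    (hψ.fderiv_right (m := ∞) (by simp)).differentiableAt (by simp)
  have hv : ∀ v : ℝ × ℝ, DifferentiableAt ℝ (fun x => fderiv ℝ ψ x v) θ := fun v =>
    hd2.clm_apply (differentiableAt_const v)
  have hvv : ∀ v w : ℝ × ℝ, fderiv ℝ (fun x => fderiv ℝ ψ x v) θ w = fderiv ℝ (fderiv ℝ ψ) θ w v := by
    intro v w
    rw [fderiv_clm_apply hd2 (differentiableAt_const v)]
    simp
  have hsymm := hψ.isSymmSndFDerivAt (by simpa using WithTop.coe_le_coe.2 (le_top : (2 : ℕ∞) ≤ ⊤)) (1, 0) (0, 1)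
  rw [fderiv_fun_neg, neg_apply, fderiv_inner_apply ℂ hd (hv _),
    fderiv_inner_apply ℂ hd (hv _), hvv, hvv, hsymm, berryIntegrand]
  ring

/-- Green's theorem on the rectangle; the contributions of the sides `y = 0` and `y = 2π` cancel by
periodicity. -/
theorem integral_berryIntegrand_eq_loopPhase_sub {ψ : ℝ × ℝ → EuclideanSpace ℂ (Fin 3)} {t₁ t₂ : ℝ}
    (hψ : ∀ t ∈ Set.uIcc t₁ t₂, ∀ y, ContDiffAt ℝ ∞ ψ (t, y))
    (hper : ∀ x, ψ (x + (0, 2 * Real.pi)) = ψ x) :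
    ∫ t in t₁..t₂, ∫ y in (0 : ℝ)..2 * Real.pi, berryIntegrand ψ (t, y)
      = loopPhase ψ t₂ - loopPhase ψ t₁ := by
  set R := Set.uIcc t₁ t₂ ×ˢ Set.uIcc (0 : ℝ) (2 * Real.pi) with hR
  have hψR : ∀ x ∈ R, ContDiffAt ℝ ∞ ψ x := fun x hx => hψ x.1 hx.1 x.2
  have hf : ∀ v, ∀ x ∈ R, ContDiffAt ℝ ∞ (fun x => ⟪ψ x, fderiv ℝ ψ x v⟫_ℂ) x := fun v x hx =>
    contDiffAt_inner_fderiv (hψR x hx) v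
  have hsub : ∀ x ∈ Set.Ioo (min t₁ t₂) (max t₁ t₂) ×ˢ
      Set.Ioo (min (0 : ℝ) (2 * Real.pi)) (max 0 (2 * Real.pi)), x ∈ R := fun x hx =>
    ⟨Set.Ioo_subset_Icc_self hx.1, Set.Ioo_subset_Icc_self hx.2⟩
  have hcont : ContinuousOn (berryIntegrand ψ) R := fun x hx =>
    (continuousAt_berryIntegrand (hψR x hx)).continuousWithinAt
  have hint : IntegrableOn (fun x =>
      fderiv ℝ (fun x => ⟪ψ x, fderiv ℝ ψ x (0, 1)⟫_ℂ) x (1, 0)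
      + fderiv ℝ (fun x => -⟪ψ x, fderiv ℝ ψ x (1, 0)⟫_ℂ) x (0, 1)) R := by
    have h1 : IntegrableOn (berryIntegrand ψ) R :=
      hcont.integrableOn_compact (isCompact_uIcc.prod isCompact_uIcc)
    refine h1.congr_fun (fun x hx => ?_) (measurableSet_uIcc.prod measurableSet_uIcc)
    exact (fderiv_inner_fderiv_sub (hψR x hx)).symm
  have key := integral2_divergence_prod_of_hasFDerivAt
    (fun x => ⟪ψ x, fderiv ℝ ψ x (0, 1)⟫_ℂ) (fun x => -⟪ψ x, fderiv ℝ ψ x (1, 0)⟫_ℂ)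
    (fderiv ℝ (fun x => ⟪ψ x, fderiv ℝ ψ x (0, 1)⟫_ℂ))
    (fderiv ℝ (fun x => -⟪ψ x, fderiv ℝ ψ x (1, 0)⟫_ℂ)) t₁ 0 t₂ (2 * Real.pi)
    (fun x hx => (hf _ x hx).continuousAt.continuousWithinAt)
    (fun x hx => (hf _ x hx).neg.continuousAt.continuousWithinAt)
    (fun x hx => ((hf _ x (hsub x hx)).differentiableAt (by simp)).hasFDerivAt)
    (fun x hx => ((hf _ x (hsub x hx)).neg.differentiableAt (by simp)).hasFDerivAt) hint
  have hfd : ∀ x, fderiv ℝ ψ (x + (0, 2 * Real.pi)) = fderiv ℝ ψ x := by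
    intro x
    rw [← fderiv_comp_add_right]
    simp only [hper]
  have hbd : ∀ t : ℝ, ⟪ψ (t, 2 * Real.pi), fderiv ℝ ψ (t, 2 * Real.pi) (1, 0)⟫_ℂ
      = ⟪ψ (t, 0), fderiv ℝ ψ (t, 0) (1, 0)⟫_ℂ := by
    intro t
    have : ((t, 2 * Real.pi) : ℝ × ℝ) = (t, 0) + (0, 2 * Real.pi) := by simp
    rw [this, hper, hfd]
  simp only [hbd, sub_self, zero_add] at key
  rw [loopPhase, loopPhase, ← key]
  refine intervalIntegral.integral_congr fun t ht => ?_
  refine intervalIntegral.integral_congr fun y hy => ?_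
  exact (fderiv_inner_fderiv_sub (hψR (t, y) ⟨ht, hy⟩)).symm

/-- Two unit sections that differ by the phase `u₀ exp (i (N y + φ y))`. -/
theorem loopPhase_sub_loopPhase {ψ χ : ℝ × ℝ → EuclideanSpace ℂ (Fin 3)} {t : ℝ}
    (hψ : ∀ y, ContDiffAt ℝ ∞ ψ (t, y)) (hχ : ∀ y, ContDiffAt ℝ ∞ χ (t, y))
    (hψ1 : ∀ y, ‖ψ (t, y)‖ = 1) {N : ℝ} {u₀ : ℂ} (hu₀ : ‖u₀‖ = 1) {φ φ' : ℝ → ℝ}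
    (hφ : ∀ y, HasDerivAt φ (φ' y) y) (hφ0 : φ (2 * Real.pi) = φ 0)
    (h : ∀ y, χ (t, y) = (u₀ * Complex.exp (Complex.I * ((N * y + φ y : ℝ) : ℂ))) • ψ (t, y)) :
    loopPhase χ t - loopPhase ψ t = 2 * Real.pi * Complex.I * N := by
  have hcurve : ∀ {f : ℝ × ℝ → EuclideanSpace ℂ (Fin 3)}, (∀ y, ContDiffAt ℝ ∞ f (t, y)) → ∀ y,
      HasDerivAt (fun y => f (t, y)) (fderiv ℝ f (t, y) (0, 1)) y := by
    intro f hf y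
    exact ((hf y).differentiableAt (by simp)).hasFDerivAt.comp_hasDerivAt y
      ((hasDerivAt_const y t).prodMk (hasDerivAt_id y))
  have hcont : ∀ {f : ℝ × ℝ → EuclideanSpace ℂ (Fin 3)}, (∀ y, ContDiffAt ℝ ∞ f (t, y)) →
      Continuous fun y => ⟪f (t, y), fderiv ℝ f (t, y) (0, 1)⟫_ℂ := by
    intro f hf
    rw [continuous_iff_continuousAt]
    intro y
    exact (contDiffAt_inner_fderiv (hf y) (0, 1)).continuousAt.comp
      (f := fun y : ℝ => (t, y)) (by fun_prop)
  have hder : ∀ y, fderiv ℝ χ (t, y) (0, 1)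
      = (u₀ * Complex.exp (Complex.I * ((N * y + φ y : ℝ) : ℂ))) • fderiv ℝ ψ (t, y) (0, 1)
        + (u₀ * (Complex.exp (Complex.I * ((N * y + φ y : ℝ) : ℂ))
          * (Complex.I * ((N + φ' y : ℝ) : ℂ)))) • ψ (t, y) := by
    intro y
    have h1 : HasDerivAt (fun y => ((N * y + φ y : ℝ) : ℂ)) ((N + φ' y : ℝ) : ℂ) y := by
      have := (((hasDerivAt_id y).const_mul N).add (hφ y)).ofReal_comp
      simpa using this
    have h2 := ((h1.const_mul Complex.I).cexp.const_mul u₀).smul (hcurve hψ y)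
    refine (hcurve hχ y).unique ?_
    convert! h2 using 1
    funext y
    exact h y
  have hdiff : ∀ y, ⟪χ (t, y), fderiv ℝ χ (t, y) (0, 1)⟫_ℂ - ⟪ψ (t, y), fderiv ℝ ψ (t, y) (0, 1)⟫_ℂ
      = Complex.I * ((N + φ' y : ℝ) : ℂ) := by
    intro y
    have hexp : ∀ x : ℝ, (starRingEnd ℂ) (Complex.exp (Complex.I * (x : ℂ)))
        * Complex.exp (Complex.I * (x : ℂ)) = 1 := by
      intro x
      rw [← Complex.normSq_eq_conj_mul_self, Complex.normSq_eq_norm_sq, mul_comm,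
        Complex.norm_exp_ofReal_mul_I]
      simp
    have hu : (starRingEnd ℂ) u₀ * u₀ = 1 := by
      rw [← Complex.normSq_eq_conj_mul_self, Complex.normSq_eq_norm_sq, hu₀]; simp
    have hE := hexp (N * y + φ y)
    rw [hder, h]
    simp only [inner_add_right, inner_smul_left, inner_smul_right,
      inner_self_eq_one_of_norm (hψ1 y), map_mul]
    set e := Complex.exp (Complex.I * ((N * y + φ y : ℝ) : ℂ))
    set P := ⟪ψ (t, y), fderiv ℝ ψ (t, y) (0, 1)⟫_ℂ
    linear_combination (P + Complex.I * ((N + φ' y : ℝ) : ℂ)) *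
      ((starRingEnd ℂ) u₀ * u₀ * hE + hu)
  -- Continuity of `φ'` is not assumed: by `hdiff` it is, up to constants, a difference of two
  -- continuous inner products.
  have hφ'c : Continuous φ' := by
    have h1 : Continuous fun y => Complex.I * ((N + φ' y : ℝ) : ℂ) := by
      simp only [← hdiff]
      exact (hcont hχ).sub (hcont hψ)
    have h2 : Continuous fun y => (Complex.I * ((N + φ' y : ℝ) : ℂ)).im - N :=
      (Complex.continuous_im.comp h1).sub continuous_const
    simpa using h2
  rw [loopPhase, loopPhase, ← intervalIntegral.integral_sub
    ((hcont hχ).intervalIntegrable _ _) ((hcont hψ).intervalIntegrable _ _)]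
  simp only [hdiff]
  rw [intervalIntegral.integral_const_mul, intervalIntegral.integral_ofReal,
    intervalIntegral.integral_add (by simp) (hφ'c.intervalIntegrable _ _),
    intervalIntegral.integral_eq_sub_of_hasDerivAt (fun y _ => hφ y)
      (hφ'c.intervalIntegrable _ _), hφ0]
  simp
  ring

end Green

/-! ### The lowest level of a Hermitian `3 × 3` matrix with nonzero off-diagonal entries -/

section Lowest

open Complex (normSq)

/-- Jacobi's identity for the `2 × 2` minors of the adjugate. On singular matrices it says that the
product of two diagonal entries is the squared modulus of the off-diagonal one. -/
theorem minor_mul_minor_eq (e : Fin 3 → ℝ) (a b c : ℂ) :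
    (e 1 * e 2 - normSq b) * (e 0 * e 2 - normSq c)
      = normSq (star c * star b - a * e 2) + e 2 * hermDet e a b c := by
  simp [hermDet, Complex.normSq_apply]; ring

theorem minor_mul_minor_eq_left (e : Fin 3 → ℝ) (a b c : ℂ) :
    (e 1 * e 2 - normSq b) * (e 0 * e 1 - normSq a)
      = normSq (a * b - star c * e 1) + e 1 * hermDet e a b c := by
  simp [hermDet, Complex.normSq_apply]; ring

theorem minor_mul_minor_eq_right (e : Fin 3 → ℝ) (a b c : ℂ) :
    (e 0 * e 2 - normSq c) * (e 0 * e 1 - normSq a)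
      = normSq (star c * star a - b * e 0) + e 0 * hermDet e a b c := by
  simp [hermDet, Complex.normSq_apply]; ring

/-- The diagonal entries of the Hermitian rank one matrix with off-diagonal moduli
`‖a‖, ‖b‖, ‖c‖` in the places `12, 23, 31`. -/
noncomputable def rankOneDiag (a b c : ℂ) : Fin 3 → ℝ :=
  ![‖c‖ * ‖a‖ / ‖b‖, ‖a‖ * ‖b‖ / ‖c‖, ‖b‖ * ‖c‖ / ‖a‖]

section RankOne

variable {a b c : ℂ} (ha : a ≠ 0) (hb : b ≠ 0) (hc : c ≠ 0)
include ha hb hc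

theorem rankOneDiag_pos (i : Fin 3) : 0 < rankOneDiag a b c i := by
  have := norm_pos_iff.2 ha
  have := norm_pos_iff.2 hb
  have := norm_pos_iff.2 hc
  fin_cases i <;> simp [rankOneDiag] <;> positivity

theorem rankOneDiag_mul :
    rankOneDiag a b c 1 * rankOneDiag a b c 2 = normSq b ∧
    rankOneDiag a b c 0 * rankOneDiag a b c 2 = normSq c ∧
    rankOneDiag a b c 0 * rankOneDiag a b c 1 = normSq a := by
  have := norm_ne_zero_iff.2 ha
  have := norm_ne_zero_iff.2 hb
  have := norm_ne_zero_iff.2 hc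
  simp only [Complex.normSq_eq_norm_sq, rankOneDiag]
  refine ⟨?_, ?_, ?_⟩ <;> simp <;> field_simp

theorem rankOneDiag_mul_mul :
    rankOneDiag a b c 0 * rankOneDiag a b c 1 * rankOneDiag a b c 2 = ‖a‖ * ‖b‖ * ‖c‖ := by
  have := norm_ne_zero_iff.2 ha
  have := norm_ne_zero_iff.2 hb
  have := norm_ne_zero_iff.2 hc
  simp only [rankOneDiag]
  simp; field_simp

end RankOne

/-- Taking norms gives both claims. Applied to cyclic permutations of `a`, `b`, `c`, it identifies
each diagonal entry of the rank one matrix. -/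
theorem eq_of_mul_eq_normSq {a b c : ℂ} (ha : a ≠ 0) {x : ℝ} (hx : 0 ≤ x) (h : a * b * c = (normSq a : ℂ) * x) :
    a * b * c = ((‖a‖ * ‖b‖ * ‖c‖ : ℝ) : ℂ) ∧ x = rankOneDiag a b c 2 := by
  have hna := norm_pos_iff.2 ha
  have h1 : ‖a‖ * ‖b‖ * ‖c‖ = ‖a‖ ^ 2 * x := by
    have := congrArg norm h
    rw [norm_mul, norm_mul, norm_mul, Complex.norm_real, Complex.norm_real, Real.norm_of_nonneg hx,
      Real.norm_of_nonneg (Complex.normSq_nonneg a), Complex.normSq_eq_norm_sq] at this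
    exact this
  refine ⟨?_, ?_⟩
  · rw [h, h1, Complex.normSq_eq_norm_sq]; push_cast; ring
  · simp only [rankOneDiag, Matrix.cons_val]
    field_simp
    have : ‖a‖ * (‖b‖ * ‖c‖) = ‖a‖ * (‖a‖ * x) := by linarith
    have := mul_left_cancel₀ hna.ne' this
    linarith

theorem rankOneDiag_rotate (a b c : ℂ) :
    rankOneDiag b c a 2 = rankOneDiag a b c 0 ∧ rankOneDiag c a b 2 = rankOneDiag a b c 1 := by
  simp [rankOneDiag]

variable {d : Fin 3 → ℝ} {a b c : ℂ} (hA : (hermThree d a b c).IsHermitian)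

/-- By Jacobi's identity the principal minors have pairwise nonnegative products, so one negative
minor would make the other two nonpositive; but their sum is a product of two nonnegative gaps. -/
theorem minors_nonneg_of_lowest :
    0 ≤ (d 1 - bandEnergy hA 0) * (d 2 - bandEnergy hA 0) - normSq b ∧
    0 ≤ (d 0 - bandEnergy hA 0) * (d 2 - bandEnergy hA 0) - normSq c ∧
    0 ≤ (d 0 - bandEnergy hA 0) * (d 1 - bandEnergy hA 0) - normSq a := by
  have hdet := hermDet_sub_bandEnergy hA 0
  have hmin := hermMinors_sub_eq hA (bandEnergy hA 0)
  have u1 := bandEnergy_mono hA (show (0 : Fin 3) ≤ 1 by decide)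
  have u2 := bandEnergy_mono hA (show (0 : Fin 3) ≤ 2 by decide)
  have h1 := minor_mul_minor_eq (fun i => d i - bandEnergy hA 0) a b c
  have h2 := minor_mul_minor_eq_left (fun i => d i - bandEnergy hA 0) a b c
  have h3 := minor_mul_minor_eq_right (fun i => d i - bandEnergy hA 0) a b c
  rw [hdet, mul_zero, add_zero] at h1 h2 h3
  have h1' := h1.ge.trans' (Complex.normSq_nonneg _)
  have h2' := h2.ge.trans' (Complex.normSq_nonneg _)
  have h3' := h3.ge.trans' (Complex.normSq_nonneg _)
  have hs : 0 ≤ hermMinors (fun i => d i - bandEnergy hA 0) a b c := by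
    rw [hmin, sub_self, zero_mul, zero_mul, add_zero, add_zero]
    exact mul_nonneg (by linarith) (by linarith)
  simp only [hermMinors] at hs
  clear h1 h2 h3 hmin hdet
  generalize (d 1 - bandEnergy hA 0) * (d 2 - bandEnergy hA 0) - normSq b = m0 at *
  generalize (d 0 - bandEnergy hA 0) * (d 2 - bandEnergy hA 0) - normSq c = m1 at *
  generalize (d 0 - bandEnergy hA 0) * (d 1 - bandEnergy hA 0) - normSq a = m2 at *
  refine ⟨?_, ?_, ?_⟩ <;> by_contra! h
  · have := nonpos_of_mul_nonneg_right h1' h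
    have := nonpos_of_mul_nonneg_right h2' h
    linarith
  · have := nonpos_of_mul_nonneg_left h1' h
    have := nonpos_of_mul_nonneg_right h3' h
    linarith
  · have := nonpos_of_mul_nonneg_left h2' h
    have := nonpos_of_mul_nonneg_left h3' h
    linarith

/-- Nonnegative minors and nonzero off-diagonal entries make all pairwise products of the shifted
diagonal entries positive. They therefore share a sign, and their sum is nonnegative. -/
theorem sub_lowest_pos (ha : a ≠ 0) (hb : b ≠ 0) (hc : c ≠ 0) (i : Fin 3) :
    0 < d i - bandEnergy hA 0 := by
  obtain ⟨h1, h2, h3⟩ := minors_nonneg_of_lowest hA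
  have hs := sum_sub_eq_sum_bandEnergy hA (bandEnergy hA 0)
  have u1 := bandEnergy_mono hA (show (0 : Fin 3) ≤ 1 by decide)
  have u2 := bandEnergy_mono hA (show (0 : Fin 3) ≤ 2 by decide)
  have pa := Complex.normSq_pos.2 ha
  have pb := Complex.normSq_pos.2 hb
  have pc := Complex.normSq_pos.2 hc
  have hs' : 0 ≤ (d 0 - bandEnergy hA 0) + (d 1 - bandEnergy hA 0) + (d 2 - bandEnergy hA 0) := by
    linarith
  clear hs
  generalize hx0 : d 0 - bandEnergy hA 0 = e0 at *
  generalize hx1 : d 1 - bandEnergy hA 0 = e1 at *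
  generalize hx2 : d 2 - bandEnergy hA 0 = e2 at *
  have q0 : 0 < e1 * e2 := by linarith
  have q1 : 0 < e0 * e2 := by linarith
  have q2 : 0 < e0 * e1 := by linarith
  have p0 : 0 < e0 := by
    by_contra! h
    have : e1 ≤ 0 := (neg_of_mul_pos_right q2 h).le
    have : e2 ≤ 0 := (neg_of_mul_pos_right q1 h).le
    have : e0 = 0 := by linarith
    simp [this] at q2
  have p1 : 0 < e1 := pos_of_mul_pos_right q2 p0.le
  have p2 : 0 < e2 := pos_of_mul_pos_right q1 p0.le
  fin_cases i
  exacts [hx0 ▸ p0, hx1 ▸ p1, hx2 ▸ p2]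

section

variable (ha : a ≠ 0) (hb : b ≠ 0) (hc : c ≠ 0)
include ha hb hc

/-- By Jacobi's identity a zero diagonal entry of the adjugate kills its whole row. The two
off-diagonal equations fix the phase of `a * b * c` and the shifted entries `1` and `2`; entry `0`
is only bounded below, by another minor. This inequality is the reason why column `0` fails along a
ray and not only at the degeneracy. -/
theorem of_adjugate_zero_zero_eq_zero
    (h : (d 1 - bandEnergy hA 0) * (d 2 - bandEnergy hA 0) - normSq b = 0) :
    a * b * c = ((‖a‖ * ‖b‖ * ‖c‖ : ℝ) : ℂ) ∧
    d 1 - bandEnergy hA 0 = rankOneDiag a b c 1 ∧ d 2 - bandEnergy hA 0 = rankOneDiag a b c 2 ∧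
      rankOneDiag a b c 0 ≤ d 0 - bandEnergy hA 0 := by
  have hdet := hermDet_sub_bandEnergy hA 0
  have h1 := minor_mul_minor_eq (fun i => d i - bandEnergy hA 0) a b c
  have h2 := minor_mul_minor_eq_left (fun i => d i - bandEnergy hA 0) a b c
  rw [hdet, mul_zero, add_zero, h, zero_mul] at h1 h2
  have h1' := sub_eq_zero.1 (Complex.normSq_eq_zero.1 h1.symm)
  have h2' := sub_eq_zero.1 (Complex.normSq_eq_zero.1 h2.symm)
  have p1 := sub_lowest_pos hA ha hb hc 1
  have p2 := sub_lowest_pos hA ha hb hc 2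
  obtain ⟨-, hm1, -⟩ := minors_nonneg_of_lowest hA
  set e1 := d 1 - bandEnergy hA 0
  set e2 := d 2 - bandEnergy hA 0
  have k1 : a * b * c = (normSq a : ℂ) * e2 := by
    have := congrArg star h1'
    simp only [star_mul', Complex.star_def, Complex.conj_conj, Complex.conj_ofReal] at this
    rw [← Complex.mul_conj]
    linear_combination a * this
  have k2 : c * a * b = (normSq c : ℂ) * e1 := by
    simp only [Complex.star_def] at h2'
    rw [← Complex.mul_conj]
    linear_combination c * h2'
  obtain ⟨l1, l2⟩ := eq_of_mul_eq_normSq ha p2.le k1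
  obtain ⟨-, l3⟩ := eq_of_mul_eq_normSq hc p1.le k2
  rw [(rankOneDiag_rotate a b c).2] at l3
  refine ⟨l1, l3, l2, ?_⟩
  rw [← (rankOneDiag_mul ha hb hc).2.1, l2, ← sub_mul] at hm1
  have := nonneg_of_mul_nonneg_left hm1 (rankOneDiag_pos ha hb hc 2)
  linarith

theorem of_adjugate_one_one_eq_zero
    (h : (d 0 - bandEnergy hA 0) * (d 2 - bandEnergy hA 0) - normSq c = 0) :
    d 0 - bandEnergy hA 0 = rankOneDiag a b c 0 ∧ d 2 - bandEnergy hA 0 = rankOneDiag a b c 2 ∧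
      rankOneDiag a b c 1 ≤ d 1 - bandEnergy hA 0 := by
  have hdet := hermDet_sub_bandEnergy hA 0
  have h1 := minor_mul_minor_eq (fun i => d i - bandEnergy hA 0) a b c
  have h2 := minor_mul_minor_eq_right (fun i => d i - bandEnergy hA 0) a b c
  rw [hdet, mul_zero, add_zero, h] at h1 h2
  rw [mul_zero] at h1
  rw [zero_mul] at h2
  have h1' := sub_eq_zero.1 (Complex.normSq_eq_zero.1 h1.symm)
  have h2' := sub_eq_zero.1 (Complex.normSq_eq_zero.1 h2.symm)
  have p1 := sub_lowest_pos hA ha hb hc 0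
  have p2 := sub_lowest_pos hA ha hb hc 2
  obtain ⟨hm1, -, -⟩ := minors_nonneg_of_lowest hA
  set e0 := d 0 - bandEnergy hA 0
  set e2 := d 2 - bandEnergy hA 0
  have k1 : a * b * c = (normSq a : ℂ) * e2 := by
    have := congrArg star h1'
    simp only [star_mul', Complex.star_def, Complex.conj_conj, Complex.conj_ofReal] at this
    rw [← Complex.mul_conj]
    linear_combination a * this
  have k2 : b * c * a = (normSq b : ℂ) * e0 := by
    have := congrArg star h2'
    simp only [star_mul', Complex.star_def, Complex.conj_conj, Complex.conj_ofReal] at this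
    rw [← Complex.mul_conj]
    linear_combination b * this
  obtain ⟨-, l2⟩ := eq_of_mul_eq_normSq ha p2.le k1
  obtain ⟨-, l3⟩ := eq_of_mul_eq_normSq hb p1.le k2
  rw [(rankOneDiag_rotate a b c).1] at l3
  refine ⟨l3, l2, ?_⟩
  rw [← (rankOneDiag_mul ha hb hc).1, l2, ← sub_mul] at hm1
  have := nonneg_of_mul_nonneg_left hm1 (rankOneDiag_pos ha hb hc 2)
  linarith

/-- At a double lowest level the sum of the nonnegative principal minors vanishes, so each of them
does. Conversely, the shifted matrix has zero determinant, zero sum of minors and positive trace, so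
its ordered spectrum is `0, 0`, positive. -/
theorem bandEnergy_zero_eq_one_iff : bandEnergy hA 0 = bandEnergy hA 1 ↔
    a * b * c = ((‖a‖ * ‖b‖ * ‖c‖ : ℝ) : ℂ) ∧
      d 0 - d 2 = rankOneDiag a b c 0 - rankOneDiag a b c 2 ∧
      d 1 - d 2 = rankOneDiag a b c 1 - rankOneDiag a b c 2 := by
  constructor
  · intro h
    have hmin := hermMinors_sub_eq hA (bandEnergy hA 0)
    rw [← h, sub_self, zero_mul, zero_mul, add_zero, add_zero] at hmin
    obtain ⟨m0, m1, m2⟩ := minors_nonneg_of_lowest hA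
    simp only [hermMinors] at hmin
    obtain ⟨h1, h2, h3, -⟩ := of_adjugate_zero_zero_eq_zero hA ha hb hc (by linarith)
    obtain ⟨h4, -⟩ := of_adjugate_one_one_eq_zero hA ha hb hc (by linarith)
    exact ⟨h1, by linarith, by linarith⟩
  · rintro ⟨h1, h2, h3⟩
    -- The only candidate for the double eigenvalue: the shift that makes the diagonal equal to
    -- `rankOneDiag`.
    set x := d 2 - rankOneDiag a b c 2 with hx
    have hdx : ∀ i, d i - x = rankOneDiag a b c i := by
      intro i; fin_cases i <;> simp only [Fin.zero_eta, Fin.mk_one, Fin.reduceFinMk] <;> linarith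
    obtain ⟨r0, r1, r2⟩ := rankOneDiag_mul ha hb hc
    have rr := rankOneDiag_mul_mul ha hb hc
    have hdet := hermDet_sub_eq_prod hA x
    have hmin := hermMinors_sub_eq hA x
    have htr := sum_sub_eq_sum_bandEnergy hA x
    simp only [hdx] at hdet hmin htr
    have p0 := rankOneDiag_pos ha hb hc 0
    have p1 := rankOneDiag_pos ha hb hc 1
    have p2 := rankOneDiag_pos ha hb hc 2
    have hdet0 : hermDet (rankOneDiag a b c) a b c = 0 := by
      rw [hermDet, h1, Complex.ofReal_re, ← rr, ← r0, ← r1, ← r2]; ring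
    have hmin0 : hermMinors (rankOneDiag a b c) a b c = 0 := by
      rw [hermMinors, ← r0, ← r1, ← r2]; ring
    change hermDet (rankOneDiag a b c) a b c = _ at hdet
    change hermMinors (rankOneDiag a b c) a b c = _ at hmin
    rw [hdet0] at hdet
    rw [hmin0] at hmin
    have u1 := bandEnergy_mono hA (show (0 : Fin 3) ≤ 1 by decide)
    have u2 := bandEnergy_mono hA (show (1 : Fin 3) ≤ 2 by decide)
    have k2 : 0 < bandEnergy hA 2 - x := by linarith
    rcases mul_eq_zero.1 hdet.symm with h | h
    · rcases mul_eq_zero.1 h with h | h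
      · rw [h, zero_mul, zero_mul, add_zero, add_zero] at hmin
        rcases mul_eq_zero.1 hmin.symm with h' | h' <;> linarith
      · rw [h, zero_mul, mul_zero, add_zero, zero_add] at hmin
        rcases mul_eq_zero.1 hmin.symm with h' | h' <;> linarith
    · linarith

/-- Otherwise one of the first two shifted entries would also lie below its rank one value, and the
minor that it forms with the third entry would be negative. -/
theorem lt_sub_lowest_of_neg (hne : d 0 - d 2 - (rankOneDiag a b c 0 - rankOneDiag a b c 2) < 0 ∨
      d 1 - d 2 - (rankOneDiag a b c 1 - rankOneDiag a b c 2) < 0) :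
    rankOneDiag a b c 2 < d 2 - bandEnergy hA 0 := by
  obtain ⟨m0, m1, -⟩ := minors_nonneg_of_lowest hA
  obtain ⟨r0, r1, -⟩ := rankOneDiag_mul ha hb hc
  have e0 := sub_lowest_pos hA ha hb hc 0
  have e1 := sub_lowest_pos hA ha hb hc 1
  have e2 := sub_lowest_pos hA ha hb hc 2
  have p2 := rankOneDiag_pos ha hb hc 2
  by_contra! h
  rcases hne with hne | hne
  · have h0 : d 0 - bandEnergy hA 0 < rankOneDiag a b c 0 := by linarith
    have := mul_lt_mul h0 h e2 (rankOneDiag_pos ha hb hc 0).le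
    linarith
  · have h0 : d 1 - bandEnergy hA 0 < rankOneDiag a b c 1 := by linarith
    have := mul_lt_mul h0 h e2 (rankOneDiag_pos ha hb hc 1).le
    linarith

/-- Otherwise `A - E` would be a rank one positive matrix plus a diagonal matrix with entries `f0,
f1 > 0` and `f2 ≥ 0`. Its determinant, expanded in the `f`'s, is then positive, although `E` is an
eigenvalue. -/
theorem sub_lowest_lt_of_pos (hτ : a * b * c = ((‖a‖ * ‖b‖ * ‖c‖ : ℝ) : ℂ))
    (h0 : 0 < d 0 - d 2 - (rankOneDiag a b c 0 - rankOneDiag a b c 2))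
    (h1 : 0 < d 1 - d 2 - (rankOneDiag a b c 1 - rankOneDiag a b c 2)) :
    d 2 - bandEnergy hA 0 < rankOneDiag a b c 2 := by
  have hdet := hermDet_sub_bandEnergy hA 0
  obtain ⟨r0, r1, r2⟩ := rankOneDiag_mul ha hb hc
  have rr := rankOneDiag_mul_mul ha hb hc
  have p0 := rankOneDiag_pos ha hb hc 0
  have p1 := rankOneDiag_pos ha hb hc 1
  have p2 := rankOneDiag_pos ha hb hc 2
  rw [hermDet, hτ, Complex.ofReal_re, ← rr, ← r0, ← r1, ← r2] at hdet
  by_contra! h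
  obtain ⟨f0, hf0⟩ : ∃ f, f = d 0 - bandEnergy hA 0 - rankOneDiag a b c 0 := ⟨_, rfl⟩
  obtain ⟨f1, hf1⟩ : ∃ f, f = d 1 - bandEnergy hA 0 - rankOneDiag a b c 1 := ⟨_, rfl⟩
  obtain ⟨f2, hf2⟩ : ∃ f, f = d 2 - bandEnergy hA 0 - rankOneDiag a b c 2 := ⟨_, rfl⟩
  have g2 : 0 ≤ f2 := by linarith
  have g0 : 0 < f0 := by linarith
  have g1 : 0 < f1 := by linarith
  rw [show d 0 - bandEnergy hA 0 = f0 + rankOneDiag a b c 0 by linarith,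
    show d 1 - bandEnergy hA 0 = f1 + rankOneDiag a b c 1 by linarith,
    show d 2 - bandEnergy hA 0 = f2 + rankOneDiag a b c 2 by linarith] at hdet
  have : 0 < f0 * f1 * f2 + f0 * f1 * rankOneDiag a b c 2 + f0 * f2 * rankOneDiag a b c 1
      + f1 * f2 * rankOneDiag a b c 0 := by positivity
  linarith

end

end Lowest

/-! ### The Chern integral of the lowest level as a winding integral -/

section Winding

open Complex (slitPlane)

/-- Multiplication by `-i` lowers the argument by `π/2`, which leaves the principal range exactly
when the argument was below `-π/2`. The hypothesis excludes the negative imaginary axis, where the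
argument would land on `-π`. -/
theorem log_neg_I_mul {w : ℂ} (h : -Complex.I * w ∈ slitPlane) :
    Complex.log (-Complex.I * w) = Complex.log w - Real.pi / 2 * Complex.I
      + if w.re < 0 ∧ w.im < 0 then 2 * Real.pi * Complex.I else 0 := by
  have hw : w ≠ 0 := by
    rintro rfl
    simp at h
  have hI : -Complex.I ≠ 0 := by simp
  split_ifs with hT
  · have h1 : Complex.log (-w) = Complex.log w + Real.pi * Complex.I := by
      apply Complex.ext
      · simp [Complex.log_re]
      · simp [Complex.log_im, Complex.arg_neg_eq_arg_add_pi_of_im_neg hT.2]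
    have h2 : Complex.log (Complex.I * -w) = Complex.log Complex.I + Complex.log (-w) := by
      rw [Complex.log_mul_eq_add_log_iff Complex.I_ne_zero (neg_ne_zero.2 hw), Complex.arg_I]
      have := Complex.neg_pi_lt_arg (-w)
      have h3 : Complex.arg (-w) ≤ Real.pi / 2 := by
        rw [Complex.arg_le_pi_div_two_iff]; left; simpa using hT.1.le
      have h4 : 0 ≤ Complex.arg (-w) := Complex.arg_nonneg_iff.2 (by simpa using hT.2.le)
      constructor <;> linarith [Real.pi_pos]
    rw [neg_mul, ← mul_neg, h2, h1, Complex.log_I]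
    ring
  · have h2 : Complex.log (-Complex.I * w) = Complex.log (-Complex.I) + Complex.log w := by
      rw [Complex.log_mul_eq_add_log_iff hI hw, Complex.arg_neg_I]
      have h3 : -(Real.pi / 2) < Complex.arg w := by
        rw [Complex.neg_pi_div_two_lt_arg_iff]
        by_contra! hc
        refine hT ⟨lt_of_le_of_ne hc.1 fun h0 => ?_, hc.2⟩
        rw [Complex.mem_slitPlane_iff] at h
        simp at h
        rcases h with h | h
        · linarith
        · exact h h0
      have h4 := Complex.arg_le_pi w
      constructor <;> linarith [Real.pi_pos]
    rw [h2, Complex.log_neg_I]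
    ring

variable {d : ℝ → Fin 3 → ℝ} {a b κ : ℂ}

/-- The curve in the plane whose winding number around `0` is the Chern index of the lowest
level. -/
noncomputable def windCurve (d : ℝ → Fin 3 → ℝ) (a b κ : ℂ) (t : ℝ) : ℂ :=
  ((rankOneDiag a b κ 0 - rankOneDiag a b κ 2 - (d t 0 - d t 2) : ℝ) : ℂ)
    + ((rankOneDiag a b κ 1 - rankOneDiag a b κ 2 - (d t 1 - d t 2) : ℝ) : ℂ) * Complex.I

theorem windCurve_re (t : ℝ) : (windCurve d a b κ t).re
    = rankOneDiag a b κ 0 - rankOneDiag a b κ 2 - (d t 0 - d t 2) := by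
  simp [windCurve]

theorem windCurve_im (t : ℝ) : (windCurve d a b κ t).im
    = rankOneDiag a b κ 1 - rankOneDiag a b κ 2 - (d t 1 - d t 2) := by
  simp [windCurve]

theorem contDiff_windCurve (hd : ContDiff ℝ ∞ d) : ContDiff ℝ ∞ (windCurve d a b κ) := by
  have h : ∀ i, ContDiff ℝ ∞ fun t => d t i := contDiff_pi.1 hd
  have h0 := h 0
  have h1 := h 1
  have h2 := h 2
  have hof : ∀ {f : ℝ → ℝ}, ContDiff ℝ ∞ f → ContDiff ℝ ∞ fun x => ((f x : ℝ) : ℂ) := fun hf =>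
    Complex.ofRealCLM.contDiff.comp hf
  exact (hof (by fun_prop)).add ((hof (by fun_prop)).mul contDiff_const)

/-- The phase factor `e^{-i y}` times `κ`. -/
noncomputable def rotatingEntry (κ : ℂ) (y : ℝ) : ℂ := κ * Complex.exp (-(Complex.I * (y : ℂ)))

theorem norm_rotatingEntry (κ : ℂ) (y : ℝ) : ‖rotatingEntry κ y‖ = ‖κ‖ := by
  rw [rotatingEntry, norm_mul, ← mul_neg, ← Complex.ofReal_neg, mul_comm Complex.I,
    Complex.norm_exp_ofReal_mul_I, mul_one]

theorem contDiff_rotatingEntry (κ : ℂ) : ContDiff ℝ ∞ (rotatingEntry κ) :=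
  contDiff_const.mul (contDiff_const.mul Complex.ofRealCLM.contDiff).neg.cexp

theorem rotatingEntry_add_two_pi (κ : ℂ) (y : ℝ) :
    rotatingEntry κ (y + 2 * Real.pi) = rotatingEntry κ y := by
  rw [rotatingEntry, rotatingEntry, Complex.ofReal_add, mul_add, neg_add, Complex.exp_add]
  have : Complex.exp (-(Complex.I * ((2 * Real.pi : ℝ) : ℂ))) = 1 := by
    rw [Complex.exp_neg, inv_eq_one, mul_comm]
    push_cast
    exact Complex.exp_two_pi_mul_I
  rw [this, mul_one]

theorem rankOneDiag_rotatingEntry (y : ℝ) :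
    rankOneDiag a b (rotatingEntry κ y) = rankOneDiag a b κ := by
  simp [rankOneDiag, norm_rotatingEntry]

variable (hA : ∀ θ : ℝ × ℝ, (hermThree (d θ.1) a b (rotatingEntry κ θ.2)).IsHermitian)

theorem adjugate_zero_zero (e : Fin 3 → ℝ) (a b c : ℂ) : (hermThree e a b c).adjugate 0 0
    = ((e 1 * e 2 - Complex.normSq b : ℝ) : ℂ) := by
  rw [Matrix.adjugate_fin_three]
  simp [hermThree, ← Complex.mul_conj]

theorem adjugate_one_one (e : Fin 3 → ℝ) (a b c : ℂ) : (hermThree e a b c).adjugate 1 1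
    = ((e 0 * e 2 - Complex.normSq c : ℝ) : ℂ) := by
  rw [Matrix.adjugate_fin_three]
  simp [hermThree, ← Complex.mul_conj, mul_comm]

theorem adjugate_zero_one (e : Fin 3 → ℝ) (a b c : ℂ) : (hermThree e a b c).adjugate 0 1
    = star c * star b - a * e 2 := by
  rw [Matrix.adjugate_fin_three]
  simp [hermThree]
  ring

section

variable (ha : a ≠ 0) (hb : b ≠ 0) (hκ : κ ≠ 0)

theorem rotatingEntry_ne_zero {κ : ℂ} (hκ : κ ≠ 0) (y : ℝ) : rotatingEntry κ y ≠ 0 :=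
  mul_ne_zero hκ (Complex.exp_ne_zero _)

include ha hb hκ

/-- If the minor vanished, `of_adjugate_zero_zero_eq_zero` would put `windCurve` on the cut: zero
imaginary part and nonpositive real part. -/
theorem minor_zero_pos {t : ℝ} (hw : windCurve d a b κ t ∈ slitPlane) (y : ℝ) :
    0 < (d t 1 - bandEnergy (hA (t, y)) 0) * (d t 2 - bandEnergy (hA (t, y)) 0)
      - Complex.normSq b := by
  refine lt_of_le_of_ne (minors_nonneg_of_lowest (hA (t, y))).1 fun h => ?_
  obtain ⟨-, h1, h2, h3⟩ := of_adjugate_zero_zero_eq_zero (hA (t, y)) ha hb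
    (rotatingEntry_ne_zero hκ y) h.symm
  simp only [rankOneDiag_rotatingEntry] at h1 h2 h3
  rw [Complex.mem_slitPlane_iff, windCurve_re, windCurve_im] at hw
  rcases hw with hw | hw
  · linarith
  · exact hw (by linarith)

/-- The same argument with the two coordinates exchanged: the cut is now the closed negative
imaginary axis. -/
theorem minor_one_pos {t : ℝ} (hw : -Complex.I * windCurve d a b κ t ∈ slitPlane) (y : ℝ) :
    0 < (d t 0 - bandEnergy (hA (t, y)) 0) * (d t 2 - bandEnergy (hA (t, y)) 0)
      - Complex.normSq (rotatingEntry κ y) := by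
  refine lt_of_le_of_ne (minors_nonneg_of_lowest (hA (t, y))).2.1 fun h => ?_
  obtain ⟨h1, h2, h3⟩ := of_adjugate_one_one_eq_zero (hA (t, y)) ha hb
    (rotatingEntry_ne_zero hκ y) h.symm
  simp only [rankOneDiag_rotatingEntry] at h1 h2 h3
  rw [Complex.mem_slitPlane_iff] at hw
  simp only [neg_mul, Complex.neg_re, Complex.I_mul_re, neg_neg, Complex.neg_im, Complex.I_mul_im,
    windCurve_re, windCurve_im] at hw
  rcases hw with hw | hw
  · linarith
  · exact hw (by linarith)

theorem eigenField_zero_ne_zero {t : ℝ} (hw : windCurve d a b κ t ∈ slitPlane) (y : ℝ) :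
    eigenField hA 0 0 (t, y) ≠ 0 := by
  intro h
  have h1 := congrArg (fun v : EuclideanSpace ℂ (Fin 3) => v 0) h
  have h2 := minor_zero_pos hA ha hb hκ hw y
  simp only [eigenField, adjCol_apply, adjugate_zero_zero, PiLp.zero_apply,
    Complex.ofReal_eq_zero] at h1
  exact h2.ne' h1

theorem eigenField_one_ne_zero {t : ℝ} (hw : -Complex.I * windCurve d a b κ t ∈ slitPlane) (y : ℝ) :
    eigenField hA 0 1 (t, y) ≠ 0 := by
  intro h
  have h1 := congrArg (fun v : EuclideanSpace ℂ (Fin 3) => v 1) h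
  have h2 := minor_one_pos hA ha hb hκ hw y
  simp only [eigenField, adjCol_apply, adjugate_one_one, PiLp.zero_apply,
    Complex.ofReal_eq_zero] at h1
  exact h2.ne' h1

/-- On the kernel line, column `1` is column `0` times the ratio of the entries `01` and `00` of the
adjugate. Entry `00` is positive, so after normalization only the phase of `z` remains. -/
theorem unitField_one_eq {t : ℝ} (hw : windCurve d a b κ t ∈ slitPlane) (y : ℝ) {z : ℂ}
    (hz : z = star (rotatingEntry κ y) * star b - a * ((d t 2 - bandEnergy (hA (t, y)) 0 : ℝ) : ℂ)) :
    unitField (eigenField hA 0 1) (t, y) = (z / ‖z‖) • unitField (eigenField hA 0 0) (t, y) := by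
  have hm := minor_zero_pos hA ha hb hκ hw y
  set m := (d t 1 - bandEnergy (hA (t, y)) 0) * (d t 2 - bandEnergy (hA (t, y)) 0)
      - Complex.normSq b with hmdef
  have h1 : eigenField hA 0 1 (t, y) = (z / (m : ℂ)) • eigenField hA 0 0 (t, y) := by
    have := eq_smul_adjCol (hA (t, y)) (toEuclideanLin_adjCol (hA (t, y)) (n := 0) 1) (k := 0)
      (by rw [adjugate_zero_zero]; exact_mod_cast hm.ne')
    rw [adjCol_apply, adjugate_zero_zero, adjugate_zero_one, ← hz, ← hmdef] at this
    exact this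
  have hn : ‖eigenField hA 0 1 (t, y)‖ = ‖z‖ / m * ‖eigenField hA 0 0 (t, y)‖ := by
    rw [h1, norm_smul, norm_div, Complex.norm_real, Real.norm_of_nonneg hm.le]
  rw [unitField, unitField, hn, h1, smul_smul, smul_smul]
  congr 1
  have hmC : (m : ℂ) ≠ 0 := by exact_mod_cast hm.ne'
  push_cast
  rw [mul_inv, inv_div]
  field_simp

end

end Winding

/-! ### Berry phases of the two adjugate columns compared -/

section Jump

open Complex (slitPlane)

theorem bandEnergy_congr {A B : Matrix (Fin 3) (Fin 3) ℂ} (h : A = B) (hA : A.IsHermitian)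
    (hB : B.IsHermitian) (n : Fin 3) : bandEnergy hA n = bandEnergy hB n := by
  subst h; rfl

variable {d : ℝ → Fin 3 → ℝ} {a b κ : ℂ}
  (hA : ∀ θ : ℝ × ℝ, (hermThree (d θ.1) a b (rotatingEntry κ θ.2)).IsHermitian)

theorem eigenField_congr {θ θ' : ℝ × ℝ} {n k : Fin 3} (hd : d θ'.1 = d θ.1)
    (hc : rotatingEntry κ θ'.2 = rotatingEntry κ θ.2) :
    eigenField hA n k θ' = eigenField hA n k θ := by
  have hE : bandEnergy (hA θ') n = bandEnergy (hA θ) n :=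
    bandEnergy_congr (by rw [hd, hc]) _ _ n
  rw [eigenField, eigenField, hE, hd, hc]

section

variable (hd : ContDiff ℝ ∞ d) (hn : ∀ θ, IsSimpleBand (hA θ) 0)
include hd hn

theorem contDiff_lowestBand : ContDiff ℝ ∞ fun θ => bandEnergy (hA θ) 0 :=
  contDiff_iff_contDiffAt.2 fun θ => contDiffAt_bandEnergy (hd.comp contDiff_fst) contDiff_const
    contDiff_const ((contDiff_rotatingEntry κ).comp contDiff_snd) hA (hn θ)

theorem contDiff_lowestField (k : Fin 3) : ContDiff ℝ ∞ (eigenField hA 0 k) :=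
  contDiff_eigenField hA (hd.comp contDiff_fst) contDiff_const
    contDiff_const ((contDiff_rotatingEntry κ).comp contDiff_snd) hn k

variable (ha : a ≠ 0) (hb : b ≠ 0) (hκ : κ ≠ 0)
include ha hb hκ

/-- The factor `m` never meets the cut, so its argument is a smooth periodic function and
contributes nothing; the transition phase winds `N` times. -/
theorem loopPhase_one_sub_loopPhase_zero_of_phase {t : ℝ} (hw₀ : windCurve d a b κ t ∈ slitPlane)
    (hw₁ : -Complex.I * windCurve d a b κ t ∈ slitPlane) {m : ℝ → ℂ} (hm : Differentiable ℝ m)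
    (hmp : m (2 * Real.pi) = m 0) (hms : ∀ y, m y ∈ slitPlane) {u₀ : ℂ} (hu₀ : ‖u₀‖ = 1) {N : ℝ}
    {z : ℝ → ℂ} (hz : ∀ y, z y = star (rotatingEntry κ y) * star b
      - a * ((d t 2 - bandEnergy (hA (t, y)) 0 : ℝ) : ℂ))
    (hzm : ∀ y, z y / ‖z y‖ = u₀ * Complex.exp (Complex.I * ((N * y : ℝ) : ℂ)) * (m y / ‖m y‖)) :
    loopPhase (unitField (eigenField hA 0 1)) t - loopPhase (unitField (eigenField hA 0 0)) t
      = 2 * Real.pi * Complex.I * N := by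
  refine loopPhase_sub_loopPhase
    (fun y => contDiffAt_unitField (contDiff_lowestField hA hd hn 0).contDiffAt
      (eigenField_zero_ne_zero hA ha hb hκ hw₀ y))
    (fun y => contDiffAt_unitField (contDiff_lowestField hA hd hn 1).contDiffAt
      (eigenField_one_ne_zero hA ha hb hκ hw₁ y))
    (fun y => norm_unitField (eigenField_zero_ne_zero hA ha hb hκ hw₀ y)) hu₀
    (φ := fun y => (Complex.log (m y)).im) (φ' := fun y => (deriv m y / m y).im) (fun y => ?_) ?_
    fun y => ?_
  · exact (Complex.imCLM.hasFDerivAt.comp_hasDerivAt y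
      ((hm y).hasDerivAt.clog_real (hms y)))
  · simp only [hmp]
  · rw [unitField_one_eq hA ha hb hκ hw₀ y (hz y), hzm]
    congr 1
    have h0 : (‖m y‖ : ℂ) ≠ 0 := by
      exact_mod_cast norm_ne_zero_iff.2 (Complex.slitPlane_ne_zero (hms y))
    have h1 := Complex.norm_mul_exp_arg_mul_I (m y)
    rw [Complex.log_im, Complex.ofReal_add, mul_add, Complex.exp_add, mul_assoc]
    congr 2
    rw [div_eq_iff h0, mul_comm Complex.I ((m y).arg : ℂ)]
    linear_combination -h1

/-- The transition function is `z = star c * star b - a * e`, where `c` rotates with `y` and `e` is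
the third shifted diagonal entry. Its winding depends on which of the two terms prevails, that is,
on whether `e` is below or above `‖b‖ * ‖c‖ / ‖a‖` at the critical phase `a * b * c > 0`. -/
theorem loopPhase_one_sub_loopPhase_zero {t : ℝ} (hw₀ : windCurve d a b κ t ∈ slitPlane)
    (hw₁ : -Complex.I * windCurve d a b κ t ∈ slitPlane) :
    loopPhase (unitField (eigenField hA 0 1)) t - loopPhase (unitField (eigenField hA 0 0)) t
      = if (windCurve d a b κ t).re < 0 ∧ (windCurve d a b κ t).im < 0 then 2 * Real.pi * Complex.I
        else 0 := by
  have hE : Differentiable ℝ fun y => ((d t 2 - bandEnergy (hA (t, y)) 0 : ℝ) : ℂ) := by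
    have h1 : ContDiff ℝ ∞ fun y : ℝ => bandEnergy (hA (t, y)) 0 :=
      (contDiff_lowestBand hA hd hn).comp (contDiff_const.prodMk contDiff_id)
    have h2 : ContDiff ℝ ∞ fun y => ((d t 2 - bandEnergy (hA (t, y)) 0 : ℝ) : ℂ) :=
      Complex.ofRealCLM.contDiff.comp (contDiff_const.sub h1)
    exact h2.differentiable (by simp)
  have hτd : Differentiable ℝ fun y => a * b * rotatingEntry κ y :=
    ((contDiff_rotatingEntry κ).differentiable (by simp)).const_mul _
  have hτsd : Differentiable ℝ fun y => star (a * b * rotatingEntry κ y) :=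
    fun y => (Complex.conjCLE.differentiableAt).comp y (hτd y)
  have hcp : rotatingEntry κ (2 * Real.pi) = rotatingEntry κ 0 := by
    simpa using rotatingEntry_add_two_pi κ 0
  have hna : (‖a‖ : ℂ) ≠ 0 := by exact_mod_cast norm_ne_zero_iff.2 ha
  have hnaR := norm_pos_iff.2 ha
  have hnaC : a * star a = (‖a‖ : ℂ) ^ 2 := by
    rw [Complex.star_def, Complex.mul_conj, Complex.normSq_eq_norm_sq]; push_cast; rfl
  have hnorm : ∀ y, ‖a * b * rotatingEntry κ y‖ = ‖a‖ ^ 2 * rankOneDiag a b κ 2 := by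
    intro y
    rw [norm_mul, norm_mul, norm_rotatingEntry]
    simp only [rankOneDiag, Matrix.cons_val]
    field_simp
  split_ifs with hT
  · -- the phase winds once
    -- With `τ = a * b * c(y)` one has `z = a * m / τ`, and `1 / τ` turns once. The value of `m` can
    -- be real only for real `τ`: it is clearly positive for `τ < 0`, and for `τ > 0` it is `τ`
    -- times the gap supplied by `sub_lowest_lt_of_pos`.
    set m : ℝ → ℂ := fun y => ((‖a * b * κ‖ ^ 2 / ‖a‖ ^ 2 : ℝ) : ℂ)
      - ((d t 2 - bandEnergy (hA (t, y)) 0 : ℝ) : ℂ) * (a * b * rotatingEntry κ y) with hm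
    have hτ0 : a * b * κ ≠ 0 := mul_ne_zero (mul_ne_zero ha hb) hκ
    have hms : ∀ y, m y ∈ slitPlane := by
      intro y
      have he := sub_lowest_pos (hA (t, y)) ha hb (rotatingEntry_ne_zero hκ y) 2
      have hlt := sub_lowest_lt_of_pos (hA (t, y)) ha hb (rotatingEntry_ne_zero hκ y)
      rw [rankOneDiag_rotatingEntry, ← norm_mul, ← norm_mul] at hlt
      rw [windCurve_re, windCurve_im] at hT
      have hny := hnorm y
      rw [Complex.mem_slitPlane_iff]
      simp only [hm, Complex.sub_re, Complex.sub_im, Complex.ofReal_re, Complex.ofReal_im,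
        Complex.re_ofReal_mul, Complex.im_ofReal_mul, zero_sub]
      have hn0 : ‖a * b * κ‖ = ‖a * b * rotatingEntry κ y‖ := by
        rw [norm_mul, norm_mul _ (rotatingEntry κ y), norm_rotatingEntry]
      have hpos : 0 < ‖a * b * κ‖ := norm_pos_iff.2 hτ0
      rw [hn0] at hpos ⊢
      by_cases him : (a * b * rotatingEntry κ y).im = 0
      · left
        rcases le_or_gt (a * b * rotatingEntry κ y).re 0 with hre | hre
        · have h1 := mul_nonneg he.le (neg_nonneg.2 hre)
          have h2 : 0 < ‖a * b * rotatingEntry κ y‖ ^ 2 / ‖a‖ ^ 2 := by positivity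
          linarith
        · have h3 : (a * b * rotatingEntry κ y) = (((a * b * rotatingEntry κ y).re : ℝ) : ℂ) := by
            apply Complex.ext <;> simp [him]
          have h4 : (a * b * rotatingEntry κ y).re = ‖a * b * rotatingEntry κ y‖ := by
            conv_rhs => rw [h3, Complex.norm_real, Real.norm_of_nonneg hre.le]
          have h5 := hlt (by rw [← h4]; exact h3) (by linarith) (by linarith)
          rw [h4]
          have h6 : ‖a * b * rotatingEntry κ y‖ ^ 2 / ‖a‖ ^ 2
              = ‖a * b * rotatingEntry κ y‖ * rankOneDiag a b κ 2 := by
            rw [hny]; field_simp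
          rw [h6, mul_comm, ← sub_mul]
          exact mul_pos (by linarith) hpos
      · right
        exact neg_ne_zero.2 (mul_ne_zero he.ne' him)
    have key := loopPhase_one_sub_loopPhase_zero_of_phase hA hd hn ha hb hκ hw₀ hw₁ (m := m)
      ((differentiable_const _).sub (hE.mul hτd)) (by simp only [hm, hcp]) hms
      (u₀ := a / ‖a‖ * (‖a * b * κ‖ / (a * b * κ))) (by
        rw [norm_mul, norm_div, norm_div, Complex.norm_real, Complex.norm_real, norm_norm,
          norm_norm, div_self hnaR.ne', div_self (norm_ne_zero_iff.2 hτ0), mul_one])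
      (N := 1) (fun y => rfl) (fun y => ?_)
    · rw [key]; simp
    · have hz : star (rotatingEntry κ y) * star b
          - a * ((d t 2 - bandEnergy (hA (t, y)) 0 : ℝ) : ℂ)
          = a * m y / (a * b * rotatingEntry κ y) := by
        have hc := rotatingEntry_ne_zero hκ y
        rw [eq_div_iff (mul_ne_zero (mul_ne_zero ha hb) hc)]
        have h1 : ((‖a * b * κ‖ ^ 2 / ‖a‖ ^ 2 : ℝ) : ℂ)
            = b * star b * (rotatingEntry κ y * star (rotatingEntry κ y)) := by
          rw [Complex.star_def, Complex.mul_conj, Complex.mul_conj,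
            Complex.normSq_eq_norm_sq, Complex.normSq_eq_norm_sq, norm_rotatingEntry, norm_mul,
            norm_mul]
          push_cast
          field_simp
        rw [hm]
        simp only [h1]
        ring
      have hexp : rotatingEntry κ y * Complex.exp (Complex.I * ((1 * y : ℝ) : ℂ)) = κ := by
        rw [rotatingEntry, mul_assoc, ← Complex.exp_add]
        simp
      have hexp0 := Complex.exp_ne_zero (Complex.I * ((1 * y : ℝ) : ℂ))
      have hm0 : (‖m y‖ : ℂ) ≠ 0 := by
        exact_mod_cast norm_ne_zero_iff.2 (Complex.slitPlane_ne_zero (hms y))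
      have hc := rotatingEntry_ne_zero hκ y
      have hnκ : (‖κ‖ : ℂ) ≠ 0 := by exact_mod_cast norm_ne_zero_iff.2 hκ
      have hnb : (‖b‖ : ℂ) ≠ 0 := by exact_mod_cast norm_ne_zero_iff.2 hb
      rw [hz, norm_div, norm_mul, norm_mul, norm_mul, norm_mul, norm_mul, norm_rotatingEntry]
      generalize Complex.exp (Complex.I * ((1 * y : ℝ) : ℂ)) = ex at *
      generalize rotatingEntry κ y = ρ at hexp hc ⊢
      rw [← hexp]
      push_cast
      have : (‖ρ * ex‖ : ℂ) ≠ 0 := by rw [hexp]; exact hnκ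
      field_simp
  -- Here `z = -a * (e - star τ / ‖a‖ ^ 2)` and `e` exceeds `‖τ‖ / ‖a‖ ^ 2`, so the bracket has
  -- positive real part and nothing winds.
  · have hms : ∀ y, ((d t 2 - bandEnergy (hA (t, y)) 0 : ℝ) : ℂ)
        - star (a * b * rotatingEntry κ y) / (‖a‖ : ℂ) ^ 2 ∈ slitPlane := by
      intro y
      have hne := lt_sub_lowest_of_neg (hA (t, y)) ha hb (rotatingEntry_ne_zero hκ y)
      rw [rankOneDiag_rotatingEntry] at hne
      have hne' := hne (by
        rw [windCurve_re, windCurve_im] at hT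
        rw [Complex.mem_slitPlane_iff] at hw₀ hw₁
        simp only [neg_mul, Complex.neg_re, Complex.I_mul_re, neg_neg, Complex.neg_im,
          Complex.I_mul_im, windCurve_re, windCurve_im] at hw₀ hw₁
        -- Off both cuts and outside the open third quadrant, the real or the imaginary part of the
        -- curve is positive.
        by_contra! hcon
        refine hT ⟨?_, ?_⟩
        · refine lt_of_le_of_ne (by linarith) fun h => ?_
          rcases hw₁ with hw₁ | hw₁
          · linarith
          · exact hw₁ (by linarith)
        · refine lt_of_le_of_ne (by linarith) fun h => ?_
          rcases hw₀ with hw₀ | hw₀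
          · linarith
          · exact hw₀ (by linarith))
      rw [Complex.mem_slitPlane_iff]
      left
      have h1 : (star (a * b * rotatingEntry κ y) / (‖a‖ : ℂ) ^ 2).re
          = (a * b * rotatingEntry κ y).re / ‖a‖ ^ 2 := by
        rw [← Complex.ofReal_pow, Complex.div_ofReal_re, Complex.star_def, Complex.conj_re]
      rw [Complex.sub_re, Complex.ofReal_re, h1, sub_pos]
      refine lt_of_le_of_lt ?_ hne'
      rw [div_le_iff₀ (by positivity), mul_comm (rankOneDiag a b κ 2), ← hnorm y]
      exact Complex.re_le_norm _
    have key := loopPhase_one_sub_loopPhase_zero_of_phase hA hd hn ha hb hκ hw₀ hw₁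
      (m := fun y => ((d t 2 - bandEnergy (hA (t, y)) 0 : ℝ) : ℂ)
        - star (a * b * rotatingEntry κ y) / (‖a‖ : ℂ) ^ 2)
      (hE.sub (hτsd.div_const _)) (by simp only [hcp]) hms
      (u₀ := -(a / ‖a‖)) (by
        rw [norm_neg, norm_div, Complex.norm_real, norm_norm, div_self hnaR.ne'])
      (N := 0) (fun y => rfl) (fun y => ?_)
    · rw [key]; simp
    · have hz : star (rotatingEntry κ y) * star b
          - a * ((d t 2 - bandEnergy (hA (t, y)) 0 : ℝ) : ℂ)
          = -a * (((d t 2 - bandEnergy (hA (t, y)) 0 : ℝ) : ℂ)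
            - star (a * b * rotatingEntry κ y) / (‖a‖ : ℂ) ^ 2) := by
        rw [← hnaC, star_mul', star_mul']
        have : star a ≠ 0 := star_ne_zero.2 ha
        field_simp
        ring
      rw [hz, norm_mul, norm_neg]
      push_cast
      simp only [zero_mul, mul_zero, Complex.exp_zero, mul_one]
      rw [← neg_div, mul_div_mul_comm]

end

end Jump

/-! ### Gluing the local primitives -/

section ChernIntegral

open Complex (slitPlane)

/-- The increment of a Chern integral along a strip on which a unit section and a branch of the
logarithm are available. -/
theorem integral_sub_logDeriv_eq {F : ℝ × ℝ → ℂ} (hFc : Continuous F)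
    {ψ : ℝ × ℝ → EuclideanSpace ℂ (Fin 3)} {w : ℝ → ℂ} (hw : ContDiff ℝ ∞ w) {z : ℂ} (hz : z ≠ 0)
    {t₁ t₂ : ℝ} (hψ : ∀ t ∈ Set.uIcc t₁ t₂, ∀ y, ContDiffAt ℝ ∞ ψ (t, y))
    (hF : ∀ t ∈ Set.uIcc t₁ t₂, ∀ y, F (t, y) = berryIntegrand ψ (t, y))
    (hper : ∀ x, ψ (x + (0, 2 * Real.pi)) = ψ x)
    (hws : ∀ t ∈ Set.uIcc t₁ t₂, z * w t ∈ slitPlane) :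
    ∫ t in t₁..t₂, ((∫ y in (0 : ℝ)..2 * Real.pi, F (t, y)) - deriv w t / w t)
      = (loopPhase ψ t₂ - Complex.log (z * w t₂)) - (loopPhase ψ t₁ - Complex.log (z * w t₁)) := by
  have hw0 : ∀ t ∈ Set.uIcc t₁ t₂, w t ≠ 0 := fun t ht h => by
    have := Complex.slitPlane_ne_zero (hws t ht)
    simp [h] at this
  have hwd := hw.continuous_deriv (by simp)
  have hvc : ContinuousOn (fun t => deriv w t / w t) (Set.uIcc t₁ t₂) :=
    hwd.continuousOn.div hw.continuous.continuousOn hw0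
  have hG : Continuous fun t => ∫ y in (0 : ℝ)..2 * Real.pi, F (t, y) :=
    intervalIntegral.continuous_parametric_intervalIntegral_of_continuous'
      (f := fun t y => F (t, y)) hFc _ _
  rw [intervalIntegral.integral_sub (hG.intervalIntegrable _ _) hvc.intervalIntegrable]
  have h1 : ∫ t in t₁..t₂, ∫ y in (0 : ℝ)..2 * Real.pi, F (t, y)
      = loopPhase ψ t₂ - loopPhase ψ t₁ := by
    rw [← integral_berryIntegrand_eq_loopPhase_sub hψ hper]
    refine intervalIntegral.integral_congr fun t ht => ?_
    refine intervalIntegral.integral_congr fun y _ => ?_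
    exact hF t ht y
  have h2 : ∫ t in t₁..t₂, deriv w t / w t = Complex.log (z * w t₂) - Complex.log (z * w t₁) := by
    refine intervalIntegral.integral_eq_sub_of_hasDerivAt (f := fun t => Complex.log (z * w t))
      (fun t ht => ?_) hvc.intervalIntegrable
    have h3 := (((hw.differentiable (by simp)).differentiableAt.hasDerivAt (x := t)).const_mul
      z).clog_real (hws t ht)
    rwa [mul_div_mul_left _ _ hz] at h3
  rw [h1, h2]
  ring

variable {d : ℝ → Fin 3 → ℝ} {a b κ : ℂ}
  (hA : ∀ θ : ℝ × ℝ, (hermThree (d θ.1) a b (rotatingEntry κ θ.2)).IsHermitian)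

theorem unitField_add (k : Fin 3) (x : ℝ × ℝ) :
    unitField (eigenField hA 0 k) (x + (0, 2 * Real.pi)) = unitField (eigenField hA 0 k) x := by
  have h := eigenField_congr hA (θ := x) (θ' := x + (0, 2 * Real.pi)) (n := 0) (k := k)
    (by simp) (by simp [rotatingEntry_add_two_pi])
  rw [unitField, unitField, h]

theorem loopPhase_add_two_pi (hdp : ∀ t, d (t + 2 * Real.pi) = d t) (k : Fin 3) (t : ℝ) :
    loopPhase (unitField (eigenField hA 0 k)) (t + 2 * Real.pi)
      = loopPhase (unitField (eigenField hA 0 k)) t := by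
  have h : ∀ x, unitField (eigenField hA 0 k) (x + (2 * Real.pi, 0))
      = unitField (eigenField hA 0 k) x := by
    intro x
    have h := eigenField_congr hA (θ := x) (θ' := x + (2 * Real.pi, 0)) (n := 0) (k := k)
      (by simp [hdp]) (by simp)
    rw [unitField, unitField, h]
  have hfd : ∀ x, fderiv ℝ (unitField (eigenField hA 0 k)) (x + (2 * Real.pi, 0))
      = fderiv ℝ (unitField (eigenField hA 0 k)) x := by
    intro x
    rw [← fderiv_comp_add_right]
    simp only [h]
  refine intervalIntegral.integral_congr fun y _ => ?_
  have : ((t + 2 * Real.pi, y) : ℝ × ℝ) = (t, y) + (2 * Real.pi, 0) := by simp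
  simp only [this, h, hfd]

theorem windCurve_add_two_pi (hdp : ∀ t, d (t + 2 * Real.pi) = d t) (t : ℝ) :
    windCurve d a b κ (t + 2 * Real.pi) = windCurve d a b κ t := by
  rw [windCurve, windCurve, hdp]

/-- The integral of the Berry curvature of the lowest level is a winding integral. -/
theorem integral_lowest_eq_integral_windCurve (hd : ContDiff ℝ ∞ d)
    (hdp : ∀ t, d (t + 2 * Real.pi) = d t) (hn : ∀ θ, IsSimpleBand (hA θ) 0)
    (ha : a ≠ 0) (hb : b ≠ 0) (hκ : κ ≠ 0) (hw0 : ∀ t, windCurve d a b κ t ≠ 0)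
    {F : ℝ × ℝ → ℂ} (hF : IsBerryCurvature hA 0 F) :
    ∫ t in (0 : ℝ)..2 * Real.pi, ∫ y in (0 : ℝ)..2 * Real.pi, F (t, y)
      = ∫ t in (0 : ℝ)..2 * Real.pi, deriv (windCurve d a b κ) t / windCurve d a b κ t := by
  set w := windCurve d a b κ with hwdef
  have hw : ContDiff ℝ ∞ w := contDiff_windCurve hd
  set ψ : Fin 3 → ℝ × ℝ → EuclideanSpace ℂ (Fin 3) := fun k => unitField (eigenField hA 0 k) with hψ
  have hloc : ∀ {θ k}, eigenField hA 0 k θ ≠ 0 → IsLocalEigenvector hA 0 θ (ψ k) := fun h =>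
    isLocalEigenvector_unitField hA (hd.comp contDiff_fst) contDiff_const contDiff_const
      ((contDiff_rotatingEntry κ).comp contDiff_snd) hn h
  have hG : Continuous fun t => ∫ y in (0 : ℝ)..2 * Real.pi, F (t, y) :=
    intervalIntegral.continuous_parametric_intervalIntegral_of_continuous'
      (f := fun t y => F (t, y)) hF.1 _ _
  have hv : Continuous fun t => deriv w t / w t :=
    (hw.continuous_deriv (by simp)).div hw.continuous hw0
  set Φ : ℝ → ℂ := fun t => ∫ x in (0 : ℝ)..t,
    ((∫ y in (0 : ℝ)..2 * Real.pi, F (x, y)) - deriv w x / w x) with hΦ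
  have hΦsub : ∀ t₁ t₂, Φ t₂ - Φ t₁ = ∫ x in t₁..t₂,
      ((∫ y in (0 : ℝ)..2 * Real.pi, F (x, y)) - deriv w x / w x) := fun t₁ t₂ =>
    intervalIntegral.integral_interval_sub_left ((hG.sub hv).intervalIntegrable _ _)
      ((hG.sub hv).intervalIntegrable _ _)
  classical
  -- A primitive of curvature minus logarithmic derivative, assembled from the two columns. By `hH1`
  -- the second formula holds on all of its domain: the jumps of Berry phase and logarithm agree,
  -- and `π/2 * I` compensates the rotation by `-i`.
  set H : ℝ → ℂ := fun t => if w t ∈ slitPlane then loopPhase (ψ 0) t - Complex.log (1 * w t)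
    else loopPhase (ψ 1) t - Complex.log (-Complex.I * w t) - Real.pi / 2 * Complex.I with hH
  have hH1 : ∀ t, -Complex.I * w t ∈ slitPlane →
      H t = loopPhase (ψ 1) t - Complex.log (-Complex.I * w t) - Real.pi / 2 * Complex.I := by
    intro t ht
    simp only [hH]
    split_ifs with h
    · have h1 := loopPhase_one_sub_loopPhase_zero hA hd hn ha hb hκ h ht
      rw [log_neg_I_mul ht, one_mul]
      change loopPhase (ψ 1) t - loopPhase (ψ 0) t = _ at h1
      linear_combination -h1
    · rfl
  have hnear : ∀ (z : ℂ) (t₀ : ℝ), z * w t₀ ∈ slitPlane →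
      ∀ᶠ t in nhds t₀, ∀ x ∈ Set.uIcc t₀ t, z * w x ∈ slitPlane := by
    intro z t₀ h0
    have hopen : {t | z * w t ∈ slitPlane} ∈ nhds t₀ :=
      (Complex.isOpen_slitPlane.preimage (continuous_const.mul hw.continuous)).mem_nhds h0
    obtain ⟨ε, hε, hball⟩ := Metric.mem_nhds_iff.1 hopen
    filter_upwards [Metric.ball_mem_nhds t₀ hε] with t ht x hx
    refine hball ?_
    exact (convex_ball t₀ ε).ordConnected.uIcc_subset (Metric.mem_ball_self hε) ht hx
  have hconst : IsLocallyConstant fun t => Φ t - H t := by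
    rw [IsLocallyConstant.iff_eventually_eq]
    intro t₀
    by_cases h0 : w t₀ ∈ slitPlane
    · filter_upwards [hnear 1 t₀ (by rwa [one_mul])] with t ht
      have hne : ∀ x ∈ Set.uIcc t₀ t, ∀ y, eigenField hA 0 0 (x, y) ≠ 0 := fun x hx y =>
        eigenField_zero_ne_zero hA ha hb hκ (by simpa using ht x hx) y
      have key := integral_sub_logDeriv_eq hF.1 (ψ := ψ 0) hw one_ne_zero
        (fun x hx y => (hloc (hne x hx y)).1) (fun x hx y => hF.2.2 _ _ (hloc (hne x hx y)))
        (unitField_add hA 0) ht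
      have hwt : w t ∈ slitPlane := by simpa using ht t Set.right_mem_uIcc
      rw [← hΦsub] at key
      simp only [hH, h0, hwt, if_true]
      linear_combination key
    -- The two cuts meet only at `0`, which `w` avoids.
    · have h1 : -Complex.I * w t₀ ∈ slitPlane := by
        rw [Complex.mem_slitPlane_iff] at h0 ⊢
        push Not at h0
        right
        have : (w t₀).re ≠ 0 := fun h => hw0 t₀ (Complex.ext h h0.2)
        simpa using this
      filter_upwards [hnear _ t₀ h1] with t ht
      have hne : ∀ x ∈ Set.uIcc t₀ t, ∀ y, eigenField hA 0 1 (x, y) ≠ 0 := fun x hx y =>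
        eigenField_one_ne_zero hA ha hb hκ (ht x hx) y
      have key := integral_sub_logDeriv_eq hF.1 (ψ := ψ 1) hw (neg_ne_zero.2 Complex.I_ne_zero)
        (fun x hx y => (hloc (hne x hx y)).1) (fun x hx y => hF.2.2 _ _ (hloc (hne x hx y)))
        (unitField_add hA 1) ht
      rw [← hΦsub] at key
      rw [hH1 t (ht t Set.right_mem_uIcc), hH1 t₀ h1]
      linear_combination key
  have hend := hconst.apply_eq_of_isPreconnected isPreconnected_univ (Set.mem_univ (2 * Real.pi))
    (Set.mem_univ 0)
  have hHp : H (2 * Real.pi) = H 0 := by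
    have h1 : w (2 * Real.pi) = w 0 := by
      simpa using windCurve_add_two_pi (a := a) (b := b) (κ := κ) hdp 0
    have h2 : ∀ k, loopPhase (ψ k) (2 * Real.pi) = loopPhase (ψ k) 0 := fun k => by
      simpa using loopPhase_add_two_pi hA hdp k 0
    simp only [hH, h1, h2]
  have hz : Φ (2 * Real.pi) - Φ 0 = 0 := by linear_combination hend + hHp
  rw [hΦsub, intervalIntegral.integral_sub (hG.intervalIntegrable _ _)
    (hv.intervalIntegrable _ _)] at hz
  exact sub_eq_zero.1 hz

end ChernIntegral

/-! ### Winding integrals of ellipses -/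

section EllipseWinding

open Complex (slitPlane)

theorem integral_logDeriv_eq_zero_of_slitPlane {w : ℝ → ℂ} (hw : ContDiff ℝ ∞ w)
    (hper : w (2 * Real.pi) = w 0) {z : ℂ} (h : ∀ t, z * w t ∈ slitPlane) :
    ∫ t in (0 : ℝ)..2 * Real.pi, deriv w t / w t = 0 := by
  have hz : z ≠ 0 := by
    rintro rfl
    simpa using h 0
  have hw0 : ∀ t, w t ≠ 0 := fun t h0 => by
    have := h t
    simp [h0] at this
  have hv : Continuous fun t => deriv w t / w t :=
    (hw.continuous_deriv (by simp)).div hw.continuous hw0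
  rw [intervalIntegral.integral_eq_sub_of_hasDerivAt (f := fun t => Complex.log (z * w t))
    (fun t _ => ?_) (hv.intervalIntegrable _ _), hper, sub_self]
  have h3 := (((hw.differentiable (by simp)).differentiableAt.hasDerivAt (x := t)).const_mul
    z).clog_real (h t)
  rwa [mul_div_mul_left _ _ hz] at h3

/-- The curve stays on a line. If the line misses `0`, a half plane contains it; if it passes
through `0`, connectedness keeps the curve on one of its two rays. Either way a branch of the
logarithm exists along the whole curve. -/
theorem integral_logDeriv_eq_zero_of_re_const {w : ℝ → ℂ} (hw : ContDiff ℝ ∞ w)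
    (hper : w (2 * Real.pi) = w 0) (hw0 : ∀ t, w t ≠ 0) {n : ℂ} (hn : n ≠ 0) {k : ℝ}
    (hk : ∀ t, (n * w t).re = k) :
    ∫ t in (0 : ℝ)..2 * Real.pi, deriv w t / w t = 0 := by
  by_cases hk0 : k = 0
  · have hs0 : ∀ t, (n * w t).im ≠ 0 := fun t h =>
      mul_ne_zero hn (hw0 t) (Complex.ext (by rw [hk, hk0]; rfl) h)
    have hsc : Continuous fun t => (n * w t).im :=
      Complex.continuous_im.comp (continuous_const.mul hw.continuous)
    have hsign : (∀ t, 0 < (n * w t).im) ∨ ∀ t, (n * w t).im < 0 := by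
      by_contra! hcon
      obtain ⟨⟨t₁, h1⟩, t₂, h2⟩ := hcon
      obtain ⟨t, ht⟩ := mem_range_of_exists_le_of_exists_ge hsc ⟨t₁, h1⟩ ⟨t₂, h2⟩
      exact hs0 t ht
    rcases hsign with h | h
    · refine integral_logDeriv_eq_zero_of_slitPlane hw hper (z := -Complex.I * n) fun t => ?_
      rw [Complex.mem_slitPlane_iff]
      left
      rw [mul_assoc]
      simpa using h t
    · refine integral_logDeriv_eq_zero_of_slitPlane hw hper (z := Complex.I * n) fun t => ?_
      rw [Complex.mem_slitPlane_iff]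
      left
      rw [mul_assoc, Complex.I_mul_re]
      linarith [h t]
  · refine integral_logDeriv_eq_zero_of_slitPlane hw hper (z := (k : ℂ) * n) fun t => ?_
    rw [Complex.mem_slitPlane_iff]
    left
    rw [mul_assoc, Complex.re_ofReal_mul, hk]
    exact mul_self_pos.2 hk0

/-- The ellipse `t ↦ A e^{it} + B e^{-it} - X`. -/
noncomputable def ellipseCurve (A B X : ℂ) (t : ℝ) : ℂ :=
  A * Complex.exp ((t : ℂ) * Complex.I) + B * Complex.exp (-((t : ℂ) * Complex.I)) - X

variable {A B X : ℂ}

theorem contDiff_ellipseCurve : ContDiff ℝ ∞ (ellipseCurve A B X) := by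
  have h : ContDiff ℝ ∞ fun t : ℝ => (t : ℂ) * Complex.I :=
    Complex.ofRealCLM.contDiff.mul contDiff_const
  exact ((contDiff_const.mul h.cexp).add (contDiff_const.mul h.neg.cexp)).sub contDiff_const

theorem exp_two_pi_mul_I' : Complex.exp (((2 * Real.pi : ℝ) : ℂ) * Complex.I) = 1 := by
  push_cast
  exact Complex.exp_two_pi_mul_I

theorem ellipseCurve_two_pi : ellipseCurve A B X (2 * Real.pi) = ellipseCurve A B X 0 := by
  rw [ellipseCurve, ellipseCurve, Complex.exp_neg, exp_two_pi_mul_I']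
  simp

theorem conj_exp_mul_I (t : ℝ) : (starRingEnd ℂ) (Complex.exp ((t : ℂ) * Complex.I))
    = Complex.exp (-((t : ℂ) * Complex.I)) := by
  rw [← Complex.exp_conj]
  simp

/-- The ellipse is flat: for a normal direction `n`, the number `n * (A e^{it} + B e^{-it})` is
purely imaginary. -/
theorem integral_ellipseCurve_of_norm_eq (hw0 : ∀ t, ellipseCurve A B X t ≠ 0) (h : ‖A‖ = ‖B‖) :
    ∫ t in (0 : ℝ)..2 * Real.pi, deriv (ellipseCurve A B X) t / ellipseCurve A B X t = 0 := by
  have hAB : A * (starRingEnd ℂ) A = B * (starRingEnd ℂ) B := by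
    rw [Complex.mul_conj, Complex.mul_conj, Complex.normSq_eq_norm_sq, Complex.normSq_eq_norm_sq, h]
  -- The normal is `i * conj (A + B)`, unless `A + B = 0`; then `conj A` serves, or `1` if both
  -- vanish.
  obtain ⟨n, hn, hnAB⟩ : ∃ n : ℂ, n ≠ 0 ∧ n * A = -(starRingEnd ℂ) (n * B) := by
    by_cases hs : (starRingEnd ℂ) A + (starRingEnd ℂ) B = 0
    · by_cases hA : A = 0
      · have hB : B = 0 := by rw [hA, norm_zero] at h; exact norm_eq_zero.1 h.symm
        exact ⟨1, one_ne_zero, by simp [hA, hB]⟩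
      · refine ⟨(starRingEnd ℂ) A, by simpa using hA, ?_⟩
        simp only [map_mul, Complex.conj_conj]
        linear_combination A * hs
    · refine ⟨Complex.I * ((starRingEnd ℂ) A + (starRingEnd ℂ) B), mul_ne_zero Complex.I_ne_zero hs, ?_⟩
      simp only [map_mul, map_add, Complex.conj_conj, Complex.conj_I]
      linear_combination Complex.I * hAB
  refine integral_logDeriv_eq_zero_of_re_const contDiff_ellipseCurve ellipseCurve_two_pi hw0 hn
    (k := -(n * X).re) fun t => ?_
  have h1 : n * ellipseCurve A B X t = n * A * Complex.exp ((t : ℂ) * Complex.I)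
      - (starRingEnd ℂ) (n * A * Complex.exp ((t : ℂ) * Complex.I)) - n * X := by
    rw [map_mul, conj_exp_mul_I, hnAB, map_neg, Complex.conj_conj, ellipseCurve, ← neg_eq_iff_eq_neg.2 hnAB]
    ring
  rw [h1, Complex.sub_re, Complex.sub_re, Complex.conj_re]
  ring

/-- The centre of the unit circle after the linear change of coordinates that turns the ellipse
into a circle. -/
noncomputable def ellipseCentre (A B X : ℂ) : ℂ :=
  ((starRingEnd ℂ) A * X - B * (starRingEnd ℂ) X) / ((‖A‖ ^ 2 - ‖B‖ ^ 2 : ℝ) : ℂ)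

theorem ellipseCurve_eq (h : ‖A‖ ≠ ‖B‖) (t : ℝ) : ellipseCurve A B X t
    = A * (Complex.exp ((t : ℂ) * Complex.I) - ellipseCentre A B X)
      + B * (starRingEnd ℂ) (Complex.exp ((t : ℂ) * Complex.I) - ellipseCentre A B X) := by
  have hD : ((‖A‖ ^ 2 - ‖B‖ ^ 2 : ℝ) : ℂ) ≠ 0 := by
    have : ‖A‖ ^ 2 - ‖B‖ ^ 2 ≠ 0 := by
      rw [sub_ne_zero]
      exact fun h2 => h ((sq_eq_sq₀ (norm_nonneg _) (norm_nonneg _)).1 h2)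
    exact_mod_cast this
  have hA : A * (starRingEnd ℂ) A - B * (starRingEnd ℂ) B = ((‖A‖ ^ 2 - ‖B‖ ^ 2 : ℝ) : ℂ) := by
    rw [Complex.mul_conj, Complex.mul_conj, Complex.normSq_eq_norm_sq, Complex.normSq_eq_norm_sq]
    push_cast
    rfl
  have hX : A * ellipseCentre A B X + B * (starRingEnd ℂ) (ellipseCentre A B X) = X := by
    rw [ellipseCentre, map_div₀, map_sub, map_mul, map_mul, Complex.conj_conj, Complex.conj_conj,
      Complex.conj_ofReal]
    field_simp
    linear_combination X * hA
  rw [map_sub, conj_exp_mul_I, ellipseCurve]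
  linear_combination hX

theorem integral_logDeriv_circle {c : ℂ} (hc : ‖c‖ ≠ 1) :
    ∫ t in (0 : ℝ)..2 * Real.pi, (Complex.exp ((t : ℂ) * Complex.I) * Complex.I)
        / (Complex.exp ((t : ℂ) * Complex.I) - c)
      = if ‖c‖ < 1 then 2 * Real.pi * Complex.I else 0 := by
  have h : ∫ t in (0 : ℝ)..2 * Real.pi, (Complex.exp ((t : ℂ) * Complex.I) * Complex.I)
        / (Complex.exp ((t : ℂ) * Complex.I) - c) = ∮ z in C(0, 1), (z - c)⁻¹ := by
    rw [circleIntegral]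
    refine intervalIntegral.integral_congr fun t _ => ?_
    simp [circleMap, div_eq_mul_inv]
  rw [h]
  split_ifs with h1
  · exact circleIntegral.integral_sub_inv_of_mem_ball (by simpa using h1)
  · have h2 : 1 < ‖c‖ := lt_of_le_of_ne (not_lt.1 h1) hc.symm
    have hne : ∀ z : ℂ, ‖z‖ ≤ 1 → z - c ≠ 0 := fun z hz h0 => by
      rw [sub_eq_zero.1 h0] at hz
      linarith
    refine Complex.circleIntegral_eq_zero_of_differentiable_on_off_countable zero_le_one
      Set.countable_empty ?_ ?_
    · exact (continuousOn_id.sub continuousOn_const).inv₀ fun z hz => hne z (by simpa using hz)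
    · intro z hz
      have hz' : ‖z‖ < 1 := by simpa using hz.1
      exact (differentiableAt_id.sub_const c).inv (hne z hz'.le)

/-- With `v = e^{it} - c` the curve is `A v + B conj v`, and its quotient by `A v` stays within
distance `|B/A| < 1` of `1`. The logarithm of the quotient is periodic, so the curve winds like the
circle `v`. -/
theorem integral_ellipseCurve_of_norm_lt (hw0 : ∀ t, ellipseCurve A B X t ≠ 0) (h : ‖B‖ < ‖A‖) :
    ∫ t in (0 : ℝ)..2 * Real.pi, deriv (ellipseCurve A B X) t / ellipseCurve A B X t
      = if ‖ellipseCentre A B X‖ < 1 then 2 * Real.pi * Complex.I else 0 := by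
  have hA0 : A ≠ 0 := norm_pos_iff.1 ((norm_nonneg B).trans_lt h)
  set c := ellipseCentre A B X with hc
  set v : ℝ → ℂ := fun t => Complex.exp ((t : ℂ) * Complex.I) - c with hv
  have hwv : ∀ t, ellipseCurve A B X t = A * v t + B * (starRingEnd ℂ) (v t) := fun t =>
    ellipseCurve_eq h.ne' t
  have hv0 : ∀ t, v t ≠ 0 := fun t h0 => hw0 t (by rw [hwv, h0]; simp)
  have hvd : ContDiff ℝ ∞ v := by
    have h : ContDiff ℝ ∞ fun t : ℝ => (t : ℂ) * Complex.I :=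
      Complex.ofRealCLM.contDiff.mul contDiff_const
    exact h.cexp.sub contDiff_const
  have hv' : ∀ t : ℝ, HasDerivAt v (Complex.exp ((t : ℂ) * Complex.I) * Complex.I) t := by
    intro t
    have h1 : HasDerivAt (fun t : ℝ => (t : ℂ) * Complex.I) Complex.I t := by
      simpa using (Complex.ofRealCLM.hasDerivAt (x := t)).mul_const Complex.I
    exact h1.cexp.sub_const c
  have hc1 : ‖c‖ ≠ 1 := by
    intro h1
    refine hv0 c.arg ?_
    have := Complex.norm_mul_exp_arg_mul_I c
    rw [h1, Complex.ofReal_one, one_mul] at this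
    simp only [hv, this, sub_self]
  rw [← integral_logDeriv_circle hc1, ← sub_eq_zero]
  have hw := contDiff_ellipseCurve (A := A) (B := B) (X := X)
  have hwc : Continuous fun t => deriv (ellipseCurve A B X) t / ellipseCurve A B X t :=
    (hw.continuous_deriv (by simp)).div hw.continuous hw0
  have hvc : Continuous fun t : ℝ => Complex.exp ((t : ℂ) * Complex.I) * Complex.I
      / (Complex.exp ((t : ℂ) * Complex.I) - c) := by
    refine Continuous.div ?_ hvd.continuous hv0
    fun_prop
  rw [← intervalIntegral.integral_sub (hwc.intervalIntegrable _ _) (hvc.intervalIntegrable _ _)]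
  set g : ℝ → ℂ := fun t => ellipseCurve A B X t / v t / A with hg
  have hgs : ∀ t, g t ∈ slitPlane := by
    intro t
    have h1 : g t = 1 + B / A * ((starRingEnd ℂ) (v t) / v t) := by
      have := hv0 t
      simp only [hg, hwv]
      field_simp
    have h2 : ‖B / A * ((starRingEnd ℂ) (v t) / v t)‖ < 1 := by
      rw [norm_mul, norm_div, norm_div, RCLike.norm_conj, div_self (norm_ne_zero_iff.2 (hv0 t)),
        mul_one, div_lt_one (norm_pos_iff.2 hA0)]
      exact h
    rw [Complex.mem_slitPlane_iff, h1]
    left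
    have := (abs_lt.1 ((Complex.abs_re_le_norm _).trans_lt h2)).1
    rw [Complex.add_re, Complex.one_re]
    linarith
  have hlog : ∀ t, HasDerivAt (fun t => Complex.log (g t))
      (deriv (ellipseCurve A B X) t / ellipseCurve A B X t
        - Complex.exp ((t : ℂ) * Complex.I) * Complex.I / (Complex.exp ((t : ℂ) * Complex.I) - c))
      t := by
    intro t
    have h1 := ((((hw.differentiable (by simp)).differentiableAt.hasDerivAt (x := t)).fun_div (hv' t)
      (hv0 t)).div_const A).clog_real (hgs t)
    convert h1 using 1
    have := hv0 t
    have := hw0 t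
    change _ - _ / v t = _ / (ellipseCurve A B X t / v t / A)
    field_simp
  rw [intervalIntegral.integral_eq_sub_of_hasDerivAt (fun t _ => hlog t)
    ((hwc.sub hvc).intervalIntegrable _ _)]
  have : v (2 * Real.pi) = v 0 := by
    simp only [hv, exp_two_pi_mul_I']
    simp
  simp only [hg, this, ellipseCurve_two_pi, sub_self]

theorem conj_ellipseCurve (t : ℝ) : (starRingEnd ℂ) (ellipseCurve A B X t)
    = ellipseCurve ((starRingEnd ℂ) B) ((starRingEnd ℂ) A) ((starRingEnd ℂ) X) t := by
  rw [ellipseCurve, ellipseCurve, map_sub, map_add, map_mul, map_mul, conj_exp_mul_I,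
    ← conj_exp_mul_I, Complex.conj_conj]
  ring

theorem norm_ellipseCentre_conj : ‖ellipseCentre ((starRingEnd ℂ) B) ((starRingEnd ℂ) A)
    ((starRingEnd ℂ) X)‖ = ‖ellipseCentre A B X‖ := by
  rw [ellipseCentre, ellipseCentre, norm_div, norm_div, Complex.norm_real, Complex.norm_real,
    RCLike.norm_conj, RCLike.norm_conj, norm_sub_rev (‖A‖ ^ 2)]
  congr 1
  rw [Complex.conj_conj, Complex.conj_conj, norm_sub_rev]

/-- Complex conjugation exchanges the roles of `A` and `B` and reverses the orientation. -/
theorem integral_ellipseCurve_of_lt_norm (hw0 : ∀ t, ellipseCurve A B X t ≠ 0) (h : ‖A‖ < ‖B‖) :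
    ∫ t in (0 : ℝ)..2 * Real.pi, deriv (ellipseCurve A B X) t / ellipseCurve A B X t
      = if ‖ellipseCentre A B X‖ < 1 then -(2 * Real.pi * Complex.I) else 0 := by
  have key := integral_ellipseCurve_of_norm_lt (A := (starRingEnd ℂ) B) (B := (starRingEnd ℂ) A)
    (X := (starRingEnd ℂ) X) (fun t => by rw [← conj_ellipseCurve]; simpa using hw0 t)
    (by simpa using h)
  rw [norm_ellipseCentre_conj] at key
  have hconj : ∀ t, deriv (ellipseCurve ((starRingEnd ℂ) B) ((starRingEnd ℂ) A)
      ((starRingEnd ℂ) X)) t / ellipseCurve ((starRingEnd ℂ) B) ((starRingEnd ℂ) A)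
      ((starRingEnd ℂ) X) t
      = (starRingEnd ℂ) (deriv (ellipseCurve A B X) t / ellipseCurve A B X t) := by
    intro t
    rw [map_div₀, conj_ellipseCurve]
    congr 1
    have h1 := (contDiff_ellipseCurve (A := A) (B := B) (X := X)).differentiable (by simp)
    have h2 : HasDerivAt (fun t => (starRingEnd ℂ) (ellipseCurve A B X t))
        ((starRingEnd ℂ) (deriv (ellipseCurve A B X) t)) t :=
      Complex.conjCLE.hasFDerivAt.comp_hasDerivAt t (h1 t).hasDerivAt
    rw [← h2.deriv]
    simp only [conj_ellipseCurve]
  simp only [hconj] at key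
  rw [intervalIntegral.integral_of_le Real.two_pi_pos.le, integral_conj,
    ← intervalIntegral.integral_of_le Real.two_pi_pos.le] at key
  have h3 := congrArg (starRingEnd ℂ) key
  rw [Complex.conj_conj] at h3
  rw [h3]
  split_ifs <;> simp [map_ofNat]

/-- The winding integral of `t ↦ (K₁ cos (t - α₁) - x₁, K₂ cos (t - α₂) - x₂)`. -/
theorem integral_logDeriv_cosCurve {K₁ K₂ α₁ α₂ x₁ x₂ : ℝ} (hK₁ : 0 ≤ K₁) (hK₂ : 0 ≤ K₂)
    {w : ℝ → ℂ} (hw : ∀ t, w t = ((K₁ * Real.cos (t - α₁) - x₁ : ℝ) : ℂ)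
      + ((K₂ * Real.cos (t - α₂) - x₂ : ℝ) : ℂ) * Complex.I) (hw0 : ∀ t, w t ≠ 0) :
    ∫ t in (0 : ℝ)..2 * Real.pi, deriv w t / w t
      = if (K₂ * x₁) ^ 2 - 2 * K₁ * K₂ * Real.cos (α₁ - α₂) * x₁ * x₂ + (K₁ * x₂) ^ 2
          - (K₁ * K₂ * Real.sin (α₁ - α₂)) ^ 2 < 0
        then -(2 * Real.pi * Complex.I * ((SignType.sign (Real.sin (α₁ - α₂)) : ℤ) : ℂ))
        else 0 := by
  obtain ⟨p, hp⟩ : ∃ p : ℂ, p = K₁ * Complex.exp ((α₁ : ℂ) * Complex.I) := ⟨_, rfl⟩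
  obtain ⟨q, hq⟩ : ∃ q : ℂ, q = K₂ * Complex.exp ((α₂ : ℂ) * Complex.I) := ⟨_, rfl⟩
  have hpre : p.re = K₁ * Real.cos α₁ := by rw [hp, Complex.re_ofReal_mul, Complex.exp_ofReal_mul_I_re]
  have hpim : p.im = K₁ * Real.sin α₁ := by rw [hp, Complex.im_ofReal_mul, Complex.exp_ofReal_mul_I_im]
  have hqre : q.re = K₂ * Real.cos α₂ := by rw [hq, Complex.re_ofReal_mul, Complex.exp_ofReal_mul_I_re]
  have hqim : q.im = K₂ * Real.sin α₂ := by rw [hq, Complex.im_ofReal_mul, Complex.exp_ofReal_mul_I_im]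
  -- Obtained by writing `K₁ cos (t - α₁) = (conj p * e^{it} + p * e^{-it}) / 2`, and likewise for
  -- `K₂` and `q`.
  set A : ℂ := ((starRingEnd ℂ) p + Complex.I * (starRingEnd ℂ) q) / 2 with hA
  set B : ℂ := (p + Complex.I * q) / 2 with hB
  set X : ℂ := x₁ + x₂ * Complex.I with hX
  have hwe : w = ellipseCurve A B X := by
    funext t
    rw [hw, ellipseCurve, ← conj_exp_mul_I]
    have hre := Complex.exp_ofReal_mul_I_re t
    have him := Complex.exp_ofReal_mul_I_im t
    rw [Real.cos_sub, Real.cos_sub]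
    generalize Complex.exp ((t : ℂ) * Complex.I) = e at hre him ⊢
    generalize Real.cos t = ct at hre ⊢
    generalize Real.sin t = st at him ⊢
    generalize Real.cos α₁ = c₁ at hpre ⊢
    generalize Real.sin α₁ = s₁ at hpim ⊢
    generalize Real.cos α₂ = c₂ at hqre ⊢
    generalize Real.sin α₂ = s₂ at hqim ⊢
    apply Complex.ext <;> simp [hA, hB, hX, hre, him, hpre, hpim, hqre, hqim] <;> ring
  -- The determinant of `z ↦ A z + B conj z`; its sign is the orientation of the ellipse. Together
  -- with `hN` it turns "the centre lies in the unit disc" into negativity of the quadratic form.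
  have hD : ‖A‖ ^ 2 - ‖B‖ ^ 2 = -(K₁ * K₂ * Real.sin (α₁ - α₂)) := by
    rw [← Complex.normSq_eq_norm_sq, ← Complex.normSq_eq_norm_sq, Complex.normSq_apply,
      Complex.normSq_apply, Real.sin_sub]
    simp [hA, hB, hpre, hpim, hqre, hqim]
    ring
  have hN : ‖(starRingEnd ℂ) A * X - B * (starRingEnd ℂ) X‖ ^ 2
      = (K₂ * x₁) ^ 2 - 2 * K₁ * K₂ * Real.cos (α₁ - α₂) * x₁ * x₂ + (K₁ * x₂) ^ 2 := by
    have h1 : (starRingEnd ℂ) A * X - B * (starRingEnd ℂ) X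
        = Complex.I * ((x₂ : ℂ) * p - (x₁ : ℂ) * q) := by
      simp only [hA, hB, hX, map_div₀, map_add, map_mul, Complex.conj_conj, Complex.conj_I,
        Complex.conj_ofReal, map_ofNat]
      ring
    rw [h1, norm_mul, Complex.norm_I, one_mul, ← Complex.normSq_eq_norm_sq, Complex.normSq_apply,
      Real.cos_sub]
    simp only [Complex.sub_re, Complex.sub_im, Complex.re_ofReal_mul, Complex.im_ofReal_mul, hpre,
      hpim, hqre, hqim]
    have s1 := Real.sin_sq_add_cos_sq α₁
    have s2 := Real.sin_sq_add_cos_sq α₂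
    linear_combination (K₁ * x₂) ^ 2 * s1 + (K₂ * x₁) ^ 2 * s2
  subst hwe
  rw [← hN]
  set S := K₁ * K₂ * Real.sin (α₁ - α₂) with hS
  have hcentre : S ≠ 0 → (‖ellipseCentre A B X‖ < 1 ↔
      ‖(starRingEnd ℂ) A * X - B * (starRingEnd ℂ) X‖ ^ 2 - S ^ 2 < 0) := by
    intro hS0
    rw [ellipseCentre, norm_div, Complex.norm_real, hD, norm_neg, div_lt_one (norm_pos_iff.2 hS0),
      sub_neg, Real.norm_eq_abs, ← sq_abs S]
    exact (sq_lt_sq₀ (norm_nonneg _) (abs_nonneg _)).symm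
  rcases lt_trichotomy S 0 with h | h | h
  · have hlt : ‖B‖ < ‖A‖ := lt_of_pow_lt_pow_left₀ 2 (norm_nonneg _) (by linarith)
    have hsin : Real.sin (α₁ - α₂) < 0 := neg_of_mul_neg_right h (mul_nonneg hK₁ hK₂)
    rw [integral_ellipseCurve_of_norm_lt hw0 hlt, sign_neg hsin]
    simp only [hcentre h.ne]
    simp
  · have heq : ‖A‖ = ‖B‖ := (sq_eq_sq₀ (norm_nonneg _) (norm_nonneg _)).1 (by linarith)
    rw [integral_ellipseCurve_of_norm_eq hw0 heq, if_neg]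
    rw [h, not_lt]
    simp
  · have hlt : ‖A‖ < ‖B‖ := lt_of_pow_lt_pow_left₀ 2 (norm_nonneg _) (by linarith)
    have hsin : 0 < Real.sin (α₁ - α₂) := pos_of_mul_pos_right h (mul_nonneg hK₁ hK₂)
    rw [integral_ellipseCurve_of_lt_norm hw0 hlt, sign_pos hsin]
    simp only [hcentre h.ne']
    simp

end EllipseWinding

/-! ### Transfer of bands and Chern indices -/

section Transfer

theorem hasChernIndex_iff_exists {A : ℝ × ℝ → Matrix (Fin 3) (Fin 3) ℂ}
    (hA : ∀ θ, (A θ).IsHermitian) (n : Fin 3) (c : ℤ) : HasChernIndex hA n c ↔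
      (∀ θ, IsSimpleBand (hA θ) n) ∧ ∃ F, IsBerryCurvature hA n F ∧
        (Complex.I / (2 * Real.pi)) * (∫ θ₁ in (0 : ℝ)..2 * Real.pi,
          ∫ θ₂ in (0 : ℝ)..2 * Real.pi, F (θ₁, θ₂)) = c := by
  refine and_congr Iff.rfl (exists_congr fun F => ?_)
  simp only [IsBerryCurvature, and_assoc]

theorem HasChernIndex.congr {A B : ℝ × ℝ → Matrix (Fin 3) (Fin 3) ℂ} (h : A = B)
    {hA : ∀ θ, (A θ).IsHermitian} (hB : ∀ θ, (B θ).IsHermitian) {n : Fin 3} {c : ℤ}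
    (hc : HasChernIndex hA n c) : HasChernIndex hB n c := by
  subst h
  exact hc

/-- Two increasing triples that are the roots of the same cubic polynomial agree. -/
theorem eq_of_prod_sub_eq {x y : Fin 3 → ℝ} (hx : Monotone x) (hy : Monotone y)
    (h : ∀ t, (x 0 - t) * (x 1 - t) * (x 2 - t) = (y 0 - t) * (y 1 - t) * (y 2 - t)) : x = y := by
  have x1 := hx (show (0 : Fin 3) ≤ 1 by decide)
  have x2 := hx (show (1 : Fin 3) ≤ 2 by decide)
  have y1 := hy (show (0 : Fin 3) ≤ 1 by decide)
  have y2 := hy (show (1 : Fin 3) ≤ 2 by decide)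
  have key : ∀ t, (t = x 0 ∨ t = x 1 ∨ t = x 2) ↔ (t = y 0 ∨ t = y 1 ∨ t = y 2) := by
    intro t
    have hz : ∀ z : Fin 3 → ℝ, (z 0 - t) * (z 1 - t) * (z 2 - t) = 0 ↔
        (t = z 0 ∨ t = z 1 ∨ t = z 2) := by
      intro z
      simp only [mul_eq_zero, sub_eq_zero, or_assoc, @eq_comm _ t]
    rw [← hz, ← hz, h]
  have h0 : x 0 = y 0 := by
    refine le_antisymm ?_ ?_
    · rcases (key (y 0)).2 (Or.inl rfl) with h | h | h <;> linarith
    · rcases (key (x 0)).1 (Or.inl rfl) with h | h | h <;> linarith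
  have h2 : x 2 = y 2 := by
    refine le_antisymm ?_ ?_
    · rcases (key (x 2)).1 (Or.inr (Or.inr rfl)) with h | h | h <;> linarith
    · rcases (key (y 2)).2 (Or.inr (Or.inr rfl)) with h | h | h <;> linarith
  have h1 : x 1 = y 1 := by
    have a0 := h 0
    have a1 := h 1
    have a2 := h (-1)
    linarith
  funext i
  fin_cases i
  exacts [h0, h1, h2]

/-- Both sides are increasing lists of the roots of the same characteristic polynomial. This reduces
the top level to the lowest one. -/
theorem bandEnergy_neg {A B : Matrix (Fin 3) (Fin 3) ℂ} (hA : A.IsHermitian) (hB : B.IsHermitian)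
    (h : B = -A) (n : Fin 3) : bandEnergy hB n = -bandEnergy hA n.rev := by
  have hmono : Monotone fun n : Fin 3 => -bandEnergy hA n.rev := fun m n hmn =>
    neg_le_neg (bandEnergy_mono hA (Fin.rev_le_rev.2 hmn))
  refine congrFun (eq_of_prod_sub_eq (bandEnergy_mono hB) hmono fun t => ?_) n
  have h1 := det_sub_smul_one_eq_prod_bandEnergy hB t
  have h2 := det_sub_smul_one_eq_prod_bandEnergy hA (-t)
  have h3 : B - (t : ℂ) • (1 : Matrix (Fin 3) (Fin 3) ℂ)
      = -(A - ((-t : ℝ) : ℂ) • (1 : Matrix (Fin 3) (Fin 3) ℂ)) := by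
    rw [h]; push_cast; rw [neg_smul]; abel
  rw [h3, Matrix.det_neg, h2, Fintype.card_fin] at h1
  have h4 : (-1 : ℝ) ^ 3 * ∏ n, (bandEnergy hA n - -t) = ∏ n, (bandEnergy hB n - t) := by
    exact_mod_cast h1
  rw [Fin.prod_univ_three, Fin.prod_univ_three] at h4
  rw [← h4]
  change _ = (-bandEnergy hA 2 - t) * (-bandEnergy hA 1 - t) * (-bandEnergy hA 0 - t)
  ring

theorem isLocalEigenvector_neg {A B : ℝ × ℝ → Matrix (Fin 3) (Fin 3) ℂ}
    (hA : ∀ θ, (A θ).IsHermitian) (hB : ∀ θ, (B θ).IsHermitian) (h : ∀ θ, B θ = -A θ) (n : Fin 3)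
    (θ : ℝ × ℝ) (ψ : ℝ × ℝ → EuclideanSpace ℂ (Fin 3)) :
    IsLocalEigenvector hB n θ ψ ↔ IsLocalEigenvector hA n.rev θ ψ := by
  refine and_congr Iff.rfl (Filter.eventually_congr (Filter.Eventually.of_forall fun x =>
    and_congr Iff.rfl ?_))
  rw [bandEnergy_neg (hA x) (hB x) (h x), h, map_neg, LinearMap.neg_apply, Complex.ofReal_neg,
    neg_smul, neg_inj]

theorem HasChernIndex.neg {A B : ℝ × ℝ → Matrix (Fin 3) (Fin 3) ℂ}
    {hB : ∀ θ, (B θ).IsHermitian} {n : Fin 3} {c : ℤ} (hc : HasChernIndex hB n c)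
    (hA : ∀ θ, (A θ).IsHermitian) (h : ∀ θ, B θ = -A θ) : HasChernIndex hA n.rev c := by
  obtain ⟨hs, F, hF, hloc, heq, hint⟩ := hc
  refine ⟨fun θ m hm h1 => ?_, F, hF, fun θ => ?_, fun θ ψ hψ => ?_, hint⟩
  · refine hs θ m.rev (fun h2 => hm (by rw [← h2, Fin.rev_rev])) ?_
    rw [bandEnergy_neg (hA θ) (hB θ) (h θ), bandEnergy_neg (hA θ) (hB θ) (h θ), Fin.rev_rev, h1]
  · obtain ⟨ψ, hψ⟩ := hloc θ
    exact ⟨ψ, (isLocalEigenvector_neg hA hB h n θ ψ).1 hψ⟩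
  · exact heq θ ψ ((isLocalEigenvector_neg hA hB h n θ ψ).2 hψ)

theorem isSimpleBand_zero_iff {A : Matrix (Fin 3) (Fin 3) ℂ} (hA : A.IsHermitian) :
    IsSimpleBand hA 0 ↔ bandEnergy hA 0 ≠ bandEnergy hA 1 := by
  have h1 := bandEnergy_mono hA (show (0 : Fin 3) ≤ 1 by decide)
  have h2 := bandEnergy_mono hA (show (1 : Fin 3) ≤ 2 by decide)
  constructor
  · exact fun h => (h 1 (by decide)).symm
  · intro h m hm
    have := lt_of_le_of_ne h1 h
    fin_cases m
    · exact absurd rfl hm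
    · exact h.symm
    · exact (this.trans_le h2).ne'

theorem isSimpleBand_one {A : Matrix (Fin 3) (Fin 3) ℂ} {hA : A.IsHermitian}
    (h0 : IsSimpleBand hA 0) (h2 : IsSimpleBand hA 2) : IsSimpleBand hA 1 := by
  intro m hm
  fin_cases m
  · exact (h0 1 (by decide)).symm
  · exact absurd rfl hm
  · exact (h2 1 (by decide)).symm

/-- The three curvatures add up to zero pointwise, hence so do the indices. -/
theorem hasChernIndex_one {A : ℝ × ℝ → Matrix (Fin 3) (Fin 3) ℂ} {hA : ∀ θ, (A θ).IsHermitian}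
    {c₀ c₂ : ℤ} (h0 : HasChernIndex hA 0 c₀) (h2 : HasChernIndex hA 2 c₂)
    (h1 : ∃ F, IsBerryCurvature hA 1 F) : HasChernIndex hA 1 (-c₀ - c₂) := by
  rw [hasChernIndex_iff_exists] at h0 h2 ⊢
  obtain ⟨s0, F0, hF0, i0⟩ := h0
  obtain ⟨s2, F2, hF2, i2⟩ := h2
  obtain ⟨F1, hF1⟩ := h1
  have s1 : ∀ θ, IsSimpleBand (hA θ) 1 := fun θ => isSimpleBand_one (s0 θ) (s2 θ)
  refine ⟨s1, F1, hF1, ?_⟩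
  have hsum : ∀ θ, F1 θ = -(F0 θ + F2 θ) := by
    intro θ
    have := sum_isBerryCurvature (hA := hA) (F := ![F0, F1, F2]) (fun θ n => by
      fin_cases n
      exacts [s0 θ, s1 θ, s2 θ]) (fun n => by
      fin_cases n
      exacts [hF0, hF1, hF2]) θ
    rw [Fin.sum_univ_three] at this
    simp only [Matrix.cons_val] at this
    linear_combination this
  have hG : ∀ {F : ℝ × ℝ → ℂ}, Continuous F →
      Continuous fun t => ∫ y in (0 : ℝ)..2 * Real.pi, F (t, y) := fun {F} hF =>
    intervalIntegral.continuous_parametric_intervalIntegral_of_continuous'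
      (f := fun t y => F (t, y)) hF _ _
  have hin : ∀ t : ℝ, ∫ y in (0 : ℝ)..2 * Real.pi, F1 (t, y)
      = -((∫ y in (0 : ℝ)..2 * Real.pi, F0 (t, y)) + ∫ y in (0 : ℝ)..2 * Real.pi, F2 (t, y)) := by
    intro t
    have k0 : Continuous fun y => F0 (t, y) := hF0.1.comp (Continuous.prodMk_right t)
    have k2 : Continuous fun y => F2 (t, y) := hF2.1.comp (Continuous.prodMk_right t)
    simp only [hsum]
    rw [intervalIntegral.integral_neg, intervalIntegral.integral_add (k0.intervalIntegrable _ _)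
      (k2.intervalIntegrable _ _)]
  simp only [hin]
  rw [intervalIntegral.integral_neg, intervalIntegral.integral_add
    ((hG hF0.1).intervalIntegrable _ _) ((hG hF2.1).intervalIntegrable _ _)]
  push_cast
  linear_combination -i0 - i2

/-- The Chern index of the lowest level as a winding number. -/
theorem hasChernIndex_lowest {A : ℝ × ℝ → Matrix (Fin 3) (Fin 3) ℂ} (hA : ∀ θ, (A θ).IsHermitian)
    {d : ℝ → Fin 3 → ℝ} {a b κ : ℂ}
    (h : ∀ θ, A θ = hermThree (d θ.1) a b (rotatingEntry κ θ.2)) (hd : ContDiff ℝ ∞ d)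
    (hdp : ∀ t, d (t + 2 * Real.pi) = d t) (hn : ∀ θ, IsSimpleBand (hA θ) 0)
    (ha : a ≠ 0) (hb : b ≠ 0) (hκ : κ ≠ 0) (hw0 : ∀ t, windCurve d a b κ t ≠ 0) {c : ℤ}
    (hc : Complex.I / (2 * Real.pi) * ∫ t in (0 : ℝ)..2 * Real.pi,
      deriv (windCurve d a b κ) t / windCurve d a b κ t = c) : HasChernIndex hA 0 c := by
  obtain rfl : A = fun θ => hermThree (d θ.1) a b (rotatingEntry κ θ.2) := funext h
  obtain ⟨F, hF⟩ := exists_isBerryCurvature hA (hd.comp contDiff_fst) contDiff_const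
    contDiff_const ((contDiff_rotatingEntry κ).comp contDiff_snd) hn
  rw [hasChernIndex_iff_exists]
  refine ⟨hn, F, hF, ?_⟩
  rw [integral_lowest_eq_integral_windCurve hA hd hdp hn ha hb hκ hw0 hF, hc]

theorem exists_isBerryCurvature_of_eq {A : ℝ × ℝ → Matrix (Fin 3) (Fin 3) ℂ}
    (hA : ∀ θ, (A θ).IsHermitian) {d : ℝ → Fin 3 → ℝ} {a b κ : ℂ}
    (h : ∀ θ, A θ = hermThree (d θ.1) a b (rotatingEntry κ θ.2)) (hd : ContDiff ℝ ∞ d) {n : Fin 3}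
    (hn : ∀ θ, IsSimpleBand (hA θ) n) : ∃ F, IsBerryCurvature hA n F := by
  obtain rfl : A = fun θ => hermThree (d θ.1) a b (rotatingEntry κ θ.2) := funext h
  exact exists_isBerryCurvature hA (hd.comp contDiff_fst) contDiff_const
    contDiff_const ((contDiff_rotatingEntry κ).comp contDiff_snd) hn

end Transfer

/-! ### The model interaction matrix -/

namespace TunnelData

theorem norm_polar {m : ℝ} (hm : 0 < m) (φ : ℝ) : ‖polar m φ‖ = m := by
  rw [polar, norm_mul, mul_comm Complex.I, Complex.norm_exp_ofReal_mul_I, Complex.norm_real,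
    Real.norm_of_nonneg hm.le, mul_one]

theorem polar_re (m φ : ℝ) : (polar m φ).re = m * Real.cos φ := by
  rw [polar, mul_comm Complex.I, Complex.re_ofReal_mul, Complex.exp_ofReal_mul_I_re]

theorem polar_im (m φ : ℝ) : (polar m φ).im = m * Real.sin φ := by
  rw [polar, mul_comm Complex.I, Complex.im_ofReal_mul, Complex.exp_ofReal_mul_I_im]

/-- Both sides are the real part of `e^{-it}` times the difference of the two polar numbers, whose
modulus is given by the law of cosines. -/
theorem sqrt_mul_cos_sub_arg (m m' φ φ' t : ℝ) :
    Real.sqrt (m ^ 2 + m' ^ 2 - 2 * m * m' * Real.cos (φ - φ'))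
        * Real.cos (t - Complex.arg (polar m' φ' - polar m φ))
      = m' * Real.cos (φ' - t) - m * Real.cos (φ - t) := by
  set z := polar m' φ' - polar m φ with hz
  have hre : z.re = m' * Real.cos φ' - m * Real.cos φ := by
    rw [hz, Complex.sub_re, polar_re, polar_re]
  have him : z.im = m' * Real.sin φ' - m * Real.sin φ := by
    rw [hz, Complex.sub_im, polar_im, polar_im]
  have hn : Real.sqrt (m ^ 2 + m' ^ 2 - 2 * m * m' * Real.cos (φ - φ')) = ‖z‖ := by
    rw [Complex.norm_def, Complex.normSq_apply, hre, him, Real.cos_sub]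
    congr 1
    linear_combination -m' ^ 2 * Real.sin_sq_add_cos_sq φ' - m ^ 2 * Real.sin_sq_add_cos_sq φ
  rw [hn, Real.cos_sub, Real.cos_sub, Real.cos_sub]
  have h1 := Complex.norm_mul_cos_arg z
  have h2 := Complex.norm_mul_sin_arg z
  rw [hre] at h1
  rw [him] at h2
  linear_combination Real.cos t * h1 + Real.sin t * h2

theorem K1_mul_cos (p : TunnelData) (t : ℝ) : p.K1 * Real.cos (t - p.angle1)
    = p.m33 * Real.cos (p.φ33 - t) - p.m11 * Real.cos (p.φ11 - t) :=
  sqrt_mul_cos_sub_arg _ _ _ _ _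

theorem K2_mul_cos (p : TunnelData) (t : ℝ) : p.K2 * Real.cos (t - p.angle2)
    = p.m33 * Real.cos (p.φ33 - t) - p.m22 * Real.cos (p.φ22 - t) :=
  sqrt_mul_cos_sub_arg _ _ _ _ _

/-- The diagonal of the model matrix. -/
noncomputable def diag (p : TunnelData) (E : Fin 3 → ℝ) (t : ℝ) : Fin 3 → ℝ :=
  ![E 0 + p.m11 * Real.cos (p.φ11 - t), E 1 + p.m22 * Real.cos (p.φ22 - t),
    E 2 + p.m33 * Real.cos (p.φ33 - t)]

theorem contDiff_diag (p : TunnelData) (E : Fin 3 → ℝ) : ContDiff ℝ ∞ (p.diag E) := by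
  rw [contDiff_pi]
  intro i
  fin_cases i <;> simp [diag] <;> fun_prop

theorem diag_add_two_pi (p : TunnelData) (E : Fin 3 → ℝ) (t : ℝ) :
    p.diag E (t + 2 * Real.pi) = p.diag E t := by
  simp only [diag, ← sub_sub, Real.cos_sub_two_pi]

theorem polar_sub (m φ y : ℝ) : polar m (φ - y) = rotatingEntry (polar m φ) y := by
  rw [polar, rotatingEntry, polar, mul_assoc, ← Complex.exp_add]
  congr 2
  push_cast
  ring

theorem smul_matrix_eq (p : TunnelData) (E : Fin 3 → ℝ) (s : ℝ) (θ : ℝ × ℝ) :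
    (s : ℂ) • p.matrix E θ = hermThree (s • p.diag E θ.1) (s * polar p.m12 p.φ12)
      (s * polar p.m23 p.φ23) (rotatingEntry (s * polar p.m31 p.φ31) θ.2) := by
  have h : rotatingEntry (s * polar p.m31 p.φ31) θ.2 = s * polar p.m31 (p.φ31 - θ.2) := by
    rw [polar_sub, rotatingEntry, rotatingEntry, mul_assoc]
  rw [h]
  ext i j
  fin_cases i <;> fin_cases j <;> simp [matrix, hermThree, diag]

theorem polar_mul_polar_mul_polar (p : TunnelData) (θ : ℝ × ℝ) :
    polar p.m12 p.φ12 * polar p.m23 p.φ23 * rotatingEntry (polar p.m31 p.φ31) θ.2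
      = ((p.m12 * p.m23 * p.m31 : ℝ) : ℂ) * Complex.exp (Complex.I * (p.totalPhase θ : ℂ)) := by
  rw [← polar_sub, polar, polar, polar, totalPhase]
  have : Complex.I * ((p.φ12 + p.φ23 + p.φ31 - θ.2 : ℝ) : ℂ) = Complex.I * (p.φ12 : ℂ)
      + Complex.I * (p.φ23 : ℂ) + Complex.I * ((p.φ31 - θ.2 : ℝ) : ℂ) := by
    push_cast; ring
  rw [this, Complex.exp_add, Complex.exp_add]
  push_cast
  ring

section

variable (p : TunnelData) (hm12 : 0 < p.m12) (hm23 : 0 < p.m23) (hm31 : 0 < p.m31)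
  {ħ : ℝ} (hħ : 0 < ħ) {s : ℝ} (hs : s = 1 ∨ s = -1)

theorem isHermitian_smul (E : Fin 3 → ℝ) (s : ℝ) (θ : ℝ × ℝ) :
    ((s : ℂ) • p.matrix E θ).IsHermitian := by
  have h := p.matrix_isHermitian E θ
  rw [Matrix.IsHermitian, Matrix.conjTranspose_smul, h.eq, Complex.star_def, Complex.conj_ofReal]

include hm12 hm23 hm31 hs in
-- The origin of `Y1` and `Y2`: differences of the diagonal entries of the rank one matrix.
theorem rankOneDiag_polar :
    rankOneDiag (s * polar p.m12 p.φ12) (s * polar p.m23 p.φ23) (s * polar p.m31 p.φ31) 0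
      - rankOneDiag (s * polar p.m12 p.φ12) (s * polar p.m23 p.φ23) (s * polar p.m31 p.φ31) 2
      = p.Y1 ∧
    rankOneDiag (s * polar p.m12 p.φ12) (s * polar p.m23 p.φ23) (s * polar p.m31 p.φ31) 1
      - rankOneDiag (s * polar p.m12 p.φ12) (s * polar p.m23 p.φ23) (s * polar p.m31 p.φ31) 2
      = p.Y2 := by
  have h1 : ‖(s : ℂ)‖ = 1 := by
    rcases hs with rfl | rfl <;> simp
  simp only [rankOneDiag, norm_mul, h1, one_mul, norm_polar hm12, norm_polar hm23,
    norm_polar hm31, Y1, Y2, Matrix.cons_val]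
  constructor <;> ring

include hħ in
-- The parameter `t - α₂` turns the two angles on the curve into `t - α₁` and `t - α₂`, so the
-- cosines are those in the differences of the diagonal entries.
theorem gam_eq_ellipsePoint_iff (E : Fin 3 → ℝ) (t : ℝ) :
    gam ħ E = p.ellipsePoint ħ s (t - p.angle2) ↔
      p.diag E t 0 - p.diag E t 2 = s * p.Y1 ∧ p.diag E t 1 - p.diag E t 2 = s * p.Y2 := by
  have h1 := p.K1_mul_cos t
  have h2 := p.K2_mul_cos t
  have h3 : t - p.angle2 - p.eta = t - p.angle1 := by rw [eta]; ring
  rw [gam, ellipsePoint, Prod.mk.injEq, h3, h1, h2, div_left_inj' hħ.ne', div_left_inj' hħ.ne']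
  simp only [diag, Matrix.cons_val]
  constructor <;> rintro ⟨h4, h5⟩ <;> constructor <;> linarith

include hm12 hm23 hm31 hħ hs

/-- The off-diagonal product of `s • A` carries the factor `s ^ 3 = s`, so its positivity reads `exp
(iΘ) = s`; the signs in the diagonal equations move to `Y1` and `Y2`. -/
theorem bandEnergy_smul_zero_eq_one_iff (E : Fin 3 → ℝ) (θ : ℝ × ℝ) :
    bandEnergy (p.isHermitian_smul E s θ) 0 = bandEnergy (p.isHermitian_smul E s θ) 1 ↔
      Complex.exp (Complex.I * (p.totalPhase θ : ℂ)) = s ∧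
        gam ħ E = p.ellipsePoint ħ s (θ.1 - p.angle2) := by
  have hs1 : ‖(s : ℂ)‖ = 1 := by
    rcases hs with rfl | rfl <;> simp
  have hss : s * s = 1 := by
    rcases hs with rfl | rfl <;> simp
  have hssC : (s : ℂ) * s = 1 := by exact_mod_cast hss
  have hs0 : (s : ℂ) ≠ 0 := left_ne_zero_of_mul_eq_one hssC
  have ha : (s : ℂ) * polar p.m12 p.φ12 ≠ 0 := mul_ne_zero hs0
    (norm_pos_iff.1 (by rw [norm_polar hm12]; exact hm12))
  have hb : (s : ℂ) * polar p.m23 p.φ23 ≠ 0 := mul_ne_zero hs0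
    (norm_pos_iff.1 (by rw [norm_polar hm23]; exact hm23))
  have hκ : (s : ℂ) * polar p.m31 p.φ31 ≠ 0 := mul_ne_zero hs0
    (norm_pos_iff.1 (by rw [norm_polar hm31]; exact hm31))
  have hB : (hermThree (s • p.diag E θ.1) (s * polar p.m12 p.φ12)
      (s * polar p.m23 p.φ23) (rotatingEntry (s * polar p.m31 p.φ31) θ.2)).IsHermitian := by
    rw [← smul_matrix_eq]
    exact p.isHermitian_smul E s θ
  rw [bandEnergy_congr (p.smul_matrix_eq E s θ) _ hB, bandEnergy_congr (p.smul_matrix_eq E s θ) _ hB,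
    bandEnergy_zero_eq_one_iff hB ha hb (rotatingEntry_ne_zero hκ _), rankOneDiag_rotatingEntry,
    (p.rankOneDiag_polar hm12 hm23 hm31 hs).1, (p.rankOneDiag_polar hm12 hm23 hm31 hs).2,
    p.gam_eq_ellipsePoint_iff hħ, norm_rotatingEntry, norm_mul, norm_mul, norm_mul, hs1,
    norm_polar hm12, norm_polar hm23, norm_polar hm31]
  refine and_congr ?_ (and_congr ?_ ?_)
  · have h1 : (s : ℂ) * polar p.m12 p.φ12 * (s * polar p.m23 p.φ23)
        * rotatingEntry (s * polar p.m31 p.φ31) θ.2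
        = s * (((p.m12 * p.m23 * p.m31 : ℝ) : ℂ)
          * Complex.exp (Complex.I * (p.totalPhase θ : ℂ))) := by
      rw [← polar_mul_polar_mul_polar, rotatingEntry, rotatingEntry]
      linear_combination (s * polar p.m12 p.φ12 * polar p.m23 p.φ23 * (polar p.m31 p.φ31
        * Complex.exp (-(Complex.I * (θ.2 : ℂ))))) * hssC
    have h2 : ((p.m12 * p.m23 * p.m31 : ℝ) : ℂ) ≠ 0 := by
      exact_mod_cast (mul_pos (mul_pos hm12 hm23) hm31).ne'
    rw [h1, one_mul, one_mul, one_mul]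
    constructor
    · intro h
      refine mul_left_cancel₀ h2 ?_
      linear_combination s * h - (((p.m12 * p.m23 * p.m31 : ℝ) : ℂ)
          * Complex.exp (Complex.I * (p.totalPhase θ : ℂ))) * hssC
    · intro h
      rw [h]
      linear_combination ((p.m12 * p.m23 * p.m31 : ℝ) : ℂ) * hssC
  · simp only [Pi.smul_apply, smul_eq_mul, ← mul_sub]
    rcases hs with rfl | rfl
    · simp
    · constructor <;> intro h <;> linarith
  · simp only [Pi.smul_apply, smul_eq_mul, ← mul_sub]
    rcases hs with rfl | rfl
    · simp
    · constructor <;> intro h <;> linarith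

/-- The wind curve is `s` times a cosine curve `v`. The factor `s` drops out of the logarithmic
derivative, and a zero of `v` would place `γ` on the ellipse. -/
theorem hasChernIndex_smul_zero (E : Fin 3 → ℝ) (hE : gam ħ E ∉ p.ellipse ħ s) :
    HasChernIndex (p.isHermitian_smul E s) 0 (p.jump ħ s (gam ħ E)) := by
  have hss : s * s = 1 := by
    rcases hs with rfl | rfl <;> simp
  have hssC : (s : ℂ) * s = 1 := by exact_mod_cast hss
  have hs0 : (s : ℂ) ≠ 0 := left_ne_zero_of_mul_eq_one hssC
  have ha : (s : ℂ) * polar p.m12 p.φ12 ≠ 0 := mul_ne_zero hs0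
    (norm_pos_iff.1 (by rw [norm_polar hm12]; exact hm12))
  have hb : (s : ℂ) * polar p.m23 p.φ23 ≠ 0 := mul_ne_zero hs0
    (norm_pos_iff.1 (by rw [norm_polar hm23]; exact hm23))
  have hκ : (s : ℂ) * polar p.m31 p.φ31 ≠ 0 := mul_ne_zero hs0
    (norm_pos_iff.1 (by rw [norm_polar hm31]; exact hm31))
  obtain ⟨hY1, hY2⟩ := p.rankOneDiag_polar hm12 hm23 hm31 hs
  set w := windCurve (fun t => s • p.diag E t) (s * polar p.m12 p.φ12) (s * polar p.m23 p.φ23)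
    (s * polar p.m31 p.φ31) with hw
  set x₁ := ħ * (gam ħ E).1 - s * p.Y1 with hx₁
  set x₂ := ħ * (gam ħ E).2 - s * p.Y2 with hx₂
  have hg1 : ħ * (gam ħ E).1 = E 0 - E 2 := mul_div_cancel₀ _ hħ.ne'
  have hg2 : ħ * (gam ħ E).2 = E 1 - E 2 := mul_div_cancel₀ _ hħ.ne'
  set v : ℝ → ℂ := fun t => ((p.K1 * Real.cos (t - p.angle1) - x₁ : ℝ) : ℂ)
      + ((p.K2 * Real.cos (t - p.angle2) - x₂ : ℝ) : ℂ) * Complex.I with hv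
  have hwv : ∀ t, w t = s * v t := by
    intro t
    simp only [hw, hv, windCurve, hY1, hY2, hx₁, hx₂, hg1, hg2, K1_mul_cos, K2_mul_cos, diag,
      Pi.smul_apply, smul_eq_mul, Matrix.cons_val]
    push_cast
    linear_combination (-(p.Y1 : ℂ) - p.Y2 * Complex.I) * hssC
  have hv0 : ∀ t, v t ≠ 0 := by
    intro t h0
    refine hE ⟨t - p.angle2, ((p.gam_eq_ellipsePoint_iff hħ E t).2 ?_).symm⟩
    have h1 := congrArg Complex.re h0
    have h2 := congrArg Complex.im h0
    simp only [hv, Complex.add_re, Complex.add_im, Complex.ofReal_re, Complex.ofReal_im,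
      Complex.re_ofReal_mul, Complex.im_ofReal_mul, Complex.I_re, Complex.I_im, mul_zero, add_zero,
      mul_one, zero_add, Complex.zero_re, Complex.zero_im, K1_mul_cos, K2_mul_cos, hx₁, hx₂, hg1,
      hg2] at h1 h2
    simp only [diag, Matrix.cons_val]
    constructor <;> linarith
  have hsimple : ∀ θ, IsSimpleBand (p.isHermitian_smul E s θ) 0 := by
    intro θ
    rw [isSimpleBand_zero_iff, ne_eq, p.bandEnergy_smul_zero_eq_one_iff hm12 hm23 hm31 hħ hs]
    rintro ⟨-, h⟩
    exact hE ⟨_, h.symm⟩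
  have hder : ∀ t, deriv w t / w t = deriv v t / v t := by
    intro t
    have : w = fun t => (s : ℂ) * v t := funext hwv
    rw [this, deriv_const_mul_field, mul_div_mul_left _ _ hs0]
  refine hasChernIndex_lowest _ (p.smul_matrix_eq E s) (d := fun t => s • p.diag E t)
    ((p.contDiff_diag E).const_smul s)
    (fun t => by simp only [diag_add_two_pi]) hsimple ha hb hκ
    (fun t => by rw [← hw, hwv]; exact mul_ne_zero hs0 (hv0 t)) ?_
  rw [← hw]
  simp only [hder]
  rw [integral_logDeriv_cosCurve (K₁ := p.K1) (K₂ := p.K2) (α₁ := p.angle1) (α₂ := p.angle2)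
    (x₁ := x₁) (x₂ := x₂) (Real.sqrt_nonneg _) (Real.sqrt_nonneg _) (w := v) (fun t => rfl) hv0]
  simp only [jump, ellipseForm, eta, ← hx₁, ← hx₂]
  split_ifs
  · have := Real.pi_ne_zero
    field_simp
    rw [Complex.I_sq]
    ring
  · simp

end

/-! ### The ellipses -/

theorem ellipse_eq_setOf_ellipseForm_eq_zero (p : TunnelData) {ħ : ℝ} (hħ : 0 < ħ) (s : ℝ)
    (hK : p.K1 * p.K2 * Real.sin p.eta ≠ 0) :
    p.ellipse ħ s = {g | p.ellipseForm ħ s g = 0} := by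
  have hK1 : p.K1 ≠ 0 := left_ne_zero_of_mul (left_ne_zero_of_mul hK)
  have hK2 : p.K2 ≠ 0 := right_ne_zero_of_mul (left_ne_zero_of_mul hK)
  have hsin : Real.sin p.eta ≠ 0 := right_ne_zero_of_mul hK
  have hη := Real.sin_sq_add_cos_sq p.eta
  ext g
  constructor
  · rintro ⟨t, rfl⟩
    have ht := Real.sin_sq_add_cos_sq t
    simp only [Set.mem_ofPred_eq, ellipseForm, ellipsePoint, mul_div_cancel₀ _ hħ.ne',
      add_sub_cancel_right, Real.cos_sub]
    linear_combination (p.K1 * p.K2 * Real.sin p.eta) ^ 2 * ht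
      - (p.K1 * p.K2 * Real.cos t) ^ 2 * hη
  · intro hg
    simp only [Set.mem_ofPred_eq, ellipseForm] at hg
    set x := ħ * g.1 - s * p.Y1 with hx
    set y := ħ * g.2 - s * p.Y2 with hy
    -- Solve the parametrization for `cos t` and, through the addition formula, for `sin t`; the
    -- quadratic equation says that they lie on the unit circle.
    have h1 : (y / p.K2) ^ 2 + ((x / p.K1 - y / p.K2 * Real.cos p.eta) / Real.sin p.eta) ^ 2 = 1 := by
      field_simp
      linear_combination hg + p.K1 ^ 2 * y ^ 2 * hη
    set z : ℂ := ⟨y / p.K2, (x / p.K1 - y / p.K2 * Real.cos p.eta) / Real.sin p.eta⟩ with hz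
    have hn : ‖z‖ = 1 := by
      rw [Complex.norm_def, Complex.normSq_apply, ← sq, ← sq, h1, Real.sqrt_one]
    have hc := Complex.norm_mul_cos_arg z
    have hsn := Complex.norm_mul_sin_arg z
    rw [hn, one_mul] at hc hsn
    refine ⟨z.arg, ?_⟩
    rw [ellipsePoint, Real.cos_sub, hc, hsn]
    apply Prod.ext
    · rw [div_eq_iff hħ.ne']
      simp only [hz]
      field_simp
      rw [hx]
      ring
    · rw [div_eq_iff hħ.ne']
      simp only [hz]
      field_simp
      rw [hy]
      ring

/-- The substitution `t ↦ η - t` exchanges `cos t` and `cos (t - η)`; a further shift by `π` changes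
both signs. -/
theorem ellipse_symm (p : TunnelData) {ħ s : ℝ} (hK : p.K1 = p.K2) {u v : ℝ}
    (h : (s * p.Y1 / ħ + u, s * p.Y2 / ħ + v) ∈ p.ellipse ħ s) :
    (s * p.Y1 / ħ + v, s * p.Y2 / ħ + u) ∈ p.ellipse ħ s ∧
      (s * p.Y1 / ħ - v, s * p.Y2 / ħ - u) ∈ p.ellipse ħ s := by
  obtain ⟨t, ht⟩ := h
  rw [ellipsePoint, Prod.mk.injEq, add_div, add_div, add_comm, add_right_inj, add_comm,
    add_right_inj, hK] at ht
  obtain ⟨h1, h2⟩ := ht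
  have e1 : p.eta - t - p.eta = -t := by ring
  have e2 : p.eta - t + Real.pi - p.eta = -t + Real.pi := by ring
  have e3 : Real.cos (p.eta - t) = Real.cos (t - p.eta) := by rw [← Real.cos_neg, neg_sub]
  constructor
  · refine ⟨p.eta - t, ?_⟩
    rw [ellipsePoint, e1, Real.cos_neg, e3, ← h1, ← h2, hK]
    ring_nf
  · refine ⟨p.eta - t + Real.pi, ?_⟩
    rw [ellipsePoint, e2, Real.cos_add_pi, Real.cos_add_pi, Real.cos_neg, e3, ← h1, ← h2, hK]
    ring_nf

end TunnelData

/-! ### Results for the three levels of the model -/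

namespace TunnelData

section

variable (p : TunnelData) (hm12 : 0 < p.m12) (hm23 : 0 < p.m23) (hm31 : 0 < p.m31)
  {ħ : ℝ} (hħ : 0 < ħ)

theorem band_eq_smul_one (E : Fin 3 → ℝ) (θ : ℝ × ℝ) (n : Fin 3) :
    p.band E θ n = bandEnergy (p.isHermitian_smul E 1 θ) n :=
  bandEnergy_congr (by simp) _ _ n

theorem band_eq_smul_neg_one (E : Fin 3 → ℝ) (θ : ℝ × ℝ) (n : Fin 3) :
    p.band E θ n = -bandEnergy (p.isHermitian_smul E (-1) θ) n.rev :=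
  bandEnergy_neg _ _ (by simp) n

include hm12 hm23 hm31 hħ

theorem band_zero_eq_one_iff (E : Fin 3 → ℝ) (θ : ℝ × ℝ) : p.band E θ 0 = p.band E θ 1 ↔
    Complex.exp (Complex.I * (p.totalPhase θ : ℂ)) = 1 ∧
      gam ħ E = p.ellipsePoint ħ 1 (θ.1 - p.angle2) := by
  rw [band_eq_smul_one, band_eq_smul_one,
    p.bandEnergy_smul_zero_eq_one_iff hm12 hm23 hm31 hħ (Or.inl rfl), Complex.ofReal_one]

theorem band_one_eq_two_iff (E : Fin 3 → ℝ) (θ : ℝ × ℝ) : p.band E θ 1 = p.band E θ 2 ↔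
    Complex.exp (Complex.I * (p.totalPhase θ : ℂ)) = -1 ∧
      gam ħ E = p.ellipsePoint ħ (-1) (θ.1 - p.angle2) := by
  rw [band_eq_smul_neg_one, band_eq_smul_neg_one, neg_inj, eq_comm]
  exact (p.bandEnergy_smul_zero_eq_one_iff hm12 hm23 hm31 hħ (Or.inr rfl) E θ).trans
    (and_congr_left' (by rw [Complex.ofReal_neg, Complex.ofReal_one]))

omit hm12 hm23 hm31 in
-- The angle `θ₂` enters only the total phase, so the phase condition can be met independently of
-- `γ` and `θ₁`; hence the whole curve is attained.
theorem exists_gam_eq_and_totalPhase (s t x : ℝ) : ∃ (E : Fin 3 → ℝ) (θ : ℝ × ℝ),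
    gam ħ E = p.ellipsePoint ħ s t ∧ p.totalPhase θ = x ∧ θ.1 - p.angle2 = t := by
  refine ⟨![ħ * (p.ellipsePoint ħ s t).1, ħ * (p.ellipsePoint ħ s t).2, 0],
    (t + p.angle2, p.φ12 + p.φ23 + p.φ31 - x), ?_, ?_, ?_⟩
  · simp [gam, hħ.ne']
  · simp [totalPhase]
  · simp

theorem setOf_band_zero_eq_one : {g | ∃ (E : Fin 3 → ℝ) (θ : ℝ × ℝ),
    gam ħ E = g ∧ p.band E θ 0 = p.band E θ 1} = p.ellipse ħ 1 := by
  ext g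
  constructor
  · rintro ⟨E, θ, rfl, h⟩
    exact ⟨_, (((p.band_zero_eq_one_iff hm12 hm23 hm31 hħ E θ).1 h).2).symm⟩
  · rintro ⟨t, rfl⟩
    obtain ⟨E, θ, h1, h2, h3⟩ := p.exists_gam_eq_and_totalPhase hħ 1 t 0
    refine ⟨E, θ, h1, (p.band_zero_eq_one_iff hm12 hm23 hm31 hħ E θ).2 ⟨?_, ?_⟩⟩
    · simp [h2]
    · rw [h3, h1]

theorem setOf_band_one_eq_two : {g | ∃ (E : Fin 3 → ℝ) (θ : ℝ × ℝ),
    gam ħ E = g ∧ p.band E θ 1 = p.band E θ 2} = p.ellipse ħ (-1) := by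
  ext g
  constructor
  · rintro ⟨E, θ, rfl, h⟩
    exact ⟨_, (((p.band_one_eq_two_iff hm12 hm23 hm31 hħ E θ).1 h).2).symm⟩
  · rintro ⟨t, rfl⟩
    obtain ⟨E, θ, h1, h2, h3⟩ := p.exists_gam_eq_and_totalPhase hħ (-1) t Real.pi
    refine ⟨E, θ, h1, (p.band_one_eq_two_iff hm12 hm23 hm31 hħ E θ).2 ⟨?_, ?_⟩⟩
    · rw [h2, mul_comm, Complex.exp_pi_mul_I]
    · rw [h3, h1]

theorem hasChernIndex_zero (E : Fin 3 → ℝ) (hE : gam ħ E ∉ p.ellipse ħ 1) :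
    HasChernIndex (p.matrix_isHermitian E) 0 (p.jump ħ 1 (gam ħ E)) :=
  (p.hasChernIndex_smul_zero hm12 hm23 hm31 hħ (Or.inl rfl) E hE).congr
    (by funext θ; simp) _

theorem hasChernIndex_two (E : Fin 3 → ℝ) (hE : gam ħ E ∉ p.ellipse ħ (-1)) :
    HasChernIndex (p.matrix_isHermitian E) 2 (p.jump ħ (-1) (gam ħ E)) :=
  (p.hasChernIndex_smul_zero hm12 hm23 hm31 hħ (Or.inr rfl) E hE).neg
    (p.matrix_isHermitian E) (by intro θ; simp)

end

end TunnelData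

theorem mainTheorem2 (p : TunnelData) (hm12 : 0 < p.m12) (hm23 : 0 < p.m23) (hm31 : 0 < p.m31)
    (ħ : ℝ) (hħ : 0 < ħ) :
    -- where the levels are degenerate, with `s = exp (iΘ)` and `t = θ₁ - α₂`
    (∀ (E : Fin 3 → ℝ) (θ : ℝ × ℝ), p.band E θ 0 = p.band E θ 1 ↔
      Complex.exp (Complex.I * (p.totalPhase θ : ℂ)) = 1 ∧
        TunnelData.gam ħ E = p.ellipsePoint ħ 1 (θ.1 - p.angle2)) ∧
    (∀ (E : Fin 3 → ℝ) (θ : ℝ × ℝ), p.band E θ 1 = p.band E θ 2 ↔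
      Complex.exp (Complex.I * (p.totalPhase θ : ℂ)) = -1 ∧
        TunnelData.gam ħ E = p.ellipsePoint ħ (-1) (θ.1 - p.angle2)) ∧
    -- the degeneracy loci in the plane `(γ₁, γ₂)`
    {g | ∃ (E : Fin 3 → ℝ) (θ : ℝ × ℝ), TunnelData.gam ħ E = g ∧ p.band E θ 0 = p.band E θ 1}
      = p.ellipse ħ 1 ∧
    {g | ∃ (E : Fin 3 → ℝ) (θ : ℝ × ℝ), TunnelData.gam ħ E = g ∧ p.band E θ 1 = p.band E θ 2}
      = p.ellipse ħ (-1) ∧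
    -- they are ellipses, with axes parallel to `γ₁ = ± γ₂` when `K₁ = K₂`
    (p.K1 * p.K2 * Real.sin p.eta ≠ 0 → ∀ s : ℝ, s = 1 ∨ s = -1 →
      p.ellipse ħ s = {g | p.ellipseForm ħ s g = 0}) ∧
    (p.K1 = p.K2 → ∀ s : ℝ, s = 1 ∨ s = -1 → ∀ u v : ℝ,
      (s * p.Y1 / ħ + u, s * p.Y2 / ħ + v) ∈ p.ellipse ħ s →
        (s * p.Y1 / ħ + v, s * p.Y2 / ħ + u) ∈ p.ellipse ħ s ∧
        (s * p.Y1 / ħ - v, s * p.Y2 / ħ - u) ∈ p.ellipse ħ s) ∧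
    -- the Chern indices of the three levels
    (∀ E : Fin 3 → ℝ, TunnelData.gam ħ E ∉ p.ellipse ħ 1 →
      HasChernIndex (p.matrix_isHermitian E) 0 (p.jump ħ 1 (TunnelData.gam ħ E))) ∧
    (∀ E : Fin 3 → ℝ, TunnelData.gam ħ E ∉ p.ellipse ħ 1 → TunnelData.gam ħ E ∉ p.ellipse ħ (-1) →
      HasChernIndex (p.matrix_isHermitian E) 1
        (-p.jump ħ 1 (TunnelData.gam ħ E) - p.jump ħ (-1) (TunnelData.gam ħ E))) ∧
    (∀ E : Fin 3 → ℝ, TunnelData.gam ħ E ∉ p.ellipse ħ (-1) →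
      HasChernIndex (p.matrix_isHermitian E) 2 (p.jump ħ (-1) (TunnelData.gam ħ E))) := by
  refine ⟨p.band_zero_eq_one_iff hm12 hm23 hm31 hħ, p.band_one_eq_two_iff hm12 hm23 hm31 hħ,
    p.setOf_band_zero_eq_one hm12 hm23 hm31 hħ, p.setOf_band_one_eq_two hm12 hm23 hm31 hħ,
    fun hK s _ => p.ellipse_eq_setOf_ellipseForm_eq_zero hħ s hK,
    fun hK s _ u v h => p.ellipse_symm hK h, p.hasChernIndex_zero hm12 hm23 hm31 hħ, ?_,
    p.hasChernIndex_two hm12 hm23 hm31 hħ⟩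
  intro E h1 h2
  have c0 := p.hasChernIndex_zero hm12 hm23 hm31 hħ E h1
  have c2 := p.hasChernIndex_two hm12 hm23 hm31 hħ E h2
  have h (θ : ℝ × ℝ) := p.smul_matrix_eq E 1 θ
  simp only [Complex.ofReal_one, one_smul] at h
  exact hasChernIndex_one c0 c2 (exists_isBerryCurvature_of_eq _ h (p.contDiff_diag E)
    fun θ => isSimpleBand_one (c0.1 θ) (c2.1 θ))
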